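/- **Theorem (Gate).** Let $\mathbb{T}^2$ be the triangular lattice and let $\Lambda$ be the set of the $2L^2$ triangular faces of a parallelogram of side length $L$ cut along two coordinate axes of $\mathbb{T}^2$, with periodic boundary conditions; two faces are nearest neighbors if they share an edge (so $\Lambda$ is a hexagonal lattice on a torus). On $\mathcal X=\{-1,+1\}^\Lambda$ let $$H(\sigma)=-\frac J2\sum_{\{i,j\}}\sigma(i)\sigma(j)-\frac h2\sum_{i\in\Lambda}\sigma(i),$$ the first sum being over unordered pairs of nearest neighbors. Assume $0<h<1$, $J\ge 2h$, $|\Lambda|=2L^2\ge(4J/h)^2$. Let $r^*=\lfloor\frac J{2h}-\frac12\rfloor$ and $\delta=\frac J{2h}-\frac12-r^*$, assume $\delta\notin\{0,\frac12\}$, and put $$A^*=\begin{cases}6{r^*}^2+10r^*+5&\text{if }0<\delta<\frac12,\\ 6(r^*+1)^2+2(r^*+1)+1&\text{if }\frac12<\delta<1.\end{cases}$$ A path is a finite sequence of configurations in which consecutive ones differ by a single spin flip; $\Phi(\sigma,\eta)$ is the minimum over the paths from $\sigma$ to $\eta$ of the maximum of $H$ along the path, and a path is optimal if it attains this minimum.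 The set $\mathscr S(\sigma,\eta)$ of minimal saddles consists of the $\zeta$ lying on some path from $\sigma$ to $\eta$ whose maximal energy is $H(\zeta)=\Phi(\sigma,\eta)$. A gate is a set $\mathcal W\subseteq\mathscr S(\sigma,\eta)$ met by every optimal path from $\sigma$ to $\eta$; it is minimal if each proper subset of $\mathcal W$ is avoided by some optimal path. The quasi-regular hexagon $E_{B_i}(r)$ ($r\ge1$, $0\le i\le5$) is obtained from the regular hexagon $E(r)$ of radius $r$ by attaching bars (rows of faces, of $2l-1$ faces on a side of length $l$) to $i$ consecutive sides, one after the other, inside the concentric regular hexagon $E(r+1)$; all its translates and rotations by multiples of $\pi/3$ are allowed. For $A\in\mathbb N$ let $\tilde{\mathcal S}(A)$ be the set of configurations whose pluses form a single cluster, of area (number of faces) $A$, that consists of a quasi-regular hexagon and an elementary rhombus (two faces sharing an edge) contained in the bar on one of its longest sides. Let $\tilde{\mathcal D}(A)$ be the set of configurations whose pluses form a single cluster, of area $A$, that consists of a quasi-regular hexagon and two faces attached to one and the same longest side of it, at lattice distance $2$ from one another. Then every optimal path from $\underline{-1}$ (all spins $-1$) to $\underline{+1}$ (all spins $+1$) visits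 $\tilde{\mathcal S}(A^*)\cup\tilde{\mathcal D}(A^*)$, and $\tilde{\mathcal S}(A^*)\cup\tilde{\mathcal D}(A^*)$ is the union of all minimal gates for the transition from $\underline{-1}$ to $\underline{+1}$. -/

import Mathlib

noncomputable section

namespace HexIsing

/-! ### The hexagonal lattice as the dual of the triangular lattice -/

/-- Faces of the triangular lattice with coordinates in `R`, which are the sites of the hexagonal
lattice.  In the lattice basis `e₁, e₂` (unit vectors at angle `π / 3`), the face `((x, y), true)`
is the triangle with vertices `(x, y), (x + 1, y), (x, y + 1)` and the face `((x, y), false)` is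
the triangle with vertices `(x + 1, y), (x, y + 1), (x + 1, y + 1)`.
With `R = ℤ` this is the infinite planar lattice; with `R = ZMod L` it is the parallelogram of side
length `L` cut along two coordinate axes of the triangular lattice, with periodic boundary. -/
abbrev Site (R : Type) : Type := (R × R) × Bool

/-- The hexagonal lattice: two faces of the triangular lattice are nearest neighbors iff they
share an edge.  The triangle `((x, y), true)` has the neighbors `((x, y), false)`,
`((x - 1, y), false)` and `((x, y - 1), false)`. -/
def hexLattice (R : Type) [CommRing R] : SimpleGraph (Site R) :=
  SimpleGraph.fromRel fun s t =>
    s.2 = true ∧ t.2 = false ∧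
      (t.1 = s.1 ∨ t.1 = (s.1.1 - 1, s.1.2) ∨ t.1 = (s.1.1, s.1.2 - 1))

/-! ### The Ising model -/

/-- Spin configurations on the torus: every site carries a spin in `{-1, +1}`. -/
abbrev Config (L : ℕ) : Type := Site (ZMod L) → ℤˣ

/-- All spins are `-1`. -/
def allMinus (L : ℕ) : Config L := fun _ => -1

/-- All spins are `+1`. -/
def allPlus (L : ℕ) : Config L := fun _ => 1

/-- The set of sites with spin `+1`. -/
def plusSet {L : ℕ} (σ : Config L) : Set (Site (ZMod L)) := {s | σ s = 1}

open Classical in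
/-- The Hamiltonian `H(σ) = -(J/2) ∑_{{i,j}} σ(i) σ(j) - (h/2) ∑_i σ(i)`; the first sum is over
the unordered pairs of nearest neighbors. -/
def hamiltonian {L : ℕ} [NeZero L] (J h : ℝ) (σ : Config L) : ℝ :=
  -(J / 2) * ∑ e ∈ (hexLattice (ZMod L)).edgeFinset, (e.map fun s => ((σ s : ℤ) : ℝ)).mul
    - (h / 2) * ∑ s : Site (ZMod L), ((σ s : ℤ) : ℝ)

/-- The configuration `σ^(x)`: the spin at `x` is flipped. -/
def flip {L : ℕ} (σ : Config L) (x : Site (ZMod L)) : Config L := Function.update σ x (-σ x)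

theorem flip_flip {L : ℕ} (σ : Config L) (x : Site (ZMod L)) : flip (flip σ x) x = σ := by
  simp [flip]

theorem flip_ne {L : ℕ} (σ : Config L) (x : Site (ZMod L)) : flip σ x ≠ σ := by
  intro hh
  have h1 := congrFun hh x
  simp only [flip, Function.update_self] at h1
  rcases Int.units_eq_one_or (σ x) with h2 | h2 <;> rw [h2] at h1 <;> exact absurd h1 (by decide)

/-- The graph of single spin flips.  The walks in this graph are the paths of configurations. -/
def flipGraph (L : ℕ) : SimpleGraph (Config L) where
  Adj σ η := ∃ x, η = flip σ x
  symm := ⟨fun σ _ ⟨x, hx⟩ => ⟨x, by rw [hx, flip_flip]⟩⟩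
  loopless := ⟨fun σ ⟨x, hx⟩ => flip_ne σ x hx.symm⟩

/-- A path of configurations from `σ` to `η`, where consecutive ones differ by one spin flip. -/
abbrev Path {L : ℕ} (σ η : Config L) : Type := (flipGraph L).Walk σ η

/-- The maximum of the energy along a path. -/
def height {L : ℕ} [NeZero L] (J h : ℝ) {σ η : Config L} (ω : Path σ η) : ℝ :=
  ω.support.toFinset.sup' ⟨σ, by simp⟩ (hamiltonian J h)

/-- The communication height `Φ(σ, η)`: the minimum, over all paths from `σ` to `η`, of the maximum
of the energy along the path. -/
def commHeight {L : ℕ} [NeZero L] (J h : ℝ) (σ η : Config L) : ℝ :=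
  ⨅ ω : Path σ η, height J h ω

theorem flipGraph_preconnected (L : ℕ) [NeZero L] : (flipGraph L).Preconnected := by
  intro σ η
  suffices H : ∀ (s : Finset (Site (ZMod L))) (σ : Config L), (∀ x, x ∉ s → σ x = η x) →
      (flipGraph L).Reachable σ η from H Finset.univ σ (by simp)
  intro s
  induction s using Finset.induction_on with
  | empty =>
    intro σ hs
    have : σ = η := funext fun x => hs x (by simp)
    rw [this]
  | insert a s ha ih =>
    intro σ hs
    by_cases haη : σ a = η a
    · refine ih σ fun x hx => ?_
      by_cases hxa : x = a
      · rw [hxa, haη]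
      · exact hs x (by simp [hxa, hx])
    · have h1 : (flipGraph L).Adj σ (flip σ a) := ⟨a, rfl⟩
      refine h1.reachable.trans (ih _ fun x hx => ?_)
      by_cases hxa : x = a
      · subst hxa
        simp only [flip, Function.update_self]
        rcases Int.units_eq_one_or (σ x) with h2 | h2 <;>
          rcases Int.units_eq_one_or (η x) with h3 | h3 <;> simp_all
      · simp only [flip, Function.update_of_ne hxa]
        exact hs x (by simp [hxa, hx])

/-- The infimum in the definition of the communication height is a minimum. -/
theorem commHeight_isLeast {L : ℕ} [NeZero L] (J h : ℝ) (σ η : Config L) :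
    IsLeast (Set.range fun ω : Path σ η => height J h ω) (commHeight J h σ η) := by
  have hfin : (Set.range fun ω : Path σ η => height J h ω).Finite := by
    refine (Set.finite_range (hamiltonian J h : Config L → ℝ)).subset ?_
    rintro _ ⟨ω, rfl⟩
    obtain ⟨ζ, -, hζ⟩ := Finset.exists_mem_eq_sup' (s := ω.support.toFinset)
      ⟨σ, by simp⟩ (hamiltonian J h)
    exact ⟨ζ, hζ.symm⟩
  have hne : (Set.range fun ω : Path σ η => height J h ω).Nonempty := by
    obtain ⟨ω⟩ := flipGraph_preconnected L σ η
    exact ⟨_, ω, rfl⟩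
  exact ⟨hne.csInf_mem hfin, fun _ hx => csInf_le hfin.bddBelow hx⟩

/-- Optimal paths: those that realize the min-max `Φ(σ, η)`. -/
def IsOptimal {L : ℕ} [NeZero L] (J h : ℝ) {σ η : Config L} (ω : Path σ η) : Prop :=
  height J h ω = commHeight J h σ η

/-- The set of minimal saddles between `σ` and `η`. -/
def saddles {L : ℕ} [NeZero L] (J h : ℝ) (σ η : Config L) : Set (Config L) :=
  {ζ | ∃ ω : Path σ η, ζ ∈ ω.support ∧ height J h ω = hamiltonian J h ζ ∧
    hamiltonian J h ζ = commHeight J h σ η}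

/-- A gate for the transition from `σ` to `η`: a set of minimal saddles that is visited by every
optimal path. -/
def IsGate {L : ℕ} [NeZero L] (J h : ℝ) (σ η : Config L) (W : Set (Config L)) : Prop :=
  W ⊆ saddles J h σ η ∧ ∀ ω : Path σ η, IsOptimal J h ω → ∃ ζ ∈ ω.support, ζ ∈ W

/-- A minimal gate: a gate such that every proper subset is avoided by some optimal path. -/
def IsMinimalGate {L : ℕ} [NeZero L] (J h : ℝ) (σ η : Config L) (W : Set (Config L)) : Prop :=
  IsGate J h σ η W ∧
    ∀ W' : Set (Config L), W' ⊂ W →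
      ∃ ω : Path σ η, IsOptimal J h ω ∧ ∀ ζ ∈ ω.support, ζ ∉ W'

/-- The union of all minimal gates for the transition from `σ` to `η`. -/
def minimalGatesUnion {L : ℕ} [NeZero L] (J h : ℝ) (σ η : Config L) : Set (Config L) :=
  ⋃₀ {W | IsMinimalGate J h σ η W}

/-! ### Shapes in the plane -/

/-- The three vertices of a face of the planar triangular lattice. -/
def vertices (f : Site ℤ) : Finset (ℤ × ℤ) :=
  if f.2 then {f.1, (f.1.1 + 1, f.1.2), (f.1.1, f.1.2 + 1)}
  else {(f.1.1 + 1, f.1.2), (f.1.1, f.1.2 + 1), (f.1.1 + 1, f.1.2 + 1)}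

/-- The six linear forms, in counter-clockwise order, whose level lines are the lines of the
triangular lattice.  They are the outer normals of the six sides of a lattice hexagon; in the
lattice basis the hexagonal norm of `v` is `max_k sideForm k v`. -/
def sideForm (k : Fin 6) (v : ℤ × ℤ) : ℤ :=
  ![v.1, v.1 + v.2, v.2, -v.1, -(v.1 + v.2), -v.2] k

/-- The hexagon cut out by the six inequalities `sideForm k v ≤ b k`, as a set of faces. -/
def hexagon (b : Fin 6 → ℤ) : Set (Site ℤ) :=
  {f | ∀ v ∈ vertices f, ∀ k, sideForm k v ≤ b k}

/-- The length of the side number `k` of `hexagon b`. -/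
def sideLength (b : Fin 6 → ℤ) (k : Fin 6) : ℤ := b (k - 1) + b (k + 1) - b k

/-- The side number `k` of `hexagon b` is one of its longest sides. -/
def IsLongestSide (b : Fin 6 → ℤ) (k : Fin 6) : Prop := ∀ k', sideLength b k' ≤ sideLength b k

/-- The bar on the side number `k` of `hexagon b`: the row of faces outside of the hexagon that is
obtained by pushing this side outwards by one row.  It has `2 l - 1` faces when the side has
length `l`, and its larger base (of length `l`) is that side. -/
def sideBar (b : Fin 6 → ℤ) (k : Fin 6) : Set (Site ℤ) :=
  hexagon (Function.update b k (b k + 1)) \ hexagon b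

/-- The quasi-regular hexagon `E_{B_i}(r)`: the regular hexagon `E(r)` of radius `r` centered at
the vertex `c`, to which `i` bars have been attached, one on each of the `i` consecutive sides
`d, d + 1, …, d + i - 1`, inside the concentric regular hexagon `E(r + 1)`. -/
def quasiHexBounds (c : ℤ × ℤ) (r i : ℕ) (d : Fin 6) : Fin 6 → ℤ :=
  fun k => sideForm k c + r + if (k - d).val < i then 1 else 0

/-- `b` is the family of bounds of a quasi-regular hexagon: some `E_{B_i}(r)` with `r ≥ 1` and
`0 ≤ i ≤ 5`, in any of its positions and orientations. -/
def IsQuasiRegular (b : Fin 6 → ℤ) : Prop :=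
  ∃ (c : ℤ × ℤ) (r i : ℕ) (d : Fin 6), 1 ≤ r ∧ i ≤ 5 ∧ b = quasiHexBounds c r i d

/-- `f` shares an edge with some face of `P`. -/
def IsAttachedTo (f : Site ℤ) (P : Set (Site ℤ)) : Prop := ∃ e ∈ P, (hexLattice ℤ).Adj f e

/-- `P` is a quasi-regular hexagon with an elementary rhombus (two faces sharing an edge)
attached to one of its longest sides, inside the bar on that side. -/
def IsCanonicalShape (P : Set (Site ℤ)) : Prop :=
  ∃ (b : Fin 6 → ℤ) (k : Fin 6) (f g : Site ℤ), IsQuasiRegular b ∧ IsLongestSide b k ∧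
    f ∈ sideBar b k ∧ g ∈ sideBar b k ∧ (hexLattice ℤ).Adj f g ∧ P = hexagon b ∪ {f, g}

/-- `P` is a quasi-regular hexagon with two faces attached to one of its longest sides at lattice
distance `2` from one another. -/
def IsDefectiveShape (P : Set (Site ℤ)) : Prop :=
  ∃ (b : Fin 6 → ℤ) (k : Fin 6) (f g : Site ℤ), IsQuasiRegular b ∧ IsLongestSide b k ∧
    f ∈ sideBar b k ∧ g ∈ sideBar b k ∧
    IsAttachedTo f (hexagon b) ∧ IsAttachedTo g (hexagon b) ∧
    (hexLattice ℤ).dist f g = 2 ∧ P = hexagon b ∪ {f, g}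

/-! ### Critical configurations -/

/-- The projection of the planar lattice onto the torus. -/
def toTorus (L : ℕ) (f : Site ℤ) : Site (ZMod L) := (((f.1.1 : ZMod L), (f.1.2 : ZMod L)), f.2)

/-- The pluses of `σ` are exactly a copy on the torus of the planar shape `P`. -/
def HasCluster {L : ℕ} (σ : Config L) (P : Set (Site ℤ)) : Prop :=
  Set.InjOn (toTorus L) P ∧ plusSet σ = toTorus L '' P

/-- `S̃(A)`: the configurations with a single cluster, of area `A`, whose shape is a quasi-regular
hexagon with an elementary rhombus on a longest side. -/
def canonicalConfigs (L A : ℕ) : Set (Config L) :=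
  {σ | ∃ P : Set (Site ℤ), IsCanonicalShape P ∧ P.ncard = A ∧ HasCluster σ P}

/-- `D̃(A)`: the configurations with a single cluster, of area `A`, whose shape is a quasi-regular
hexagon with two faces at lattice distance `2` on a longest side. -/
def defectiveConfigs (L A : ℕ) : Set (Config L) :=
  {σ | ∃ P : Set (Site ℤ), IsDefectiveShape P ∧ P.ncard = A ∧ HasCluster σ P}

/-- The critical radius `r* = ⌊J / (2h) - 1 / 2⌋`. -/
def criticalRadius (J h : ℝ) : ℕ := ⌊J / (2 * h) - 1 / 2⌋₊

/-- The fractional part `δ` of `J / (2h) - 1 / 2`. -/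
def delta (J h : ℝ) : ℝ := Int.fract (J / (2 * h) - 1 / 2)

open Classical in
/-- The critical area: `A*₁ = 6 r*² + 10 r* + 5` if `δ < 1/2`, and
`A*₂ = 6 (r* + 1)² + 2 (r* + 1) + 1` if `δ > 1/2`. -/
def criticalArea (J h : ℝ) : ℕ :=
  if delta J h < 1 / 2 then 6 * criticalRadius J h ^ 2 + 10 * criticalRadius J h + 5
  else 6 * (criticalRadius J h + 1) ^ 2 + 2 * (criticalRadius J h + 1) + 1

end HexIsing

end

/-!
Relative to `-1` the energy of a configuration whose plus set has area `n` and perimeter `p` is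
`J p - h n`.  The isoperimetric inequality `6 n ≤ p ^ 2` comes from enclosing a plus set in the
hexagon cut out by its extreme strips.  Parity and the defect in this inequality show that at the
critical perimeter `p`, with `6 N + 7 = p ^ 2`, the sets of area `N` are exactly quasi-regular
hexagons.  A path whose energy stays at most `J (p + 2) - h (N + 2)` must leave such a hexagon by
adding two faces while the area passes through `N + 2`; the third face and the next larger hexagon
only fit if these two lie on one longest side, adjacent or at distance `2`.  Conversely every such
configuration is the only maximum of some path, which otherwise follows a growing chain of
quasi-regular hexagons.  So it is an essential saddle, and every gate contains all of them.
-/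

namespace HexIsing

section Perimeter

variable {R : Type} [CommRing R]

/-- The neighbor of the face `f` across its edge of direction `i`.  An edge has the same direction
seen from both of its faces, so that `neighbor · i` is an involution. -/
def neighbor (f : Site R) (i : Fin 3) : Site R :=
  (![f.1, if f.2 then (f.1.1 - 1, f.1.2) else (f.1.1 + 1, f.1.2),
    if f.2 then (f.1.1, f.1.2 - 1) else (f.1.1, f.1.2 + 1)] i, !f.2)

@[simp] lemma neighbor_neighbor (f : Site R) (i : Fin 3) : neighbor (neighbor f i) i = f := by
  obtain ⟨⟨x, y⟩, t⟩ := f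
  fin_cases i <;> cases t <;> simp [neighbor]

lemma neighbor_snd (f : Site R) (i : Fin 3) : (neighbor f i).2 = !f.2 := rfl

lemma neighbor_ne (f : Site R) (i : Fin 3) : neighbor f i ≠ f := fun h => by
  simpa [neighbor] using congrArg Prod.snd h

lemma neighbor_eq_iff {f g : Site R} {i : Fin 3} : neighbor f i = g ↔ f = neighbor g i :=
  ⟨fun h => by rw [← h, neighbor_neighbor], fun h => by rw [h, neighbor_neighbor]⟩

lemma hexLattice_adj_iff (f g : Site R) : (hexLattice R).Adj f g ↔ ∃ i, g = neighbor f i := by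
  obtain ⟨⟨x, y⟩, t⟩ := f
  obtain ⟨⟨x', y'⟩, t'⟩ := g
  simp only [hexLattice, SimpleGraph.fromRel_adj, Fin.exists_fin_succ, neighbor, ne_eq]
  cases t <;> cases t' <;> simp [Prod.ext_iff, eq_sub_iff_add_eq, eq_comm]

variable [DecidableEq R]

/-- The perimeter of a finite set of faces: the number of its boundary edges. -/
def perimeter (S : Finset (Site R)) : ℕ :=
  ∑ f ∈ S, (Finset.univ.filter fun i => neighbor f i ∉ S).card

/-- The number of edges that the face `f` shares with the faces of `S`. -/
def contacts (S : Finset (Site R)) (f : Site R) : ℕ :=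
  (Finset.univ.filter fun i => neighbor f i ∈ S).card

lemma contacts_mono {S T : Finset (Site R)} (h : S ⊆ T) (f : Site R) :
    contacts S f ≤ contacts T f :=
  Finset.card_le_card <| Finset.monotone_filter_right _ fun _ _ hi => h hi

lemma one_le_contacts {S : Finset (Site R)} {f : Site R} (i : Fin 3) (h : neighbor f i ∈ S) :
    1 ≤ contacts S f :=
  Finset.card_pos.2 ⟨i, by simp [h]⟩

lemma two_le_contacts {S : Finset (Site R)} {f : Site R} {i j : Fin 3} (hij : i ≠ j)
    (hi : neighbor f i ∈ S) (hj : neighbor f j ∈ S) : 2 ≤ contacts S f :=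
  Finset.one_lt_card.2 ⟨i, by simp [hi], j, by simp [hj], hij⟩

lemma exists_of_one_le_contacts {S : Finset (Site R)} {f : Site R} (h : 1 ≤ contacts S f) :
    ∃ i, neighbor f i ∈ S := by
  obtain ⟨i, hi⟩ := Finset.card_pos.1 h
  exact ⟨i, by simpa using hi⟩

lemma exists_of_two_le_contacts {S : Finset (Site R)} {f : Site R} (h : 2 ≤ contacts S f) :
    ∃ i j, i ≠ j ∧ neighbor f i ∈ S ∧ neighbor f j ∈ S := by
  obtain ⟨i, hi, j, hj, hij⟩ := Finset.one_lt_card.1 h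
  exact ⟨i, j, hij, by simpa using hi, by simpa using hj⟩

lemma perimeter_add_sum_contacts (S : Finset (Site R)) :
    perimeter S + ∑ f ∈ S, contacts S f = 3 * S.card := by
  rw [perimeter, ← Finset.sum_add_distrib, mul_comm, ← smul_eq_mul, ← Finset.sum_const]
  refine Finset.sum_congr rfl fun f _ => ?_
  rw [contacts, add_comm, Finset.card_filter_add_card_filter_not, Finset.card_univ,
    Fintype.card_fin]

lemma contacts_insert (S : Finset (Site R)) {f g : Site R} (hf : f ∉ S) :
    contacts (insert f S) g =
      contacts S g + (Finset.univ.filter fun i => neighbor g i = f).card := by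
  rw [contacts, contacts, ← Finset.card_union_of_disjoint]
  · congr 1
    ext i
    simp [or_comm]
  · exact Finset.disjoint_filter.2 fun i _ hi hif => hf (hif ▸ hi)

lemma sum_card_neighbor_eq (S : Finset (Site R)) (f : Site R) :
    ∑ g ∈ S, (Finset.univ.filter fun i => neighbor g i = f).card = contacts S f := by
  simp only [contacts, Finset.card_filter]
  rw [Finset.sum_comm]
  refine Finset.sum_congr rfl fun i _ => ?_
  simp only [neighbor_eq_iff, Finset.sum_ite_eq']

lemma sum_contacts_insert {S : Finset (Site R)} {f : Site R} (hf : f ∉ S) :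
    ∑ g ∈ insert f S, contacts (insert f S) g = ∑ g ∈ S, contacts S g + 2 * contacts S f := by
  have hself : (Finset.univ.filter fun i => neighbor f i = f) = ∅ := by simp [neighbor_ne]
  rw [Finset.sum_insert hf]
  simp only [contacts_insert S hf]
  rw [Finset.sum_add_distrib, sum_card_neighbor_eq, hself, Finset.card_empty]
  ring

lemma perimeter_insert {S : Finset (Site R)} {f : Site R} (hf : f ∉ S) :
    (perimeter (insert f S) : ℤ) = perimeter S + 3 - 2 * contacts S f := by
  have hS := perimeter_add_sum_contacts S
  have hfS := perimeter_add_sum_contacts (insert f S)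
  rw [sum_contacts_insert hf, Finset.card_insert_of_notMem hf] at hfS
  omega

lemma perimeter_insert_le_of_one {S : Finset (Site R)} {f : Site R} (hf : f ∉ S)
    (h : 1 ≤ contacts S f) : perimeter (insert f S) ≤ perimeter S + 1 := by
  have := perimeter_insert hf
  omega

lemma perimeter_insert_le_of_two {S : Finset (Site R)} {f : Site R} (hf : f ∉ S)
    (h : 2 ≤ contacts S f) : perimeter (insert f S) + 1 ≤ perimeter S := by
  have := perimeter_insert hf
  omega

lemma perimeter_erase {S : Finset (Site R)} {f : Site R} (hf : f ∈ S) :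
    (perimeter (S.erase f) : ℤ) = perimeter S - 3 + 2 * contacts (S.erase f) f := by
  have := perimeter_insert (Finset.notMem_erase f S)
  rw [Finset.insert_erase hf] at this
  omega

@[simp] lemma perimeter_empty : perimeter (∅ : Finset (Site R)) = 0 := by simp [perimeter]

lemma perimeter_mod_two (S : Finset (Site R)) : perimeter S % 2 = S.card % 2 := by
  induction S using Finset.induction_on with
  | empty => simp
  | insert f S hf ih =>
    have := perimeter_insert hf
    rw [Finset.card_insert_of_notMem hf]
    omega

lemma perimeter_union {S T : Finset (Site R)} (hd : Disjoint S T)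
    (hST : ∀ f ∈ S, ∀ i, neighbor f i ∉ T) :
    perimeter (S ∪ T) = perimeter S + perimeter T := by
  have hTS : ∀ f ∈ T, ∀ i, neighbor f i ∉ S := fun f hf i hs => hST _ hs i (by simpa using hf)
  rw [perimeter, Finset.sum_union hd, perimeter, perimeter]
  congr 1 <;> refine Finset.sum_congr rfl fun f hf => ?_
  · simp only [Finset.mem_union, hST f hf, or_false]
  · simp only [Finset.mem_union, hTS f hf, false_or]

end Perimeter

section Strips

variable {R : Type} [CommRing R]

/-- The index of the strip of direction `k` that contains a face: the strips of the three
directions are the regions between consecutive parallel lines of the triangular lattice. -/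
def strip (k : Fin 3) (f : Site R) : R :=
  ![f.1.1, f.1.2, f.1.1 + f.1.2 + if f.2 then 0 else 1] k

lemma strip_zero (f : Site R) : strip 0 f = f.1.1 := rfl

lemma strip_one (f : Site R) : strip 1 f = f.1.2 := rfl

lemma strip_neighbor_of_ne (f : Site R) {i j : Fin 3} (hij : i ≠ j) (k : Fin 3) :
    strip k (neighbor f i) = strip k f ∨ strip k (neighbor f j) = strip k f := by
  obtain ⟨⟨x, y⟩, t⟩ := f
  fin_cases i <;> fin_cases j <;> fin_cases k <;> cases t <;>
    first
    | exact absurd rfl hij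
    | (left; simp [strip, neighbor]; done)
    | (right; simp [strip, neighbor]; done)
    | (left; simp [strip, neighbor]; ring; done)
    | (right; simp [strip, neighbor]; ring)

lemma abs_strip_neighbor_sub_le (f : Site ℤ) (i k : Fin 3) :
    |strip k (neighbor f i) - strip k f| ≤ 1 := by
  obtain ⟨⟨x, y⟩, t⟩ := f
  rw [abs_le]
  fin_cases i <;> fin_cases k <;> cases t <;> simp [strip, neighbor] <;> omega

/-- The next face of the strip of direction `k` that contains `f`. -/
def forward (k : Fin 3) (f : Site R) : Site R := neighbor f (if f.2 then k else k + 2)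

/-- The previous face of the strip of direction `k` that contains `f`. -/
def backward (k : Fin 3) (f : Site R) : Site R := neighbor f (if f.2 then k + 2 else k)

lemma forward_backward (k : Fin 3) (f : Site R) : forward k (backward k f) = f := by
  obtain ⟨v, t⟩ := f
  cases t <;> simp [forward, backward, neighbor_snd]

lemma backward_forward (k : Fin 3) (f : Site R) : backward k (forward k f) = f := by
  obtain ⟨v, t⟩ := f
  cases t <;> simp [forward, backward, neighbor_snd]

lemma strip_forward (k : Fin 3) (f : Site R) : strip k (forward k f) = strip k f := by
  obtain ⟨⟨x, y⟩, t⟩ := f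
  fin_cases k <;> cases t <;> simp [strip, forward, neighbor] <;> ring

lemma strip_backward (k : Fin 3) (f : Site R) : strip k (backward k f) = strip k f := by
  rw [← strip_forward, forward_backward]

lemma exists_position_forward (k : Fin 3) :
    ∃ pos : Site ℤ → ℤ, ∀ f, pos (forward k f) = pos f + 1 := by
  refine ⟨fun f => ![strip 1 f + strip 2 f, -(strip 0 f + strip 2 f), strip 0 f - strip 1 f] k, ?_⟩
  rintro ⟨⟨x, y⟩, t⟩
  fin_cases k <;> cases t <;> simp [strip, forward, neighbor] <;> ring

variable [DecidableEq R]

lemma card_filter_neighbor_ite (P : Finset (Site R)) (a b : Fin 3) :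
    (P.filter fun f => neighbor f (if f.2 then a else b) ∉ P).card =
      (P.filter fun f => f.2 = true ∧ neighbor f a ∉ P).card +
        (P.filter fun f => f.2 = false ∧ neighbor f b ∉ P).card := by
  rw [← Finset.card_union_of_disjoint]
  · congr 1
    ext ⟨v, t⟩
    cases t <;> simp
  · exact Finset.disjoint_filter.2 fun f _ htrue hfalse =>
      Bool.noConfusion (htrue.1.symm.trans hfalse.1)

lemma perimeter_eq_sum_direction (P : Finset (Site R)) :
    perimeter P = ∑ i : Fin 3, ((P.filter fun f => f.2 = true ∧ neighbor f i ∉ P).card +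
        (P.filter fun f => f.2 = false ∧ neighbor f i ∉ P).card) := by
  simp only [perimeter, Finset.card_filter]
  rw [Finset.sum_comm]
  refine Finset.sum_congr rfl fun i _ => ?_
  rw [← Finset.card_filter, ← Finset.card_filter, ← Finset.card_filter,
    ← card_filter_neighbor_ite P i i]
  simp only [ite_self]

/-- Each boundary edge ends a maximal run of faces in two of the three strips of its face. -/
lemma two_mul_perimeter (P : Finset (Site R)) :
    2 * perimeter P = ∑ k, ((P.filter fun f => forward k f ∉ P).card +
      (P.filter fun f => backward k f ∉ P).card) := by
  have hforward (k : Fin 3) : (P.filter fun f => forward k f ∉ P).card = _ :=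
    card_filter_neighbor_ite P k (k + 2)
  have hbackward (k : Fin 3) : (P.filter fun f => backward k f ∉ P).card = _ :=
    card_filter_neighbor_ite P (k + 2) k
  simp only [hforward, hbackward]
  rw [perimeter_eq_sum_direction, Fin.sum_univ_three, Fin.sum_univ_three]
  simp only [Fin.isValue, zero_add, Fin.reduceAdd]
  ring

lemma card_image_le_card_filter {α : Type*} [DecidableEq α] (P : Finset α) (row pos : α → ℤ)
    (step : α → α) (hrow : ∀ f, row (step f) = row f) (hpos : ∀ f, pos f < pos (step f)) :
    (P.image row).card ≤ (P.filter fun f => step f ∉ P).card := by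
  refine (Finset.card_le_card fun c hc => ?_).trans (Finset.card_image_le (f := row))
  obtain ⟨f, hf, rfl⟩ := Finset.mem_image.1 hc
  obtain ⟨last, hlast, hmax⟩ := Finset.exists_max_image (P.filter fun g => row g = row f) pos
    ⟨f, by simp [hf]⟩
  simp only [Finset.mem_filter] at hlast hmax
  refine Finset.mem_image.2 ⟨last, Finset.mem_filter.2 ⟨hlast.1, fun hstep => ?_⟩, hlast.2⟩
  exact absurd (hmax _ ⟨hstep, (hrow last).trans hlast.2⟩) (not_le.2 (hpos last))

/-- The last and the first face of every strip that `P` meets contribute a boundary edge each, and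
every boundary edge is counted for two strips. -/
lemma sum_card_image_strip_le_perimeter (P : Finset (Site ℤ)) :
    ∑ k, (P.image (strip k)).card ≤ perimeter P := by
  have hends : ∀ k, 2 * (P.image (strip k)).card ≤
      (P.filter fun f => forward k f ∉ P).card + (P.filter fun f => backward k f ∉ P).card := by
    intro k
    obtain ⟨pos, hpos⟩ := exists_position_forward k
    have hlast := card_image_le_card_filter P (strip k) pos (forward k) (strip_forward k)
      fun f => by rw [hpos]; omega
    have hfirst := card_image_le_card_filter P (strip k) (fun f => -pos f) (backward k)
      (strip_backward k) fun f => by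
        have := hpos (backward k f)
        rw [forward_backward] at this
        omega
    omega
  have := two_mul_perimeter P
  have := Finset.sum_le_sum fun k (_ : k ∈ Finset.univ) => hends k
  rw [← Finset.mul_sum] at this
  omega

end Strips

section Hexagons

/-- The maxima over the vertices of a face of the six linear forms. -/
def faceForm (f : Site ℤ) (k : Fin 6) : ℤ :=
  ![strip 0 f + 1, strip 2 f + 1, strip 1 f + 1, -strip 0 f, -strip 2 f, -strip 1 f] k

lemma faceForm_le_iff {f : Site ℤ} {k : Fin 6} {c : ℤ} :
    faceForm f k ≤ c ↔ ∀ v ∈ vertices f, sideForm k v ≤ c := by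
  obtain ⟨⟨x, y⟩, t⟩ := f
  fin_cases k <;> cases t <;> simp [vertices, sideForm, faceForm, strip] <;> omega

lemma mem_hexagon {b : Fin 6 → ℤ} {f : Site ℤ} : f ∈ hexagon b ↔ ∀ k, faceForm f k ≤ b k := by
  simp only [faceForm_le_iff]
  exact ⟨fun h k v hv => h v hv k, fun h v hv k => h k v hv⟩

/-- The hexagon `hexagon b` as a finite set. -/
noncomputable def hexagonFinset (b : Fin 6 → ℤ) : Finset (Site ℤ) :=
  ((Finset.Ico (-b 3) (b 0) ×ˢ Finset.Ico (-b 5) (b 2)) ×ˢ Finset.univ).filter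
    fun f => -b 4 ≤ strip 2 f ∧ strip 2 f < b 1

lemma mem_hexagonFinset {b : Fin 6 → ℤ} {f : Site ℤ} :
    f ∈ hexagonFinset b ↔ ∀ k, faceForm f k ≤ b k := by
  simp only [hexagonFinset, Finset.mem_filter, Finset.mem_product, Finset.mem_Ico, Finset.mem_univ,
    and_true, faceForm, strip_zero, strip_one, Fin.forall_fin_succ]
  simp
  omega

lemma coe_hexagonFinset (b : Fin 6 → ℤ) : (hexagonFinset b : Set (Site ℤ)) = hexagon b := by
  ext f
  rw [Finset.mem_coe, mem_hexagonFinset, mem_hexagon]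

lemma hexagonFinset_mono {b b' : Fin 6 → ℤ} (h : ∀ k, b k ≤ b' k) :
    hexagonFinset b ⊆ hexagonFinset b' :=
  fun _ hf => mem_hexagonFinset.2 fun k => (mem_hexagonFinset.1 hf k).trans (h k)

lemma card_triangle (n : ℕ) :
    (((Finset.range n ×ˢ Finset.range n) ×ˢ (Finset.univ : Finset Bool)).filter fun f =>
      f.1.1 + f.1.2 + (if f.2 then 1 else 0) < n).card = n ^ 2 := by
  rw [Finset.card_filter, Finset.sum_product, Finset.sum_product]
  have hrow : ∀ u ∈ Finset.range n, (∑ v ∈ Finset.range n, ∑ t : Bool,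
      if u + v + (if t then 1 else 0) < n then 1 else 0) = 2 * (n - 1 - u) + 1 := by
    intro u hu
    rw [Finset.mem_range] at hu
    simp only [Fintype.sum_bool, if_true, Finset.sum_add_distrib]
    rw [← Finset.card_filter, ← Finset.card_filter]
    have htrue : (Finset.range n).filter (fun v => u + v + 1 < n) = Finset.range (n - 1 - u) := by
      ext v; simp; omega
    have hfalse : (Finset.range n).filter (fun v => u + v + (if false = true then 1 else 0) < n) =
        Finset.range (n - u) := by
      ext v; simp; omega
    rw [htrue, hfalse, Finset.card_range, Finset.card_range]
    omega
  rw [Finset.sum_congr rfl hrow, Finset.sum_range_reflect (fun u => 2 * u + 1) n]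
  clear hrow
  induction n with
  | zero => rfl
  | succ n ih => rw [Finset.sum_range_succ, ih]; ring

lemma card_upper_corner (C : Finset (Site ℤ)) (X Y : ℤ) (n : ℕ)
    (h : ∀ f, f ∈ C ↔ strip 0 f < X ∧ strip 1 f < Y ∧ X + Y - n ≤ strip 2 f) :
    C.card = n ^ 2 := by
  rw [← card_triangle n]
  refine Finset.card_bij' (fun f _ => (((X - 1 - f.1.1).toNat, (Y - 1 - f.1.2).toNat), f.2))
    (fun f _ => ((X - 1 - f.1.1, Y - 1 - f.1.2), f.2)) ?_ ?_ ?_ ?_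
  · rintro ⟨⟨x, y⟩, t⟩ hf
    rw [h] at hf
    cases t <;> simp [strip] at hf ⊢ <;> omega
  · rintro ⟨⟨x, y⟩, t⟩ hf
    rw [h]
    cases t <;> simp [strip] at hf ⊢ <;> omega
  · rintro ⟨⟨x, y⟩, t⟩ hf
    rw [h] at hf
    cases t <;> simp [strip] at hf ⊢ <;> omega
  · rintro ⟨⟨x, y⟩, t⟩ hf
    cases t <;> simp at hf ⊢

lemma card_lower_corner (C : Finset (Site ℤ)) (X Y : ℤ) (n : ℕ)
    (h : ∀ f, f ∈ C ↔ X ≤ strip 0 f ∧ Y ≤ strip 1 f ∧ strip 2 f < X + Y + n) :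
    C.card = n ^ 2 := by
  rw [← card_triangle n]
  refine Finset.card_bij' (fun f _ => (((f.1.1 - X).toNat, (f.1.2 - Y).toNat), !f.2))
    (fun f _ => ((X + f.1.1, Y + f.1.2), !f.2)) ?_ ?_ ?_ ?_
  · rintro ⟨⟨x, y⟩, t⟩ hf
    rw [h] at hf
    cases t <;> simp [strip] at hf ⊢ <;> omega
  · rintro ⟨⟨x, y⟩, t⟩ hf
    rw [h]
    cases t <;> simp [strip] at hf ⊢ <;> omega
  · rintro ⟨⟨x, y⟩, t⟩ hf
    rw [h] at hf
    cases t <;> simp [strip] at hf ⊢ <;> omega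
  · rintro ⟨⟨x, y⟩, t⟩ hf
    cases t <;> simp at hf ⊢

lemma forall_sideLength_nonneg_iff {b : Fin 6 → ℤ} : (∀ k, 0 ≤ sideLength b k) ↔
    0 ≤ b 5 + b 1 - b 0 ∧ 0 ≤ b 0 + b 2 - b 1 ∧ 0 ≤ b 1 + b 3 - b 2 ∧ 0 ≤ b 2 + b 4 - b 3 ∧
      0 ≤ b 3 + b 5 - b 4 ∧ 0 ≤ b 4 + b 0 - b 5 :=
  ⟨fun h => ⟨h 0, h 1, h 2, h 3, h 4, h 5⟩, fun ⟨h₀, h₁, h₂, h₃, h₄, h₅⟩ k => by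
    fin_cases k
    exacts [h₀, h₁, h₂, h₃, h₄, h₅]⟩

lemma strip_two_bounds (f : Site ℤ) :
    strip 0 f + strip 1 f ≤ strip 2 f ∧ strip 2 f ≤ strip 0 f + strip 1 f + 1 := by
  obtain ⟨⟨x, y⟩, _ | _⟩ := f <;> simp [strip]

/-- A parallelogram without two of its corners. -/
lemma card_hexagonFinset {b : Fin 6 → ℤ} (hb : ∀ k, 0 ≤ sideLength b k) :
    ((hexagonFinset b).card : ℤ) = 2 * (b 0 + b 3) * (b 2 + b 5) - (b 0 + b 2 - b 1) ^ 2 -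
      (b 3 + b 5 - b 4) ^ 2 := by
  rw [forall_sideLength_nonneg_iff] at hb
  obtain ⟨h₀, h₁, h₂, h₃, h₄, h₅⟩ := hb
  set B : Finset (Site ℤ) :=
    (Finset.Ico (-b 3) (b 0) ×ˢ Finset.Ico (-b 5) (b 2)) ×ˢ Finset.univ with hB
  have hmem : ∀ f, f ∈ B ↔ (-b 3 ≤ strip 0 f ∧ strip 0 f < b 0) ∧
      -b 5 ≤ strip 1 f ∧ strip 1 f < b 2 := by
    intro f
    simp [hB, strip_zero, strip_one]
  have hBcard : (B.card : ℤ) = 2 * (b 0 + b 3) * (b 2 + b 5) := by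
    rw [hB, Finset.card_product, Finset.card_product, Int.card_Ico, Int.card_Ico]
    push_cast
    rw [Int.toNat_of_nonneg (by omega), Int.toNat_of_nonneg (by omega)]
    simp
    ring
  have hupper : (B.filter fun f => b 1 ≤ strip 2 f).card = (b 0 + b 2 - b 1).toNat ^ 2 := by
    refine card_upper_corner _ (b 0) (b 2) _ fun f => ?_
    have := strip_two_bounds f
    rw [Finset.mem_filter, hmem]
    omega
  have hlower : (B.filter fun f => strip 2 f < -b 4).card = (b 3 + b 5 - b 4).toNat ^ 2 := by
    refine card_lower_corner _ (-b 3) (-b 5) _ fun f => ?_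
    have := strip_two_bounds f
    rw [Finset.mem_filter, hmem]
    omega
  have hsplit : B.card = (hexagonFinset b).card + (B.filter fun f => b 1 ≤ strip 2 f).card +
      (B.filter fun f => strip 2 f < -b 4).card := by
    simp only [hexagonFinset, ← hB, Finset.card_filter]
    rw [Finset.card_eq_sum_ones, ← Finset.sum_add_distrib, ← Finset.sum_add_distrib]
    refine Finset.sum_congr rfl fun f _ => ?_
    split_ifs <;> omega
  zify at hsplit hupper hlower
  rw [Int.toNat_of_nonneg h₁] at hupper
  rw [Int.toNat_of_nonneg h₄] at hlower
  linarith

/-- The bounds of the hexagon obtained by pushing the side number `k` outwards by one row. -/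
def pushSide (b : Fin 6 → ℤ) (k : Fin 6) : Fin 6 → ℤ := Function.update b k (b k + 1)

lemma le_pushSide (b : Fin 6 → ℤ) (k k' : Fin 6) : b k' ≤ pushSide b k k' := by
  by_cases h : k' = k
  · subst h
    simp [pushSide]
  · simp [pushSide, h]

lemma sideLength_pushSide_nonneg {b : Fin 6 → ℤ} (hb : ∀ k, 0 ≤ sideLength b k) {k : Fin 6}
    (hk : 1 ≤ sideLength b k) (k' : Fin 6) : 0 ≤ sideLength (pushSide b k) k' := by
  have e : (-1 : Fin 6) = 5 := rfl
  revert k'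
  rw [forall_sideLength_nonneg_iff] at hb ⊢
  fin_cases k <;> simp [sideLength, pushSide, Function.update, e] at hk ⊢ <;> omega

lemma card_hexagonFinset_pushSide {b : Fin 6 → ℤ} (hb : ∀ k, 0 ≤ sideLength b k) {k : Fin 6}
    (hk : 1 ≤ sideLength b k) :
    ((hexagonFinset (pushSide b k)).card : ℤ) =
      (hexagonFinset b).card + 2 * sideLength b k - 1 := by
  have e : (-1 : Fin 6) = 5 := rfl
  rw [card_hexagonFinset hb, card_hexagonFinset (sideLength_pushSide_nonneg hb hk)]
  fin_cases k <;>
    simp only [pushSide, Function.update_apply, sideLength, Fin.reduceFinMk, Fin.reduceEq,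
      if_true, if_false, Fin.reduceAdd, Fin.reduceSub, Fin.zero_eta, Fin.mk_one, zero_sub, zero_add,
      sub_self, e] <;>
    ring

end Hexagons

section Isoperimetry

lemma six_mul_card_hexagonFinset {b : Fin 6 → ℤ} (hb : ∀ k, 0 ≤ sideLength b k) :
    6 * ((hexagonFinset b).card : ℤ) = (∑ k, b k) ^ 2 -
      2 * ((b 0 + b 3 - (b 1 + b 4)) ^ 2 + (b 1 + b 4 - (b 2 + b 5)) ^ 2 +
        (b 0 + b 3 - (b 2 + b 5)) ^ 2) - 3 * (b 0 + b 2 + b 4 - (b 1 + b 3 + b 5)) ^ 2 := by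
  rw [card_hexagonFinset hb, Fin.sum_univ_six]
  ring

lemma six_mul_card_hexagonFinset_le {b : Fin 6 → ℤ} (hb : ∀ k, 0 ≤ sideLength b k) :
    6 * ((hexagonFinset b).card : ℤ) ≤ (∑ k, b k) ^ 2 := by
  rw [six_mul_card_hexagonFinset hb]
  nlinarith [sq_nonneg (b 0 + b 3 - (b 1 + b 4)), sq_nonneg (b 1 + b 4 - (b 2 + b 5)),
    sq_nonneg (b 0 + b 3 - (b 2 + b 5)), sq_nonneg (b 0 + b 2 + b 4 - (b 1 + b 3 + b 5))]

lemma sum_nonneg_of_sideLength {b : Fin 6 → ℤ} (hb : ∀ k, 0 ≤ sideLength b k) :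
    0 ≤ ∑ k, b k := by
  rw [forall_sideLength_nonneg_iff] at hb
  rw [Fin.sum_univ_six]
  omega

/-- The bounds of the smallest hexagon that contains a nonempty finite set of faces. -/
noncomputable def hullBounds (P : Finset (Site ℤ)) (k : Fin 6) : ℤ :=
  if h : P.Nonempty then P.sup' h fun f => faceForm f k else 0

lemma faceForm_le_hullBounds {P : Finset (Site ℤ)} {f : Site ℤ} (hf : f ∈ P) (k : Fin 6) :
    faceForm f k ≤ hullBounds P k := by
  rw [hullBounds, dif_pos ⟨f, hf⟩]
  exact Finset.le_sup' (fun f => faceForm f k) hf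

lemma exists_faceForm_eq_hullBounds {P : Finset (Site ℤ)} (hP : P.Nonempty) (k : Fin 6) :
    ∃ f ∈ P, faceForm f k = hullBounds P k := by
  rw [hullBounds, dif_pos hP]
  obtain ⟨f, hf, h⟩ := Finset.exists_mem_eq_sup' hP fun f => faceForm f k
  exact ⟨f, hf, h.symm⟩

lemma hullBounds_le {P : Finset (Site ℤ)} (hP : P.Nonempty) {k : Fin 6} {c : ℤ}
    (h : ∀ f ∈ P, faceForm f k ≤ c) : hullBounds P k ≤ c := by
  obtain ⟨f, hf, hk⟩ := exists_faceForm_eq_hullBounds hP k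
  exact hk ▸ h f hf

lemma hullBounds_mono {P Q : Finset (Site ℤ)} (hP : P.Nonempty) (h : P ⊆ Q) (k : Fin 6) :
    hullBounds P k ≤ hullBounds Q k :=
  hullBounds_le hP fun _ hf => faceForm_le_hullBounds (h hf) k

lemma subset_hexagonFinset_hullBounds (P : Finset (Site ℤ)) : P ⊆ hexagonFinset (hullBounds P) :=
  fun _ hf => mem_hexagonFinset.2 fun k => faceForm_le_hullBounds hf k

lemma sideLength_faceForm_nonneg (f : Site ℤ) (k : Fin 6) : 0 ≤ sideLength (faceForm f) k := by
  revert k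
  rw [forall_sideLength_nonneg_iff]
  obtain ⟨⟨x, y⟩, _ | _⟩ := f <;> simp [faceForm, strip] <;> omega

lemma sideLength_hullBounds_nonneg {P : Finset (Site ℤ)} (hP : P.Nonempty) (k : Fin 6) :
    0 ≤ sideLength (hullBounds P) k := by
  obtain ⟨f, hf, hk⟩ := exists_faceForm_eq_hullBounds hP k
  have hprev := faceForm_le_hullBounds hf (k - 1)
  have hnext := faceForm_le_hullBounds hf (k + 1)
  have hface := sideLength_faceForm_nonneg f k
  simp only [sideLength] at hface ⊢
  omega

lemma six_mul_card_le_sum_hullBounds {P : Finset (Site ℤ)} (hP : P.Nonempty) :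
    6 * (P.card : ℤ) ≤ (∑ k, hullBounds P k) ^ 2 := by
  have hcard : (P.card : ℤ) ≤ (hexagonFinset (hullBounds P)).card :=
    mod_cast Finset.card_le_card (subset_hexagonFinset_hullBounds P)
  linarith [six_mul_card_hexagonFinset_le (sideLength_hullBounds_nonneg hP)]

/-- The strips of direction `k` that meet `P` are consecutive. -/
def NoGap (k : Fin 3) (P : Finset (Site ℤ)) : Prop :=
  ∀ a, (∃ f ∈ P, strip k f < a) → (∃ f ∈ P, a < strip k f) → ∃ f ∈ P, strip k f = a

lemma NoGap.le_card {k : Fin 3} {P : Finset (Site ℤ)} (h : NoGap k P) {f g : Site ℤ}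
    (hf : f ∈ P) (hg : g ∈ P) :
    strip k f + 1 + -strip k g ≤ (P.image (strip k)).card := by
  have hsub : Finset.Icc (strip k g) (strip k f) ⊆ P.image (strip k) := by
    intro a ha
    rw [Finset.mem_Icc] at ha
    rw [Finset.mem_image]
    rcases ha.1.eq_or_lt with hga | hga
    · exact ⟨g, hg, hga⟩
    rcases ha.2.eq_or_lt with haf | haf
    · exact ⟨f, hf, haf.symm⟩
    · exact h a ⟨g, hg, hga⟩ ⟨f, hf, haf⟩
  have hcard := Finset.card_le_card hsub
  rw [Int.card_Icc] at hcard
  omega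

lemma sum_hullBounds_le_perimeter_of_noGap {P : Finset (Site ℤ)} (hP : P.Nonempty)
    (h : ∀ k, NoGap k P) : ∑ k, hullBounds P k ≤ perimeter P := by
  have hstrips := sum_card_image_strip_le_perimeter P
  rw [Fin.sum_univ_three] at hstrips
  choose f hf hmax using exists_faceForm_eq_hullBounds hP
  have hwidth₀ := (h 0).le_card (hf 0) (hf 3)
  have hwidth₁ := (h 1).le_card (hf 2) (hf 5)
  have hwidth₂ := (h 2).le_card (hf 1) (hf 4)
  rw [Fin.sum_univ_six]
  simp only [← hmax]
  change (strip 0 (f 0) + 1) + (strip 2 (f 1) + 1) + (strip 1 (f 2) + 1) + -strip 0 (f 3) +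
    -strip 2 (f 4) + -strip 1 (f 5) ≤ _
  omega

lemma exists_split_of_gap {k : Fin 3} {P : Finset (Site ℤ)} (h : ¬ NoGap k P) :
    ∃ P₁ P₂ : Finset (Site ℤ), P₁.Nonempty ∧ P₂.Nonempty ∧ P.card = P₁.card + P₂.card ∧
      perimeter P = perimeter P₁ + perimeter P₂ := by
  simp only [NoGap, not_forall, not_exists, not_and] at h
  obtain ⟨a, ⟨f, hf, hfa⟩, ⟨g, hg, hga⟩, hgap⟩ := h
  have hdisj : Disjoint (P.filter fun f => strip k f < a) (P.filter fun f => ¬ strip k f < a) :=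
    Finset.disjoint_filter_filter_not _ _ _
  have hunion : (P.filter fun f => strip k f < a) ∪ (P.filter fun f => ¬ strip k f < a) = P :=
    Finset.filter_union_filter_not_eq _ _
  refine ⟨P.filter fun f => strip k f < a, P.filter fun f => ¬ strip k f < a,
    ⟨f, by simp [hf, hfa]⟩, ⟨g, by simp [hg, hga.le]⟩, ?_, ?_⟩
  · rw [← Finset.card_union_of_disjoint hdisj, hunion]
  · rw [← perimeter_union hdisj, hunion]
    intro u hu i hv
    simp only [Finset.mem_filter] at hu hv
    have hstep := abs_le.1 (abs_strip_neighbor_sub_le u i k)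
    have hne := hgap _ hv.1
    omega

lemma three_le_of_six_le_sq {n : ℕ} (h : 6 ≤ n ^ 2) : 3 ≤ n := by
  nlinarith

lemma six_mul_add_le {n₁ n₂ p₁ p₂ : ℕ} (h₁ : 6 * n₁ ≤ p₁ ^ 2) (h₂ : 6 * n₂ ≤ p₂ ^ 2)
    (hn₁ : 0 < n₁) (hn₂ : 0 < n₂) :
    3 ≤ p₁ + p₂ ∧ 6 * ((n₁ + n₂ : ℕ) : ℤ) ≤ (((p₁ + p₂ : ℕ) : ℤ) - 3) ^ 2 + 9 := by
  have hp₁ := three_le_of_six_le_sq (n := p₁) (by omega)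
  have hp₂ := three_le_of_six_le_sq (n := p₂) (by omega)
  refine ⟨by omega, ?_⟩
  zify at *
  nlinarith [mul_nonneg (sub_nonneg.2 hp₁) (sub_nonneg.2 hp₂)]

/-- Without gaps the perimeter bounds the sum of the widths of the enclosing hexagon; across a gap
the set splits. -/
lemma six_mul_card_le_perimeter_sq (P : Finset (Site ℤ)) : 6 * P.card ≤ perimeter P ^ 2 := by
  induction hn : P.card using Nat.strong_induction_on generalizing P with
  | _ n ih =>
    subst hn
    rcases P.eq_empty_or_nonempty with rfl | hP
    · simp
    by_cases h : ∀ k, NoGap k P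
    · have hsum := sum_hullBounds_le_perimeter_of_noGap hP h
      have hcard := six_mul_card_le_sum_hullBounds hP
      have hnonneg := sum_nonneg_of_sideLength (sideLength_hullBounds_nonneg hP)
      zify
      nlinarith
    · push Not at h
      obtain ⟨k, hk⟩ := h
      obtain ⟨P₁, P₂, hP₁, hP₂, hcard, hper⟩ := exists_split_of_gap hk
      have hpos₁ := hP₁.card_pos
      have hpos₂ := hP₂.card_pos
      have := six_mul_add_le (ih _ (by omega) P₁ rfl) (ih _ (by omega) P₂ rfl) hpos₁ hpos₂
      rw [← hcard, ← hper] at this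
      zify at this ⊢
      nlinarith

lemma sum_hullBounds_le_perimeter {P : Finset (Site ℤ)} (hP : P.Nonempty)
    (h : ((perimeter P : ℤ) - 3) ^ 2 + 9 < 6 * P.card) : ∑ k, hullBounds P k ≤ perimeter P := by
  by_cases hgap : ∀ k, NoGap k P
  · exact sum_hullBounds_le_perimeter_of_noGap hP hgap
  · push Not at hgap
    obtain ⟨k, hk⟩ := hgap
    obtain ⟨P₁, P₂, hP₁, hP₂, hcard, hper⟩ := exists_split_of_gap hk
    have := six_mul_add_le (six_mul_card_le_perimeter_sq P₁) (six_mul_card_le_perimeter_sq P₂)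
      hP₁.card_pos hP₂.card_pos
    rw [← hcard, ← hper] at this
    omega

end Isoperimetry

section QuasiRegular

lemma card_hexagonFinset_le {b : Fin 6 → ℤ} (hb : ∀ k, 0 ≤ sideLength b k) {N p : ℕ}
    (hN : 6 * N + 7 = p ^ 2) (hp : 7 ≤ p) (hs : ∑ k, b k ≤ p) : (hexagonFinset b).card ≤ N := by
  have harea := six_mul_card_hexagonFinset hb
  have hnonneg := sum_nonneg_of_sideLength hb
  set s := ∑ k, b k
  set asym := b 0 + b 2 + b 4 - (b 1 + b 3 + b 5)
  have hu := sq_nonneg (b 0 + b 3 - (b 1 + b 4))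
  have hv := sq_nonneg (b 1 + b 4 - (b 2 + b 5))
  have huv := sq_nonneg (b 0 + b 3 - (b 2 + b 5))
  have hasym := sq_nonneg asym
  have hsq : s ^ 2 ≤ p ^ 2 := by nlinarith
  zify at *
  by_contra! hlt
  have hzero : asym ^ 2 = 0 := by omega
  rcases hs.eq_or_lt with heq | hlt'
  · rw [heq] at harea
    omega
  · have : s ^ 2 ≤ ((p : ℤ) - 1) ^ 2 := by nlinarith
    nlinarith

lemma quadratic_eq_seven {u v t : ℤ} (hq : 2 * (u ^ 2 + v ^ 2 + (u + v) ^ 2) + 3 * t ^ 2 = 7) :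
    (t = 1 ∨ t = -1) ∧ (u = 1 ∧ v = 0 ∨ u = -1 ∧ v = 0 ∨ u = 0 ∧ v = 1 ∨ u = 0 ∧ v = -1 ∨
      u = 1 ∧ v = -1 ∨ u = -1 ∧ v = 1) := by
  have hu : u ≤ 1 := by nlinarith [sq_nonneg t, sq_nonneg (u + 2 * v)]
  have hu' : -1 ≤ u := by nlinarith [sq_nonneg t, sq_nonneg (u + 2 * v)]
  have hv : v ≤ 1 := by nlinarith [sq_nonneg t, sq_nonneg (2 * u + v)]
  have hv' : -1 ≤ v := by nlinarith [sq_nonneg t, sq_nonneg (2 * u + v)]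
  have ht : t ≤ 1 := by nlinarith [sq_nonneg u, sq_nonneg v, sq_nonneg (u + v)]
  have ht' : -1 ≤ t := by nlinarith [sq_nonneg u, sq_nonneg v, sq_nonneg (u + v)]
  interval_cases t <;> interval_cases u <;> interval_cases v <;> simp at hq ⊢

lemma exists_eq_sideForm_add {a : Fin 6 → ℤ} {r : ℤ} (h : a 0 + a 3 = 2 * r ∧ a 1 + a 4 = 2 * r ∧
    a 2 + a 5 = 2 * r ∧ a 0 + a 2 = a 1 + r) : ∃ c, ∀ k, a k = sideForm k c + r :=
  ⟨(a 0 - r, a 2 - r), fun k => by fin_cases k <;> simp [sideForm] <;> omega⟩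

lemma isQuasiRegular_of_one_bar {b : Fin 6 → ℤ} {r : ℕ} (hr : 1 ≤ r) (d : Fin 6)
    (h : ∃ c, ∀ k, b k - (if k = d then 1 else 0) = sideForm k c + r) : IsQuasiRegular b := by
  obtain ⟨c, hc⟩ := h
  refine ⟨c, r, 1, d, hr, by norm_num, funext fun k => ?_⟩
  have hbar : (k - d).val < 1 ↔ k = d := by
    rw [Nat.lt_one_iff, Fin.val_eq_zero_iff, sub_eq_zero]
  simp only [quasiHexBounds, hbar, ← hc k]
  ring

lemma isQuasiRegular_of_five_bars {b : Fin 6 → ℤ} {r : ℕ} (hr : 1 ≤ r) (m : Fin 6)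
    (h : ∃ c, ∀ k, b k - (if k = m then 0 else 1) = sideForm k c + r) : IsQuasiRegular b := by
  obtain ⟨c, hc⟩ := h
  refine ⟨c, r, 5, m + 1, hr, le_rfl, funext fun k => ?_⟩
  have hbar : ∀ k m : Fin 6, ((k - (m + 1)).val < 5) ↔ ¬ k = m := by decide
  simp only [quasiHexBounds, hbar, ite_not, ← hc k]
  ring

/-- The quadratic form in `six_mul_card_hexagonFinset` takes the value `7` only on twelve vectors,
which are those of the hexagons with one bar or with five bars in the six orientations. -/
lemma isQuasiRegular_of_card {b : Fin 6 → ℤ} (hb : ∀ k, 0 ≤ sideLength b k) {N p : ℕ}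
    (hN : 6 * N + 7 = p ^ 2) (hp : 7 ≤ p) (hs : ∑ k, b k = p)
    (hcard : (hexagonFinset b).card = N) : IsQuasiRegular b := by
  have harea := six_mul_card_hexagonFinset hb
  rw [hs, hcard] at harea
  rw [Fin.sum_univ_six] at hs
  zify at hN hp
  obtain ⟨hasym, hwidths⟩ := quadratic_eq_seven (u := b 0 + b 3 - (b 1 + b 4))
    (v := b 1 + b 4 - (b 2 + b 5)) (t := b 0 + b 2 + b 4 - (b 1 + b 3 + b 5)) (by linarith)
  have hr : 1 ≤ p / 6 := by omega
  clear harea hb hcard hN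
  rcases hasym with ht | ht <;> rcases hwidths with h | h | h | h | h | h
  · exact isQuasiRegular_of_one_bar hr 0 (exists_eq_sideForm_add (by simp; omega))
  · exact isQuasiRegular_of_five_bars hr 3 (exists_eq_sideForm_add (by simp; omega))
  · exact isQuasiRegular_of_five_bars hr 5 (exists_eq_sideForm_add (by simp; omega))
  · exact isQuasiRegular_of_one_bar hr 2 (exists_eq_sideForm_add (by simp; omega))
  · exact isQuasiRegular_of_five_bars hr 1 (exists_eq_sideForm_add (by simp; omega))
  · exact isQuasiRegular_of_one_bar hr 4 (exists_eq_sideForm_add (by simp; omega))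
  · exact isQuasiRegular_of_one_bar hr 3 (exists_eq_sideForm_add (by simp; omega))
  · exact isQuasiRegular_of_five_bars hr 0 (exists_eq_sideForm_add (by simp; omega))
  · exact isQuasiRegular_of_five_bars hr 2 (exists_eq_sideForm_add (by simp; omega))
  · exact isQuasiRegular_of_one_bar hr 5 (exists_eq_sideForm_add (by simp; omega))
  · exact isQuasiRegular_of_five_bars hr 4 (exists_eq_sideForm_add (by simp; omega))
  · exact isQuasiRegular_of_one_bar hr 1 (exists_eq_sideForm_add (by simp; omega))

end QuasiRegular

section Torus

lemma card_forward_add_card_backward_le {R : Type} [CommRing R] [DecidableEq R]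
    (P : Finset (Site R)) (k : Fin 3) :
    (P.filter fun f => forward k f ∉ P).card + (P.filter fun f => backward k f ∉ P).card ≤
      perimeter P := by
  rw [show (P.filter fun f => forward k f ∉ P).card = _ from card_filter_neighbor_ite P k (k + 2),
    show (P.filter fun f => backward k f ∉ P).card = _ from card_filter_neighbor_ite P (k + 2) k,
    perimeter_eq_sum_direction, Fin.sum_univ_three]
  fin_cases k <;> simp only [Fin.isValue, Fin.reduceFinMk, Fin.zero_eta, Fin.mk_one, zero_add,
    Fin.reduceAdd] <;> omega

variable {L : ℕ}

lemma toTorus_neighbor (f : Site ℤ) (i : Fin 3) :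
    toTorus L (neighbor f i) = neighbor (toTorus L f) i := by
  obtain ⟨⟨x, y⟩, t⟩ := f
  fin_cases i <;> cases t <;> simp [toTorus, neighbor]

lemma iterate_forward_two_mul (k : Fin 3) (f : Site (ZMod L)) (n : ℕ) :
    (forward k)^[2 * n] f = ((f.1.1 + n * ![0, -1, 1] k, f.1.2 + n * ![1, 0, -1] k), f.2) := by
  induction n with
  | zero => simp
  | succ n ih =>
    rw [mul_add, mul_one, add_comm, Function.iterate_add_apply, ih]
    obtain ⟨⟨x, y⟩, t⟩ := f
    fin_cases k <;> cases t <;> simp [forward, neighbor] <;> ring_nf <;> trivial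

lemma exists_strip_eq (k : Fin 3) (c c' : ZMod L) :
    ∃ f : Site (ZMod L), strip k f = c ∧ strip (k + 1) f = c' := by
  fin_cases k
  · exact ⟨((c, c'), true), rfl, rfl⟩
  · exact ⟨((c' - c, c), true), rfl, by simp [strip]⟩
  · exact ⟨((c', c - c'), true), by simp [strip], rfl⟩

lemma perimeter_lt_of_small {P : Finset (Site (ZMod L))}
    (h : P.card + L * perimeter P < 2 * L ^ 2) : perimeter P < 2 * L := by
  by_contra! hle
  nlinarith [Nat.mul_le_mul_left L hle]

variable [NeZero L]

lemma exists_iterate_forward_of_snd_eq {k : Fin 3} {f g : Site (ZMod L)}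
    (h : strip k f = strip k g) (ht : f.2 = g.2) : ∃ n, (forward k)^[n] f = g := by
  obtain ⟨⟨x, y⟩, t⟩ := f
  obtain ⟨⟨x', y'⟩, t'⟩ := g
  obtain rfl : t = t' := ht
  refine ⟨2 * (![y' - y, x - x', x' - x] k).val, ?_⟩
  rw [iterate_forward_two_mul, ZMod.natCast_zmod_val]
  fin_cases k <;> simp [strip] at h ⊢ <;> grind

lemma exists_iterate_forward {k : Fin 3} {f g : Site (ZMod L)} (h : strip k f = strip k g) :
    ∃ n, (forward k)^[n] f = g := by
  by_cases ht : f.2 = g.2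
  · exact exists_iterate_forward_of_snd_eq h ht
  · obtain ⟨n, hn⟩ := exists_iterate_forward_of_snd_eq (f := forward k f) (g := g)
      (by rw [strip_forward, h]) (by simpa [forward, neighbor_snd] using Bool.not_eq.2 ht)
    exact ⟨n + 1, hn⟩

lemma strip_subset_of_forward_mem {P : Finset (Site (ZMod L))} {k : Fin 3} {f : Site (ZMod L)}
    (hf : f ∈ P) (hP : ∀ g ∈ P, strip k g = strip k f → forward k g ∈ P) {g : Site (ZMod L)}
    (hg : strip k g = strip k f) : g ∈ P := by
  have hiter : ∀ n, (forward k)^[n] f ∈ P ∧ strip k ((forward k)^[n] f) = strip k f := by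
    intro n
    induction n with
    | zero => exact ⟨hf, rfl⟩
    | succ n ih =>
      rw [Function.iterate_succ_apply', strip_forward]
      exact ⟨hP _ ih.1 ih.2, ih.2⟩
  obtain ⟨n, rfl⟩ := exists_iterate_forward hg.symm
  exact (hiter n).1

lemma strip_subset_of_backward_mem {P : Finset (Site (ZMod L))} {k : Fin 3} {f : Site (ZMod L)}
    (hf : f ∈ P) (hP : ∀ g ∈ P, strip k g = strip k f → backward k g ∈ P) {g : Site (ZMod L)}
    (hg : strip k g = strip k f) : g ∈ P := by
  have hiter : ∀ n, ∀ u ∈ P, strip k u = strip k f → (forward k)^[n] g = u → g ∈ P := by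
    intro n
    induction n with
    | zero => rintro u hu - rfl; exact hu
    | succ n ih =>
      rintro u hu hstrip rfl
      rw [Function.iterate_succ_apply'] at hu hstrip
      have := hP _ hu hstrip
      rw [backward_forward] at this
      exact ih _ this (by rwa [strip_forward] at hstrip) rfl
  obtain ⟨n, hn⟩ := exists_iterate_forward hg
  exact hiter n f hf rfl hn

lemma two_mul_card_strip_filter_le (P : Finset (Site (ZMod L))) (k : Fin 3) :
    2 * ((P.image (strip k)).filter fun c => ¬ ∀ f, strip k f = c → f ∈ P).card ≤ perimeter P := by
  refine le_trans ?_ (card_forward_add_card_backward_le P k)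
  rw [two_mul]
  refine add_le_add ?_ ?_ <;>
    refine (Finset.card_le_card fun c hc => ?_).trans (Finset.card_image_le (f := strip k)) <;>
    obtain ⟨hc, hnot⟩ := Finset.mem_filter.1 hc <;>
    obtain ⟨f, hf, rfl⟩ := Finset.mem_image.1 hc <;>
    simp only [Finset.mem_image, Finset.mem_filter] <;>
    by_contra! hstep
  · exact hnot fun g hg => strip_subset_of_forward_mem hf
      (fun u hu hstrip => by_contra fun h => hstep u ⟨hu, h⟩ hstrip) hg
  · exact hnot fun g hg => strip_subset_of_backward_mem hf
      (fun u hu hstrip => by_contra fun h => hstep u ⟨hu, h⟩ hstrip) hg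

lemma card_filter_strip_eq (k : Fin 3) (c : ZMod L) :
    (Finset.univ.filter fun f => strip k f = c).card = 2 * L := by
  have hcard : (Finset.univ : Finset (ZMod L × Bool)).card = 2 * L := by
    simp [ZMod.card, mul_comm]
  rw [← hcard]
  refine Finset.card_bij' (fun f _ => (![f.1.2, f.1.1, f.1.1] k, f.2))
    (fun q _ => (![(c, q.1), (q.1, c), (q.1, c - q.1 - if q.2 then 0 else 1)] k, q.2)) ?_ ?_ ?_ ?_
  · simp
  · rintro ⟨x, t⟩ -
    refine Finset.mem_filter.2 ⟨Finset.mem_univ _, ?_⟩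
    fin_cases k
    · rfl
    · rfl
    · simp [strip]
      ring
  · rintro ⟨⟨x, y⟩, t⟩ hf
    obtain rfl := (Finset.mem_filter.1 hf).2
    fin_cases k
    · rfl
    · rfl
    · simp [strip]
      grind
  · rintro ⟨x, t⟩ -
    fin_cases k <;> rfl

lemma card_mul_le_of_strip_subset {P : Finset (Site (ZMod L))} {k : Fin 3} {C : Finset (ZMod L)}
    (hC : ∀ c ∈ C, ∀ f, strip k f = c → f ∈ P) : C.card * (2 * L) ≤ P.card := by
  rw [← smul_eq_mul, ← Finset.sum_const, ← Finset.sum_congr rfl fun c _ => card_filter_strip_eq k c,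
    Finset.sum_card_fiberwise_eq_card_filter]
  exact Finset.card_le_card fun f hf => hC _ (Finset.mem_filter.1 hf).2 f rfl

lemma not_strip_subset_of_small {P : Finset (Site (ZMod L))}
    (h : P.card + L * perimeter P < 2 * L ^ 2) (k : Fin 3) (c : ZMod L) :
    ¬ ∀ f, strip k f = c → f ∈ P := by
  intro hfull
  have himage : P.image (strip (k + 1)) = Finset.univ := by
    refine Finset.eq_univ_of_forall fun c' => ?_
    obtain ⟨f, hf, hf'⟩ := exists_strip_eq k c c'
    exact Finset.mem_image.2 ⟨f, hfull f hf, hf'⟩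
  have hpartial := two_mul_card_strip_filter_le P (k + 1)
  rw [himage] at hpartial
  have hcontained := card_mul_le_of_strip_subset (P := P) (k := k + 1)
    (C := Finset.univ.filter fun c => ∀ f, strip (k + 1) f = c → f ∈ P) (by simp)
  have hsum := Finset.card_filter_add_card_filter_not (s := (Finset.univ : Finset (ZMod L)))
    (fun c => ∀ f, strip (k + 1) f = c → f ∈ P)
  rw [Finset.card_univ, ZMod.card] at hsum
  nlinarith

lemma two_mul_card_image_strip_le {P : Finset (Site (ZMod L))}
    (h : P.card + L * perimeter P < 2 * L ^ 2) (k : Fin 3) :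
    2 * (P.image (strip k)).card ≤ perimeter P := by
  have := two_mul_card_strip_filter_le P k
  rwa [Finset.filter_true_of_mem fun c _ => not_strip_subset_of_small h k c] at this

/-- The lift to the plane of the torus cut along the strips `a` and `b`. -/
def lift (a b : ZMod L) (f : Site (ZMod L)) : Site ℤ :=
  ((((f.1.1 - a).val + a.val : ℤ), ((f.1.2 - b).val + b.val : ℤ)), f.2)

lemma toTorus_lift (a b : ZMod L) (f : Site (ZMod L)) : toTorus L (lift a b f) = f := by
  obtain ⟨⟨x, y⟩, t⟩ := f
  simp [toTorus, lift]

lemma lift_injective (a b : ZMod L) : Function.Injective (lift a b) :=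
  Function.LeftInverse.injective (toTorus_lift a b)

/-- The face `f` lies on neither of the strips `a` and `b` along which the torus is cut. -/
def OffCut (a b : ZMod L) (f : Site (ZMod L)) : Prop := strip 0 f ≠ a ∧ strip 1 f ≠ b

lemma val_sub_one_sub {x a : ZMod L} (h : x ≠ a) :
    ((x - 1 - a).val : ℤ) = (x - a).val - 1 := by
  have hne : (x - a).val ≠ 0 := by
    rw [Ne, ZMod.val_eq_zero, sub_eq_zero]
    exact h
  have heq : x - 1 - a = ((((x - a).val - 1 : ℕ)) : ZMod L) := by
    rw [Nat.cast_sub (by omega), ZMod.natCast_zmod_val]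
    ring
  have hlt := ZMod.val_lt (x - a)
  rw [heq, ZMod.val_natCast_of_lt (by omega)]
  omega

lemma val_add_one_sub {x a : ZMod L} (h : x + 1 ≠ a) :
    ((x + 1 - a).val : ℤ) = (x - a).val + 1 := by
  have := val_sub_one_sub h
  rw [add_sub_cancel_right] at this
  omega

lemma lift_neighbor {a b : ZMod L} {f : Site (ZMod L)} {i : Fin 3} (hf : OffCut a b f)
    (hi : OffCut a b (neighbor f i)) : lift a b (neighbor f i) = neighbor (lift a b f) i := by
  obtain ⟨⟨x, y⟩, t⟩ := f
  obtain ⟨hx, hy⟩ := hf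
  obtain ⟨hx', hy'⟩ := hi
  fin_cases i <;> cases t <;> simp [neighbor, strip_zero, strip_one] at hx hy hx' hy' <;>
    simp [neighbor, lift, val_sub_one_sub, val_add_one_sub, -ZMod.natCast_val, *] <;> ring

lemma neighbor_lift_mem_iff {a b : ZMod L} {f : Site (ZMod L)} {i : Fin 3}
    {S : Finset (Site (ZMod L))} (hf : OffCut a b f) (hS : ∀ g ∈ S, OffCut a b g) :
    neighbor (lift a b f) i ∈ S.image (lift a b) ↔ neighbor f i ∈ S := by
  rw [Finset.mem_image]
  constructor
  · rintro ⟨g, hg, h⟩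
    have := congrArg (toTorus L) h
    rw [toTorus_neighbor, toTorus_lift, toTorus_lift] at this
    rwa [← this]
  · intro h
    exact ⟨_, h, lift_neighbor hf (hS _ h)⟩

lemma perimeter_image_lift {a b : ZMod L} {S : Finset (Site (ZMod L))}
    (hS : ∀ g ∈ S, OffCut a b g) : perimeter (S.image (lift a b)) = perimeter S := by
  rw [perimeter, Finset.sum_image (lift_injective a b).injOn, perimeter]
  refine Finset.sum_congr rfl fun f hf => ?_
  congr 1
  ext i
  simp only [Finset.mem_filter, Finset.mem_univ, true_and]
  rw [neighbor_lift_mem_iff (hS f hf) hS]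

lemma contacts_image_lift {a b : ZMod L} {f : Site (ZMod L)} {S : Finset (Site (ZMod L))}
    (hf : OffCut a b f) (hS : ∀ g ∈ S, OffCut a b g) :
    contacts (S.image (lift a b)) (lift a b f) = contacts S f := by
  rw [contacts, contacts]
  congr 1
  ext i
  simp only [Finset.mem_filter, Finset.mem_univ, true_and]
  rw [neighbor_lift_mem_iff hf hS]

lemma card_image_lift (a b : ZMod L) (S : Finset (Site (ZMod L))) :
    (S.image (lift a b)).card = S.card :=
  Finset.card_image_of_injective _ (lift_injective a b)

lemma image_toTorus_image_lift (a b : ZMod L) (S : Finset (Site (ZMod L))) :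
    (S.image (lift a b)).image (toTorus L) = S := by
  rw [Finset.image_image, show toTorus L ∘ lift a b = id from funext fun f => toTorus_lift a b f,
    Finset.image_id]

lemma exists_notMem_image_of_card_lt {α : Type*} {S : Finset α} {row : α → ZMod L}
    (h : (S.image row).card < L) : ∃ a, ∀ g ∈ S, row g ≠ a := by
  by_contra! hsurj
  rw [Finset.eq_univ_of_forall fun a => Finset.mem_image.2 (hsurj a), Finset.card_univ,
    ZMod.card] at h
  exact lt_irrefl _ h

lemma exists_offCut_of_small {P : Finset (Site (ZMod L))}
    (h : P.card + L * perimeter P < 2 * L ^ 2) : ∃ a b, ∀ g ∈ P, OffCut a b g := by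
  have hstrip := two_mul_card_image_strip_le h
  have hlt := perimeter_lt_of_small h
  obtain ⟨a, ha⟩ := exists_notMem_image_of_card_lt (S := P) (row := strip 0)
    (by have := hstrip 0; omega)
  obtain ⟨b, hb⟩ := exists_notMem_image_of_card_lt (S := P) (row := strip 1)
    (by have := hstrip 1; omega)
  exact ⟨a, b, fun g hg => ⟨ha g hg, hb g hg⟩⟩

lemma six_mul_card_le_perimeter_sq_of_small {P : Finset (Site (ZMod L))}
    (h : P.card + L * perimeter P < 2 * L ^ 2) : 6 * P.card ≤ perimeter P ^ 2 := by
  obtain ⟨a, b, hab⟩ := exists_offCut_of_small h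
  have := six_mul_card_le_perimeter_sq (P.image (lift a b))
  rwa [card_image_lift, perimeter_image_lift hab] at this

end Torus

section Energy

variable {L : ℕ}

/-- The configuration with a given set of sites with spin `+1`. -/
def configOf (S : Finset (Site (ZMod L))) : Config L := fun s => if s ∈ S then 1 else -1

lemma configOf_apply_eq_one_iff {S : Finset (Site (ZMod L))} {s : Site (ZMod L)} :
    configOf S s = 1 ↔ s ∈ S := by
  by_cases h : s ∈ S
  · simp [configOf, h]
  · simp only [configOf, h, if_false, iff_false]
    decide

/-- The energy of the configuration with set of pluses `S`, relative to the one of all minuses. -/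
def energy (J h : ℝ) (S : Finset (Site (ZMod L))) : ℝ := J * perimeter S - h * S.card

lemma neighbor_injective (hL : 2 ≤ L) (f : Site (ZMod L)) : Function.Injective (neighbor f) := by
  have : Fact (1 < L) := ⟨hL⟩
  obtain ⟨⟨x, y⟩, t⟩ := f
  intro i j h
  fin_cases i <;> fin_cases j <;> cases t <;> simp [neighbor, eq_sub_iff_add_eq] at h ⊢

variable [NeZero L]

/-- The set of sites with spin `+1`, as a finite set. -/
def plusFinset (σ : Config L) : Finset (Site (ZMod L)) := Finset.univ.filter fun s => σ s = 1

@[simp] lemma mem_plusFinset {σ : Config L} {s : Site (ZMod L)} : s ∈ plusFinset σ ↔ σ s = 1 := by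
  simp [plusFinset]

@[simp] lemma plusFinset_configOf (S : Finset (Site (ZMod L))) : plusFinset (configOf S) = S := by
  ext s
  rw [mem_plusFinset, configOf_apply_eq_one_iff]

@[simp] lemma configOf_plusFinset (σ : Config L) : configOf (plusFinset σ) = σ := by
  funext s
  rcases Int.units_eq_one_or (σ s) with h | h
  · simp [configOf, h]
  · have : ¬ ((-1 : ℤˣ) = 1) := by decide
    simp [configOf, h, this]

lemma coe_plusFinset (σ : Config L) : (plusFinset σ : Set (Site (ZMod L))) = plusSet σ := by
  ext s
  simp [plusSet]

@[simp] lemma plusFinset_allMinus : plusFinset (allMinus L) = ∅ := by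
  ext s
  simp only [mem_plusFinset, allMinus, Finset.notMem_empty, iff_false]
  decide

@[simp] lemma plusFinset_allPlus : plusFinset (allPlus L) = Finset.univ := by
  ext s
  simp [allPlus]

lemma sum_edgeFinset (hL : 2 ≤ L) (F : Sym2 (Site (ZMod L)) → ℝ)
    [Fintype (hexLattice (ZMod L)).edgeSet] :
    ∑ e ∈ (hexLattice (ZMod L)).edgeFinset, F e =
      ∑ q ∈ (Finset.univ.filter fun f : Site (ZMod L) => f.2 = true) ×ˢ
        (Finset.univ : Finset (Fin 3)), F s(q.1, neighbor q.1 q.2) := by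
  symm
  refine Finset.sum_bij (fun q _ => s(q.1, neighbor q.1 q.2)) ?_ ?_ ?_ (fun _ _ => rfl)
  · rintro ⟨f, i⟩ _
    rw [SimpleGraph.mem_edgeFinset, SimpleGraph.mem_edgeSet, hexLattice_adj_iff]
    exact ⟨i, rfl⟩
  · rintro ⟨f, i⟩ hf ⟨g, j⟩ hg hfg
    simp only [Finset.mem_product, Finset.mem_filter, Finset.mem_univ, true_and, and_true] at hf hg
    rcases Sym2.eq_iff.1 hfg with ⟨hfg, hij⟩ | ⟨hswap, -⟩
    · dsimp only at hfg hij
      subst hfg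
      rw [neighbor_injective hL f hij]
    · have := congrArg Prod.snd hswap
      simp [neighbor_snd, hf, hg] at this
  · intro e he
    induction e using Sym2.ind with
    | _ f g =>
      rw [SimpleGraph.mem_edgeFinset, SimpleGraph.mem_edgeSet, hexLattice_adj_iff] at he
      obtain ⟨i, rfl⟩ := he
      cases ht : f.2
      · refine ⟨(neighbor f i, i), by simp [neighbor_snd, ht], ?_⟩
        rw [neighbor_neighbor, Sym2.eq_swap]
      · exact ⟨(f, i), by simp [ht], rfl⟩

lemma spin_eq (σ : Config L) (s : Site (ZMod L)) :
    ((σ s : ℤ) : ℝ) = if s ∈ plusFinset σ then 1 else -1 := by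
  rw [← configOf_plusFinset σ, plusFinset_configOf]
  by_cases h : s ∈ plusFinset σ <;> simp [configOf, h]

lemma sum_disagree (S : Finset (Site (ZMod L))) :
    (∑ q ∈ (Finset.univ.filter fun f : Site (ZMod L) => f.2 = true) ×ˢ
        (Finset.univ : Finset (Fin 3)), if (q.1 ∈ S ↔ neighbor q.1 q.2 ∈ S) then 0 else 1) =
      perimeter S := by
  rw [Finset.sum_product_right, perimeter_eq_sum_direction]
  refine Finset.sum_congr rfl fun i _ => ?_
  have hfalse : (S.filter fun f => f.2 = false ∧ neighbor f i ∉ S).card =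
      ((Finset.univ.filter fun f : Site (ZMod L) => f.2 = true).filter
        fun f => f ∉ S ∧ neighbor f i ∈ S).card := by
    refine Finset.card_bij' (fun f _ => neighbor f i) (fun f _ => neighbor f i) ?_ ?_ ?_ ?_ <;>
      simp +contextual [neighbor_snd]
  have htrue : (S.filter fun f => f.2 = true ∧ neighbor f i ∉ S).card =
      ((Finset.univ.filter fun f : Site (ZMod L) => f.2 = true).filter
        fun f => f ∈ S ∧ neighbor f i ∉ S).card := by
    congr 1
    ext f
    simp only [Finset.mem_filter, Finset.mem_univ, true_and]
    tauto
  rw [hfalse, htrue, Finset.card_filter, Finset.card_filter, ← Finset.sum_add_distrib]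
  refine Finset.sum_congr rfl fun f _ => ?_
  by_cases hf : f ∈ S <;> by_cases hfi : neighbor f i ∈ S <;> simp [hf, hfi]

lemma hamiltonian_eq_add_energy (hL : 2 ≤ L) (J h : ℝ) (σ : Config L) :
    hamiltonian J h σ = (h - 3 / 2 * J) * L ^ 2 + energy J h (plusFinset σ) := by
  have hedge : ∀ q : Site (ZMod L) × Fin 3,
      (Sym2.map (fun s => ((σ s : ℤ) : ℝ)) s(q.1, neighbor q.1 q.2)).mul = 1 - 2 *
        ((if (q.1 ∈ plusFinset σ ↔ neighbor q.1 q.2 ∈ plusFinset σ) then 0 else 1 : ℕ) : ℝ) := by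
    intro q
    rw [Sym2.map_mk, Sym2.mul_mk, spin_eq, spin_eq]
    by_cases hq : q.1 ∈ plusFinset σ <;> by_cases hq' : neighbor q.1 q.2 ∈ plusFinset σ <;>
      simp only [hq, hq'] <;> norm_num
  have hsite : ∀ s : Site (ZMod L),
      ((σ s : ℤ) : ℝ) = 2 * (if s ∈ plusFinset σ then 1 else 0) - 1 := by
    intro s
    rw [spin_eq]
    split_ifs <;> norm_num
  have hcard : (Finset.univ.filter fun f : Site (ZMod L) => f.2 = true).card = L ^ 2 := by
    rw [show (Finset.univ.filter fun f : Site (ZMod L) => f.2 = true) = Finset.univ ×ˢ {true} by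
      ext ⟨v, t⟩; simp, Finset.card_product]
    simp [ZMod.card, sq]
  rw [hamiltonian, sum_edgeFinset hL, Finset.sum_congr rfl fun q _ => hedge q,
    Finset.sum_congr rfl fun s _ => hsite s, Finset.sum_sub_distrib, Finset.sum_sub_distrib,
    ← Finset.mul_sum, ← Finset.mul_sum, ← Nat.cast_sum, sum_disagree, Finset.sum_ite_mem,
    Finset.univ_inter, energy]
  simp only [Finset.sum_const, nsmul_eq_mul, mul_one, Finset.card_product, hcard, Finset.card_univ,
    Fintype.card_fin, Fintype.card_prod, ZMod.card, Fintype.card_bool]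
  push_cast
  ring

lemma hamiltonian_eq (hL : 2 ≤ L) (J h : ℝ) (σ : Config L) :
    hamiltonian J h σ = hamiltonian J h (allMinus L) + energy J h (plusFinset σ) := by
  rw [hamiltonian_eq_add_energy hL, hamiltonian_eq_add_energy hL J h (allMinus L),
    plusFinset_allMinus]
  simp [energy]

end Energy

section Rotation

/-- The rotation of the plane by `π / 3` around the origin. -/
def rotate (f : Site ℤ) : Site ℤ :=
  if f.2 then ((-f.1.2 - 1, f.1.1 + f.1.2), false) else ((-f.1.2 - 1, f.1.1 + f.1.2 + 1), true)

lemma rotate_neighbor (f : Site ℤ) (i : Fin 3) :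
    rotate (neighbor f i) = neighbor (rotate f) (i + 2) := by
  obtain ⟨⟨x, y⟩, t⟩ := f
  fin_cases i <;> cases t <;> simp [rotate, neighbor] <;> grind

lemma faceForm_rotate (f : Site ℤ) (k : Fin 6) : faceForm (rotate f) (k + 1) = faceForm f k := by
  obtain ⟨⟨x, y⟩, t⟩ := f
  fin_cases k <;> cases t <;> simp [rotate, faceForm, strip] <;> ring

lemma rotate_surjective : Function.Surjective rotate := by
  rintro ⟨⟨x, y⟩, t⟩
  cases t
  · exact ⟨((x + y + 1, -x - 1), true), by simp [rotate]⟩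
  · exact ⟨((x + y, -x - 1), false), by simp [rotate]; ring⟩

lemma rotate_injective : Function.Injective rotate := by
  rintro ⟨⟨x, y⟩, t⟩ ⟨⟨x', y'⟩, t'⟩ h
  cases t <;> cases t' <;> simp [rotate] at h ⊢ <;> omega

lemma rotate_mem_hexagonFinset {b : Fin 6 → ℤ} {f : Site ℤ} :
    rotate f ∈ hexagonFinset b ↔ f ∈ hexagonFinset fun k => b (k + 1) := by
  rw [mem_hexagonFinset, mem_hexagonFinset]
  constructor
  · intro h k
    rw [← faceForm_rotate]
    exact h _
  · intro h k
    have := h (k - 1)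
    rwa [sub_add_cancel, ← faceForm_rotate, sub_add_cancel] at this

lemma sideLength_comp_add_one (b : Fin 6 → ℤ) (k : Fin 6) :
    sideLength (fun j => b (j + 1)) k = sideLength b (k + 1) := by
  simp only [sideLength, add_sub_cancel_right, sub_add_cancel]

lemma pushSide_comp_add_one (b : Fin 6 → ℤ) (k : Fin 6) :
    pushSide (fun j => b (j + 1)) k = fun j => pushSide b (k + 1) (j + 1) := by
  funext j
  simp [pushSide, Function.update_apply]

end Rotation

section Bars

/-- The faces `f n` form the row outside of the side `k` of the hexagon, `n = 0` being the first
face of the bar on that side.  The faces of even index share an edge of direction `i₂` with the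
hexagon; the edges between consecutive faces of the row have the directions `i₀` and `i₁`. -/
structure IsBar (b : Fin 6 → ℤ) (k : Fin 6) (f : ℤ → Site ℤ) (i₀ i₁ i₂ : Fin 3) : Prop where
  ne₀₁ : i₀ ≠ i₁
  ne₀₂ : i₀ ≠ i₂
  ne₁₂ : i₁ ≠ i₂
  odd : ∀ j, f (2 * j + 1) = neighbor (f (2 * j)) i₀
  even : ∀ j, f (2 * j + 2) = neighbor (f (2 * j + 1)) i₁
  inj : Function.Injective f
  mem : ∀ g, (g ∈ hexagonFinset (pushSide b k) ∧ g ∉ hexagonFinset b) ↔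
    ∃ n, 0 ≤ n ∧ n < 2 * sideLength b k - 1 ∧ f n = g
  below : ∀ j, 0 ≤ j → j < sideLength b k → neighbor (f (2 * j)) i₂ ∈ hexagonFinset b
  above : ∀ j, neighbor (f (2 * j + 1)) i₂ ∉ hexagonFinset (pushSide b k)
  notMem : ∀ n, f n ∉ hexagonFinset b

/-- The row of faces outside of the side `0` of `hexagon b`. -/
def rowZero (b : Fin 6 → ℤ) (n : ℤ) : Site ℤ := ((b 0, -b 5 + n / 2), decide (n % 2 = 0))

lemma rowZero_two_mul (b : Fin 6 → ℤ) (j : ℤ) : rowZero b (2 * j) = ((b 0, -b 5 + j), true) := by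
  simp [rowZero]

lemma rowZero_two_mul_add_one (b : Fin 6 → ℤ) (j : ℤ) :
    rowZero b (2 * j + 1) = ((b 0, -b 5 + j), false) := by
  have hdiv : (2 * j + 1) / 2 = j := by omega
  simp [rowZero, hdiv]

lemma faceForm_rowZero_zero (b : Fin 6 → ℤ) (n : ℤ) : faceForm (rowZero b n) 0 = b 0 + 1 := rfl

lemma rowZero_notMem (b : Fin 6 → ℤ) (n : ℤ) : rowZero b n ∉ hexagonFinset b := fun h => by
  have := mem_hexagonFinset.1 h 0
  rw [faceForm_rowZero_zero] at this
  omega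

lemma mem_pushSide_zero_iff {b : Fin 6 → ℤ} {f : Site ℤ} :
    f ∈ hexagonFinset (pushSide b 0) ∧ f ∉ hexagonFinset b ↔
      f.1.1 = b 0 ∧ ∀ k ≠ 0, faceForm f k ≤ b k := by
  have hne : ∀ k ≠ 0, pushSide b 0 k = b k := fun k hk => by simp [pushSide, hk]
  have hzero : pushSide b 0 0 = b 0 + 1 := by simp [pushSide]
  have hform : faceForm f 0 = f.1.1 + 1 := rfl
  rw [mem_hexagonFinset, mem_hexagonFinset]
  constructor
  · rintro ⟨hpush, hnot⟩
    have hpos : ∀ k ≠ 0, faceForm f k ≤ b k := fun k hk => hne k hk ▸ hpush k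
    refine ⟨?_, hpos⟩
    by_contra hx
    refine hnot fun k => ?_
    by_cases hk : k = 0
    · subst hk
      have := hpush 0
      omega
    · exact hpos k hk
  · rintro ⟨hx, hpos⟩
    refine ⟨fun k => ?_, fun h => by have := h 0; omega⟩
    by_cases hk : k = 0
    · subst hk
      omega
    · exact hne k hk ▸ hpos k hk

lemma one_le_width {b : Fin 6 → ℤ} (h : (hexagonFinset b).Nonempty) : 1 ≤ b 0 + b 3 := by
  obtain ⟨f, hf⟩ := h
  have hright := mem_hexagonFinset.1 hf 0
  have hleft := mem_hexagonFinset.1 hf 3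
  simp [faceForm] at hright hleft
  omega

lemma mem_pushSide_zero_iff_exists {b : Fin 6 → ℤ} (hb : ∀ k, 0 ≤ sideLength b k)
    (hne : (hexagonFinset b).Nonempty) (g : Site ℤ) :
    g ∈ hexagonFinset (pushSide b 0) ∧ g ∉ hexagonFinset b ↔
      ∃ n, 0 ≤ n ∧ n < 2 * sideLength b 0 - 1 ∧ rowZero b n = g := by
  have hwidth := one_le_width hne
  have e : (-1 : Fin 6) = 5 := rfl
  rw [forall_sideLength_nonneg_iff] at hb
  rw [mem_pushSide_zero_iff]
  simp only [sideLength, zero_sub, zero_add, e]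
  obtain ⟨⟨x, y⟩, t⟩ := g
  constructor
  · rintro ⟨hx, hpos⟩
    have hupper := hpos 1 (by decide)
    have hlower := hpos 5 (by decide)
    simp only [faceForm, strip] at hx hupper hlower
    cases t
    · refine ⟨2 * (y + b 5) + 1, ?_⟩
      rw [rowZero_two_mul_add_one]
      simp at hupper hlower ⊢
      omega
    · refine ⟨2 * (y + b 5), ?_⟩
      rw [rowZero_two_mul]
      simp at hupper hlower ⊢
      omega
  · rintro ⟨n, hn, hlt, heq⟩
    rcases Int.even_or_odd' n with ⟨j, rfl | rfl⟩
    · rw [rowZero_two_mul] at heq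
      obtain ⟨⟨rfl, rfl⟩, rfl⟩ : (b 0 = x ∧ -b 5 + j = y) ∧ true = t := by simpa using heq
      simp [Fin.forall_fin_succ, faceForm, strip]
      omega
    · rw [rowZero_two_mul_add_one] at heq
      obtain ⟨⟨rfl, rfl⟩, rfl⟩ : (b 0 = x ∧ -b 5 + j = y) ∧ false = t := by simpa using heq
      simp [Fin.forall_fin_succ, faceForm, strip]
      omega

lemma isBar_rowZero {b : Fin 6 → ℤ} (hb : ∀ k, 0 ≤ sideLength b k)
    (hne : (hexagonFinset b).Nonempty) : IsBar b 0 (rowZero b) 0 2 1 where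
  ne₀₁ := by decide
  ne₀₂ := by decide
  ne₁₂ := by decide
  odd j := by simp [rowZero_two_mul, rowZero_two_mul_add_one, neighbor]
  even j := by
    rw [show 2 * j + 2 = 2 * (j + 1) by ring, rowZero_two_mul, rowZero_two_mul_add_one]
    simp [neighbor]
    ring
  inj m n h := by
    simp only [rowZero, Prod.mk.injEq, decide_eq_decide] at h
    omega
  mem := mem_pushSide_zero_iff_exists hb hne
  below j hj hlt := by
    have hwidth := one_le_width hne
    have e : (-1 : Fin 6) = 5 := rfl
    rw [forall_sideLength_nonneg_iff] at hb
    rw [rowZero_two_mul, mem_hexagonFinset]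
    simp [sideLength, e] at hlt
    simp [Fin.forall_fin_succ, faceForm, strip, neighbor]
    omega
  above j h := by
    rw [rowZero_two_mul_add_one] at h
    have := mem_hexagonFinset.1 h 0
    simp [faceForm, strip, neighbor, pushSide] at this
  notMem := rowZero_notMem b

lemma IsBar.rotate {b : Fin 6 → ℤ} {k : Fin 6} {f : ℤ → Site ℤ} {i₀ i₁ i₂ : Fin 3}
    (h : IsBar (fun k => b (k + 1)) k f i₀ i₁ i₂) :
    IsBar b (k + 1) (fun n => rotate (f n)) (i₀ + 2) (i₁ + 2) (i₂ + 2) where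
  ne₀₁ e := h.ne₀₁ (add_right_cancel e)
  ne₀₂ e := h.ne₀₂ (add_right_cancel e)
  ne₁₂ e := h.ne₁₂ (add_right_cancel e)
  odd j := by rw [h.odd, rotate_neighbor]
  even j := by rw [h.even, rotate_neighbor]
  inj := rotate_injective.comp h.inj
  mem g := by
    obtain ⟨g, rfl⟩ := rotate_surjective g
    rw [rotate_mem_hexagonFinset, rotate_mem_hexagonFinset, ← pushSide_comp_add_one, h.mem,
      sideLength_comp_add_one]
    simp only [rotate_injective.eq_iff]
  below j hj hlt := by
    rw [← rotate_neighbor, rotate_mem_hexagonFinset]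
    exact h.below j hj (by rwa [sideLength_comp_add_one])
  above j := by
    rw [← rotate_neighbor, rotate_mem_hexagonFinset, ← pushSide_comp_add_one]
    exact h.above j
  notMem n := by
    rw [rotate_mem_hexagonFinset]
    exact h.notMem n

lemma exists_isBar (k : Fin 6) (b : Fin 6 → ℤ) (hb : ∀ k, 0 ≤ sideLength b k)
    (hne : (hexagonFinset b).Nonempty) : ∃ f i₀ i₁ i₂, IsBar b k f i₀ i₁ i₂ := by
  induction k using Fin.induction generalizing b with
  | zero => exact ⟨_, _, _, _, isBar_rowZero hb hne⟩
  | succ k ih =>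
    obtain ⟨f, i₀, i₁, i₂, h⟩ := ih (fun j => b (j + 1))
      (fun j => sideLength_comp_add_one b j ▸ hb (j + 1)) (by
        obtain ⟨g, hg⟩ := hne
        obtain ⟨g, rfl⟩ := rotate_surjective g
        exact ⟨g, rotate_mem_hexagonFinset.1 hg⟩)
    rw [← Fin.coeSucc_eq_succ]
    exact ⟨_, _, _, _, h.rotate⟩

lemma not_adj_of_common_neighbor {f g u : Site ℤ} (hfg : (hexLattice ℤ).Adj f g)
    (hgu : (hexLattice ℤ).Adj g u) : ¬ (hexLattice ℤ).Adj f u := by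
  simp only [hexLattice_adj_iff] at hfg hgu ⊢
  obtain ⟨i, rfl⟩ := hfg
  obtain ⟨j, rfl⟩ := hgu
  rintro ⟨l, hl⟩
  simpa [neighbor_snd] using congrArg Prod.snd hl

namespace IsBar

variable {b : Fin 6 → ℤ} {k : Fin 6} {f : ℤ → Site ℤ} {i₀ i₁ i₂ : Fin 3}

lemma neighbor_even_zero (h : IsBar b k f i₀ i₁ i₂) (j : ℤ) :
    neighbor (f (2 * j)) i₀ = f (2 * j + 1) :=
  (h.odd j).symm

lemma neighbor_odd_zero (h : IsBar b k f i₀ i₁ i₂) (j : ℤ) :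
    neighbor (f (2 * j + 1)) i₀ = f (2 * j) := by
  rw [h.odd, neighbor_neighbor]

lemma neighbor_odd_one (h : IsBar b k f i₀ i₁ i₂) (j : ℤ) :
    neighbor (f (2 * j + 1)) i₁ = f (2 * j + 2) :=
  (h.even j).symm

lemma neighbor_even_one (h : IsBar b k f i₀ i₁ i₂) (j : ℤ) :
    neighbor (f (2 * j)) i₁ = f (2 * j - 1) := by
  rw [neighbor_eq_iff]
  convert h.even (j - 1) using 2 <;> ring_nf

lemma index_cases (h : IsBar b k f i₀ i₁ i₂) (i : Fin 3) : i = i₀ ∨ i = i₁ ∨ i = i₂ := by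
  have := h.ne₀₁
  have := h.ne₀₂
  have := h.ne₁₂
  omega

lemma neighbor_odd_notMem (h : IsBar b k f i₀ i₁ i₂) (j : ℤ) (i : Fin 3) :
    neighbor (f (2 * j + 1)) i ∉ hexagonFinset b := by
  rcases h.index_cases i with rfl | rfl | rfl
  · rw [h.neighbor_odd_zero]
    exact h.notMem _
  · rw [h.neighbor_odd_one]
    exact h.notMem _
  · exact fun hi => h.above j (hexagonFinset_mono (le_pushSide b k) hi)

lemma even_of_contacts (h : IsBar b k f i₀ i₁ i₂) {n : ℤ}
    (hn : 1 ≤ contacts (hexagonFinset b) (f n)) : ∃ j, n = 2 * j := by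
  rcases Int.even_or_odd' n with ⟨j, rfl | rfl⟩
  · exact ⟨j, rfl⟩
  · obtain ⟨i, hi⟩ := exists_of_one_le_contacts hn
    exact absurd hi (h.neighbor_odd_notMem j i)

lemma adj_of_contacts_insert_odd (h : IsBar b k f i₀ i₁ i₂) {x : Site ℤ} {j : ℤ}
    (hx : 1 ≤ contacts (insert x (hexagonFinset b)) (f (2 * j + 1))) :
    (hexLattice ℤ).Adj x (f (2 * j + 1)) := by
  obtain ⟨i, hi⟩ := exists_of_one_le_contacts hx
  rw [SimpleGraph.adj_comm, hexLattice_adj_iff]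
  exact ⟨i, ((Finset.mem_insert.1 hi).resolve_right (h.neighbor_odd_notMem j i)).symm⟩

lemma mem_of_two_le_contacts_even (h : IsBar b k f i₀ i₁ i₂) {S : Finset (Site ℤ)} {j : ℤ}
    (hS : 2 ≤ contacts S (f (2 * j))) : f (2 * j - 1) ∈ S ∨ f (2 * j + 1) ∈ S := by
  rw [← h.neighbor_even_zero, ← h.neighbor_even_one]
  obtain ⟨i, i', hne, hi, hi'⟩ := exists_of_two_le_contacts hS
  rcases h.index_cases i with rfl | rfl | rfl
  · exact .inr hi
  · exact .inl hi
  · rcases h.index_cases i' with rfl | rfl | rfl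
    · exact .inr hi'
    · exact .inl hi'
    · exact absurd rfl hne

lemma mem_of_two_le_contacts_odd (h : IsBar b k f i₀ i₁ i₂) {S : Finset (Site ℤ)}
    (hsub : S ⊆ hexagonFinset (pushSide b k)) {j : ℤ} (hS : 2 ≤ contacts S (f (2 * j + 1))) :
    f (2 * j) ∈ S ∧ f (2 * j + 2) ∈ S := by
  rw [← h.neighbor_odd_zero, ← h.neighbor_odd_one]
  obtain ⟨i, i', hne, hi, hi'⟩ := exists_of_two_le_contacts hS
  have habove : neighbor (f (2 * j + 1)) i₂ ∉ S := fun hmem => h.above j (hsub hmem)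
  rcases h.index_cases i with rfl | rfl | rfl <;> rcases h.index_cases i' with rfl | rfl | rfl
  all_goals first
    | exact absurd rfl hne
    | exact absurd hi habove
    | exact absurd hi' habove
    | exact ⟨hi, hi'⟩
    | exact ⟨hi', hi⟩

lemma adj_succ (h : IsBar b k f i₀ i₁ i₂) (n : ℤ) : (hexLattice ℤ).Adj (f n) (f (n + 1)) := by
  rw [hexLattice_adj_iff]
  rcases Int.even_or_odd' n with ⟨j, rfl | rfl⟩
  · exact ⟨i₀, h.odd j⟩
  · exact ⟨i₁, by rw [add_assoc]; exact h.even j⟩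

lemma dist_add_two (h : IsBar b k f i₀ i₁ i₂) (n : ℤ) :
    (hexLattice ℤ).dist (f n) (f (n + 2)) = 2 := by
  have hadj := h.adj_succ n
  have hadj' : (hexLattice ℤ).Adj (f (n + 1)) (f (n + 2)) := by
    simpa [add_assoc] using h.adj_succ (n + 1)
  have hle : (hexLattice ℤ).dist (f n) (f (n + 2)) ≤ 2 :=
    SimpleGraph.dist_le (.cons hadj (.cons hadj' .nil))
  have hne_zero : (hexLattice ℤ).dist (f n) (f (n + 2)) ≠ 0 := by
    rw [Ne, (hadj.reachable.trans hadj'.reachable).dist_eq_zero_iff, h.inj.eq_iff]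
    omega
  have hne_one : (hexLattice ℤ).dist (f n) (f (n + 2)) ≠ 1 := by
    rw [Ne, SimpleGraph.dist_eq_one_iff_adj]
    exact not_adj_of_common_neighbor hadj hadj'
  omega

lemma attached (h : IsBar b k f i₀ i₁ i₂) {j : ℤ} (hj : 0 ≤ j) (hlt : j < sideLength b k) :
    IsAttachedTo (f (2 * j)) (hexagon b) := by
  refine ⟨_, ?_, (hexLattice_adj_iff _ _).2 ⟨i₂, rfl⟩⟩
  rw [← coe_hexagonFinset]
  exact h.below j hj hlt

lemma adj_or_dist_eq_two (h : IsBar b k f i₀ i₁ i₂) {j l m : ℤ} (hne : 2 * j ≠ l)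
    (hj : 0 ≤ 2 * j ∧ 2 * j < 2 * sideLength b k - 1) (hl : 0 ≤ l ∧ l < 2 * sideLength b k - 1)
    (hsub : insert (f l) (insert (f (2 * j)) (hexagonFinset b)) ⊆ hexagonFinset (pushSide b k))
    (hcl : 1 ≤ contacts (insert (f (2 * j)) (hexagonFinset b)) (f l))
    (hcm : 2 ≤ contacts (insert (f l) (insert (f (2 * j)) (hexagonFinset b))) (f m)) :
    (hexLattice ℤ).Adj (f (2 * j)) (f l) ∨ IsAttachedTo (f (2 * j)) (hexagon b) ∧
      IsAttachedTo (f l) (hexagon b) ∧ (hexLattice ℤ).dist (f (2 * j)) (f l) = 2 := by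
  have hindex : ∀ n, f n ∈ insert (f l) (insert (f (2 * j)) (hexagonFinset b)) →
      n = l ∨ n = 2 * j := by
    intro n hn
    simpa [h.inj.eq_iff, h.notMem n] using hn
  rcases Int.even_or_odd' m with ⟨m, rfl | rfl⟩
  · left
    have hodd : ∃ q, l = 2 * q + 1 := by
      rcases h.mem_of_two_le_contacts_even hcm with hmem | hmem
      · exact ⟨m - 1, by have := hindex _ hmem; omega⟩
      · exact ⟨m, by have := hindex _ hmem; omega⟩
    obtain ⟨q, rfl⟩ := hodd
    exact h.adj_of_contacts_insert_odd hcl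
  · right
    obtain ⟨hleft, hright⟩ := h.mem_of_two_le_contacts_odd hsub hcm
    have := hindex _ hleft
    have := hindex _ hright
    have hcases : l = 2 * (j + 1) ∨ l = 2 * (j - 1) := by omega
    rcases hcases with rfl | rfl
    · refine ⟨h.attached (by omega) (by omega), h.attached (by omega) (by omega), ?_⟩
      simpa [mul_add] using h.dist_add_two (2 * j)
    · refine ⟨h.attached (by omega) (by omega), h.attached (by omega) (by omega), ?_⟩
      rw [SimpleGraph.dist_comm]
      simpa [mul_sub] using h.dist_add_two (2 * (j - 1))

end IsBar

lemma sideBar_eq (b : Fin 6 → ℤ) (k : Fin 6) {g : Site ℤ} :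
    g ∈ sideBar b k ↔ g ∈ hexagonFinset (pushSide b k) ∧ g ∉ hexagonFinset b := by
  rw [sideBar, ← coe_hexagonFinset, ← coe_hexagonFinset]
  rfl

lemma rhombus_or_dist_two {b : Fin 6 → ℤ} {k : Fin 6} (hb : ∀ k, 0 ≤ sideLength b k)
    (hne : (hexagonFinset b).Nonempty) {x g y : Site ℤ} (hx : x ∈ sideBar b k)
    (hg : g ∈ sideBar b k) (hy : y ∈ sideBar b k) (hxg : x ≠ g)
    (hcx : 1 ≤ contacts (hexagonFinset b) x) (hcg : 1 ≤ contacts (insert x (hexagonFinset b)) g)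
    (hcy : 2 ≤ contacts (insert g (insert x (hexagonFinset b))) y) :
    (hexLattice ℤ).Adj x g ∨ IsAttachedTo x (hexagon b) ∧ IsAttachedTo g (hexagon b) ∧
      (hexLattice ℤ).dist x g = 2 := by
  obtain ⟨f, i₀, i₁, i₂, h⟩ := exists_isBar k b hb hne
  rw [sideBar_eq] at hx hg hy
  have hsub : insert g (insert x (hexagonFinset b)) ⊆ hexagonFinset (pushSide b k) :=
    Finset.insert_subset hg.1 (Finset.insert_subset hx.1 (hexagonFinset_mono (le_pushSide b k)))
  obtain ⟨n, hn, hn', rfl⟩ := (h.mem x).1 hx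
  obtain ⟨l, hl, hl', rfl⟩ := (h.mem g).1 hg
  obtain ⟨m, -, -, rfl⟩ := (h.mem y).1 hy
  obtain ⟨j, rfl⟩ := h.even_of_contacts hcx
  exact h.adj_or_dist_eq_two (fun e => hxg (e ▸ rfl)) ⟨hn, hn'⟩ ⟨hl, hl'⟩ hsub hcg hcy

end Bars

section CriticalHexagon

/-- The relations between the side `L` of the torus, the perimeter `p` and the area `N` of the
critical quasi-regular hexagon, and the area `M` of this hexagon with one more bar. -/
structure CriticalSizes (L N p M : ℕ) : Prop where
  area_eq : 6 * N + 7 = p ^ 2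
  seven_le : 7 ≤ p
  lt_six_mul : (p + 1) ^ 2 < 6 * M + 6
  odd : N % 2 = 1
  even : M % 2 = 0
  le : N + 3 ≤ M
  cut : M + L * (p + 2) < 2 * L ^ 2
  width : p + 3 < 2 * L

/-- The bounds on the perimeter of a set of area at most `M` that result from the bound
`J (p + 2) - h (N + 2)` on its energy. -/
def Admissible {L : ℕ} (N p M : ℕ) (S : Finset (Site (ZMod L))) : Prop :=
  S.card ≤ M → perimeter S ≤ p + 2 ∧ (S.card < N + 2 → perimeter S ≤ p + 1)

/-- `Q` has the area and the perimeter of the critical quasi-regular hexagon, which determine its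
shape. -/
def IsCore {R : Type} [CommRing R] [DecidableEq R] (N p : ℕ) (Q : Finset (Site R)) : Prop :=
  Q.card = N ∧ perimeter Q = p

/-- A critical quasi-regular hexagon with one more face. -/
def IsCorePlus {L : ℕ} (N p : ℕ) (S : Finset (Site (ZMod L))) : Prop :=
  ∃ Q x, IsCore N p Q ∧ x ∉ Q ∧ S = insert x Q

/-- `T` has the area and the perimeter of the critical quasi-regular hexagon with one more bar. -/
def IsTarget {R : Type} [CommRing R] [DecidableEq R] (p M : ℕ) (T : Finset (Site R)) : Prop :=
  T.card = M ∧ perimeter T = p + 1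

/-- The set `S` has not yet crossed the gate.  Sets of area less than `M` that are contained in no
critical hexagon with one more bar count as not having crossed it. -/
def Subcritical {L : ℕ} (N p M : ℕ) (S : Finset (Site (ZMod L))) : Prop :=
  S.card < M ∧ (S.card ≤ N ∨ IsCorePlus N p S ∨ ∀ T, IsTarget p M T → ¬ S ⊆ T)

/-- The set `S̃(A) ∪ D̃(A)` of the theorem. -/
def gateConfigs (L A : ℕ) : Set (Config L) := canonicalConfigs L A ∪ defectiveConfigs L A

lemma IsCore.image_lift {L N p : ℕ} [NeZero L] {Q : Finset (Site (ZMod L))} (hQ : IsCore N p Q)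
    {a b : ZMod L} (hoff : ∀ f ∈ Q, OffCut a b f) : IsCore N p (Q.image (lift a b)) :=
  ⟨(card_image_lift a b Q).trans hQ.1, (perimeter_image_lift hoff).trans hQ.2⟩

lemma IsTarget.image_lift {L p M : ℕ} [NeZero L] {T : Finset (Site (ZMod L))}
    (hT : IsTarget p M T) {a b : ZMod L} (hoff : ∀ f ∈ T, OffCut a b f) :
    IsTarget p M (T.image (lift a b)) :=
  ⟨(card_image_lift a b T).trans hT.1, (perimeter_image_lift hoff).trans hT.2⟩

lemma contacts_hexagonFinset_le {b : Fin 6 → ℤ} {f : Site ℤ} (hf : f ∉ hexagonFinset b) :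
    contacts (hexagonFinset b) f ≤ 1 := by
  by_contra! h
  obtain ⟨i, j, hij, hi, hj⟩ := exists_of_two_le_contacts h
  rw [mem_hexagonFinset] at hi hj
  refine hf (mem_hexagonFinset.2 fun k => ?_)
  have hstrip := strip_neighbor_of_ne f hij
  have hstrip0 := hstrip 0
  have hstrip1 := hstrip 1
  have hstrip2 := hstrip 2
  have hik := hi k
  have hjk := hj k
  fin_cases k <;> simp [faceForm] at hik hjk ⊢ <;> omega

lemma eq_of_le_of_sum_le {ι : Type*} [Fintype ι] {b b' : ι → ℤ} (h : ∀ k, b k ≤ b' k)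
    (hs : ∑ k, b' k ≤ ∑ k, b k) : b = b' := by
  have hsum := (Finset.sum_eq_sum_iff_of_le fun k (_ : k ∈ Finset.univ) => h k).1
    (le_antisymm (Finset.sum_le_sum fun k _ => h k) hs)
  exact funext fun k => hsum k (Finset.mem_univ k)

lemma sum_pushSide (b : Fin 6 → ℤ) (k : Fin 6) : ∑ k', pushSide b k k' = ∑ k', b k' + 1 := by
  rw [pushSide, Finset.sum_update_of_mem (Finset.mem_univ k),
    ← Finset.add_sum_erase _ b (Finset.mem_univ k), Finset.sdiff_singleton_eq_erase]
  ring

lemma exists_pushSide {b b' : Fin 6 → ℤ} (h : ∀ k, b k ≤ b' k)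
    (hs : ∑ k, b' k = ∑ k, b k + 1) : ∃ k, b' = pushSide b k := by
  obtain ⟨k, hk⟩ : ∃ k, b k < b' k := by
    by_contra! hle
    have := Finset.sum_le_sum fun k (_ : k ∈ Finset.univ) => hle k
    omega
  refine ⟨k, (eq_of_le_of_sum_le (fun k' => ?_) (by rw [hs, sum_pushSide])).symm⟩
  rcases eq_or_ne k' k with rfl | hne
  · simpa [pushSide] using hk
  · simpa [pushSide, hne] using h k'

lemma one_le_sideLength_of_pushSide {b : Fin 6 → ℤ} {k : Fin 6}
    (h : 0 ≤ sideLength (pushSide b k) k) : 1 ≤ sideLength b k := by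
  have hprev : k - 1 ≠ k := by simp
  have hnext : k + 1 ≠ k := by simp
  simp only [sideLength, pushSide, Function.update_self, Function.update_of_ne hprev,
    Function.update_of_ne hnext] at h ⊢
  omega

/-- Pushing a longer side would violate the isoperimetric inequality. -/
lemma isLongestSide_of_sq_lt {b : Fin 6 → ℤ} (hb : ∀ k, 0 ≤ sideLength b k) {k : Fin 6}
    (hk : 1 ≤ sideLength b k)
    (hlt : (∑ k, b k + 1) ^ 2 < 6 * ((hexagonFinset (pushSide b k)).card : ℤ) + 12) :
    IsLongestSide b k := by
  intro k'
  by_contra! hk'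
  have harea' := six_mul_card_hexagonFinset_le
    (sideLength_pushSide_nonneg hb (hk.trans hk'.le))
  rw [sum_pushSide, card_hexagonFinset_pushSide hb (hk.trans hk'.le)] at harea'
  rw [card_hexagonFinset_pushSide hb hk] at hlt
  omega

lemma hasCluster_lift {L : ℕ} [NeZero L] (a b : ZMod L) (S : Finset (Site (ZMod L))) :
    HasCluster (configOf S) ((S.image (lift a b) : Finset (Site ℤ)) : Set (Site ℤ)) := by
  constructor
  · rw [Finset.coe_image]
    rintro _ ⟨u, -, rfl⟩ _ ⟨v, -, rfl⟩ huv
    rw [toTorus_lift, toTorus_lift] at huv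
    rw [huv]
  · rw [← coe_plusFinset, plusFinset_configOf, ← Finset.coe_image, image_toTorus_image_lift]

lemma offCut_of_two_le_contacts {L : ℕ} {a b : ZMod L} {S : Finset (Site (ZMod L))}
    (hS : ∀ f ∈ S, OffCut a b f) {f : Site (ZMod L)} (hf : 2 ≤ contacts S f) : OffCut a b f := by
  obtain ⟨i, j, hij, hi, hj⟩ := exists_of_two_le_contacts hf
  constructor
  · rcases strip_neighbor_of_ne f hij 0 with e | e
    · exact e ▸ (hS _ hi).1
    · exact e ▸ (hS _ hj).1
  · rcases strip_neighbor_of_ne f hij 1 with e | e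
    · exact e ▸ (hS _ hi).2
    · exact e ▸ (hS _ hj).2

lemma one_le_contacts_of_two_le_insert {L : ℕ} (hL : 2 ≤ L) {S : Finset (Site (ZMod L))}
    {f x : Site (ZMod L)} (h : 2 ≤ contacts (insert x S) f) : 1 ≤ contacts S f := by
  obtain ⟨i, j, hij, hi, hj⟩ := exists_of_two_le_contacts h
  rcases Finset.mem_insert.1 hi with hi | hi
  · rcases Finset.mem_insert.1 hj with hj | hj
    · exact absurd (neighbor_injective hL f (hi.trans hj.symm)) hij
    · exact one_le_contacts j hj
  · exact one_le_contacts i hi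

end CriticalHexagon

namespace CriticalSizes

variable {L N p M : ℕ}

lemma one_le (hc : CriticalSizes L N p M) : 1 ≤ N := by
  nlinarith [hc.area_eq, hc.seven_le]

lemma odd_p (hc : CriticalSizes L N p M) : p % 2 = 1 := by
  have h := hc.area_eq
  rcases Nat.even_or_odd' p with ⟨q, rfl | rfl⟩
  · have : (2 * q) ^ 2 = 2 * (2 * q ^ 2) := by ring
    omega
  · omega

lemma two_le (hc : CriticalSizes L N p M) : 2 ≤ L := by
  have := hc.width
  have := hc.seven_le
  omega

section Plane

variable {A B P Q T : Finset (Site ℤ)}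

lemma nonempty_of_le_card (hc : CriticalSizes L N p M) (hP : N ≤ P.card) : P.Nonempty :=
  Finset.card_pos.1 (hc.one_le.trans hP)

lemma lt_sum_hullBounds (hc : CriticalSizes L N p M) (hP : N + 1 ≤ P.card) :
    (p : ℤ) + 1 ≤ ∑ k, hullBounds P k := by
  by_contra! h
  have hne := hc.nonempty_of_le_card (Nat.le_of_succ_le hP)
  have hcard := (Finset.card_le_card (subset_hexagonFinset_hullBounds P)).trans
    (card_hexagonFinset_le (sideLength_hullBounds_nonneg hne) hc.area_eq hc.seven_le (by omega))
  omega

lemma eq_hexagonFinset_of_sum_le (hc : CriticalSizes L N p M) (hP : N ≤ P.card)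
    (hs : ∑ k, hullBounds P k ≤ p) : P = hexagonFinset (hullBounds P) :=
  Finset.eq_of_subset_of_card_le (subset_hexagonFinset_hullBounds P) <|
    (card_hexagonFinset_le (sideLength_hullBounds_nonneg (hc.nonempty_of_le_card hP))
      hc.area_eq hc.seven_le hs).trans hP

lemma sum_hullBounds_le (hc : CriticalSizes L N p M) (hP : N + 1 ≤ P.card)
    (hp : perimeter P ≤ p + 2) : ∑ k, hullBounds P k ≤ perimeter P := by
  have harea := hc.area_eq
  have hseven := hc.seven_le
  refine sum_hullBounds_le_perimeter (hc.nonempty_of_le_card (Nat.le_of_succ_le hP)) ?_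
  zify at *
  nlinarith

lemma eq_hexagonFinset_of_core (hc : CriticalSizes L N p M) (hQ : IsCore N p Q) :
    Q = hexagonFinset (hullBounds Q) ∧ ∑ k, hullBounds Q k = p := by
  obtain ⟨hcard, hper⟩ := hQ
  have harea := hc.area_eq
  have hseven := hc.seven_le
  have hne := hc.nonempty_of_le_card hcard.ge
  have hle : ∑ k, hullBounds Q k ≤ p := by
    rw [← hper]
    refine sum_hullBounds_le_perimeter hne ?_
    zify at *
    nlinarith
  refine ⟨hc.eq_hexagonFinset_of_sum_le hcard.ge hle, hle.antisymm ?_⟩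
  have hiso := six_mul_card_le_sum_hullBounds hne
  have hsum := sum_nonneg_of_sideLength (sideLength_hullBounds_nonneg hne)
  by_contra! hlt
  rw [hcard] at hiso
  zify at *
  nlinarith

lemma eq_hexagonFinset_of_target (hc : CriticalSizes L N p M) (hT : IsTarget p M T) :
    T = hexagonFinset (hullBounds T) ∧ ∑ k, hullBounds T k = p + 1 := by
  obtain ⟨hcard, hper⟩ := hT
  have hle := hc.le
  have hlt := hc.lt_six_mul
  have hupper := hc.sum_hullBounds_le (P := T) (by omega) (by omega)
  have hlower := hc.lt_sum_hullBounds (P := T) (by omega)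
  have hsum : ∑ k, hullBounds T k = p + 1 := by omega
  refine ⟨Finset.eq_of_subset_of_card_le (subset_hexagonFinset_hullBounds T) ?_, hsum⟩
  have hiso := six_mul_card_hexagonFinset_le
    (sideLength_hullBounds_nonneg (hc.nonempty_of_le_card (P := T) (by omega)))
  rw [hsum] at hiso
  rw [hcard]
  zify at *
  omega

lemma exists_longest_side (hc : CriticalSizes L N p M) (hQT : Q ⊆ T) (hQ : IsCore N p Q)
    (hT : IsTarget p M T) :
    ∃ k, hullBounds T = pushSide (hullBounds Q) k ∧ IsLongestSide (hullBounds Q) k := by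
  have hQsum := (hc.eq_hexagonFinset_of_core hQ).2
  obtain ⟨hThex, hTsum⟩ := hc.eq_hexagonFinset_of_target hT
  have hQne := hc.nonempty_of_le_card hQ.1.ge
  obtain ⟨k, hk⟩ := exists_pushSide (hullBounds_mono hQne hQT) (by rw [hQsum, hTsum])
  have hlen := sideLength_hullBounds_nonneg (hQne.mono hQT) k
  rw [hk] at hlen
  refine ⟨k, hk, isLongestSide_of_sq_lt (sideLength_hullBounds_nonneg hQne)
    (one_le_sideLength_of_pushSide hlen) ?_⟩
  rw [hQsum, ← hk, ← hThex, hT.1]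
  have hlt := hc.lt_six_mul
  zify at hlt
  linarith

/-- The hexagons `Q` and `T` differ by the bar on a longest side of `Q`. -/
lemma isCanonicalShape_or_isDefectiveShape (hc : CriticalSizes L N p M) (hQ : IsCore N p Q)
    (hT : IsTarget p M T) {x g y : Site ℤ} (hx : x ∉ Q) (hg : g ∉ insert x Q)
    (hy : y ∉ insert g (insert x Q)) (hsub : insert y (insert g (insert x Q)) ⊆ T)
    (hcx : 1 ≤ contacts Q x) (hcg : 1 ≤ contacts (insert x Q) g)
    (hcy : 2 ≤ contacts (insert g (insert x Q)) y) :
    IsCanonicalShape (insert g (insert x Q) : Finset (Site ℤ)) ∨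
      IsDefectiveShape (insert g (insert x Q) : Finset (Site ℤ)) := by
  simp only [Finset.insert_subset_iff] at hsub
  obtain ⟨hyT, hgT, hxT, hQT⟩ := hsub
  obtain ⟨k, hk, hlong⟩ := hc.exists_longest_side hQT hQ hT
  obtain ⟨hQhex, hQsum⟩ := hc.eq_hexagonFinset_of_core hQ
  have hThex := (hc.eq_hexagonFinset_of_target hT).1
  have hne := hc.nonempty_of_le_card hQ.1.ge
  have hb := sideLength_hullBounds_nonneg hne
  have hcard := hQ.1
  rw [hk] at hThex
  generalize hullBounds Q = b at *
  subst Q T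
  simp only [Finset.mem_insert, not_or] at hg hy
  have hxbar := (sideBar_eq b k).2 ⟨hxT, hx⟩
  have hgbar := (sideBar_eq b k).2 ⟨hgT, hg.2⟩
  have hybar := (sideBar_eq b k).2 ⟨hyT, hy.2.2⟩
  have hquasi := isQuasiRegular_of_card hb hc.area_eq hc.seven_le hQsum hcard
  have hshape : ((insert g (insert x (hexagonFinset b)) : Finset (Site ℤ)) : Set (Site ℤ)) =
      hexagon b ∪ {x, g} := by
    rw [Finset.coe_insert, Finset.coe_insert, coe_hexagonFinset, Set.insert_comm,
      Set.union_comm, Set.insert_union, Set.singleton_union]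
  rcases rhombus_or_dist_two hb hne hxbar hgbar hybar (Ne.symm hg.1) hcx hcg hcy with
    hadj | ⟨hxatt, hgatt, hdist⟩
  · exact Or.inl ⟨b, k, x, g, hquasi, hlong, hxbar, hgbar, hadj, hshape⟩
  · exact Or.inr ⟨b, k, x, g, hquasi, hlong, hxbar, hgbar, hxatt, hgatt, hdist, hshape⟩

lemma subset_target_of_sum_le (hc : CriticalSizes L N p M) (hT : IsTarget p M T) (hAT : A ⊆ T)
    (hne : A.Nonempty) (hA : (p : ℤ) + 1 ≤ ∑ k, hullBounds A k) (hAB : A ⊆ B)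
    (hB : ∑ k, hullBounds B k ≤ p + 1) : B ⊆ T := by
  obtain ⟨hhex, hsum⟩ := hc.eq_hexagonFinset_of_target hT
  have hAeqT := eq_of_le_of_sum_le (hullBounds_mono hne hAT) (hsum.trans_le hA)
  have hAeqB := eq_of_le_of_sum_le (hullBounds_mono hne hAB) (hB.trans hA)
  rw [hhex, ← hAeqT, hAeqB]
  exact subset_hexagonFinset_hullBounds B

lemma subset_target_of_perimeter_le (hc : CriticalSizes L N p M) (hT : IsTarget p M T)
    (hAT : A ⊆ T) (hA : N + 1 ≤ A.card) (hAB : A ⊆ B) (hB : perimeter B ≤ p + 1) : B ⊆ T := by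
  refine hc.subset_target_of_sum_le hT hAT (hc.nonempty_of_le_card (Nat.le_of_succ_le hA))
    (hc.lt_sum_hullBounds hA) hAB ?_
  have := hc.sum_hullBounds_le (hA.trans (Finset.card_le_card hAB)) (by omega)
  omega

lemma contacts_le_one_of_sum_le (hc : CriticalSizes L N p M) (hP : N ≤ P.card)
    (hs : ∑ k, hullBounds P k ≤ p) {f : Site ℤ} (hf : f ∉ P) : contacts P f ≤ 1 := by
  rw [hc.eq_hexagonFinset_of_sum_le hP hs] at hf ⊢
  exact contacts_hexagonFinset_le hf

lemma sum_hullBounds_erase_le (hc : CriticalSizes L N p M) (hT : IsTarget p M T) {u w : Site ℤ}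
    (hAT : A ⊆ T) (hA : N + 1 ≤ A.card) (hw : w ∉ T) (hu : u ∈ A)
    (hp : perimeter (insert w (A.erase u)) ≤ p + 1) : ∑ k, hullBounds (A.erase u) k ≤ p := by
  by_contra! h
  have hRT : A.erase u ⊆ T := (Finset.erase_subset _ _).trans hAT
  have hcard := Finset.card_erase_add_one hu
  have hsum := hc.sum_hullBounds_le (P := insert w (A.erase u))
    (by rw [Finset.card_insert_of_notMem fun h => hw (hRT h)]; omega) (by omega)
  exact hw (hc.subset_target_of_sum_le hT hRT (hc.nonempty_of_le_card (by omega)) h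
    (Finset.subset_insert w _) (by omega) (Finset.mem_insert_self w _))

end Plane

section Torus

variable {A B S T Q : Finset (Site (ZMod L))}

lemma perimeter_le_of_even (hc : CriticalSizes L N p M) (h : Admissible N p M S) (hS : S.card ≤ M)
    (he : S.card % 2 = 0) : perimeter S ≤ p + 1 := by
  have hle := (h hS).1
  have hparity := perimeter_mod_two S
  have hodd := hc.odd_p
  omega

lemma small (hc : CriticalSizes L N p M) (hS : S.card ≤ M) (hp : perimeter S ≤ p + 2) :
    S.card + L * perimeter S < 2 * L ^ 2 := by
  have := hc.cut
  have := Nat.mul_le_mul_left L hp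
  omega

variable [NeZero L]

lemma six_mul_card_le (hc : CriticalSizes L N p M) (hS : S.card ≤ M) (hp : perimeter S ≤ p + 2) :
    6 * S.card ≤ perimeter S ^ 2 :=
  six_mul_card_le_perimeter_sq_of_small (hc.small hS hp)

lemma le_perimeter (hc : CriticalSizes L N p M) (hS : S.card ≤ M) (hN : N ≤ S.card) :
    p ≤ perimeter S := by
  by_contra! h
  nlinarith [hc.six_mul_card_le hS (by omega), hc.area_eq, hc.seven_le]

lemma add_one_le_perimeter (hc : CriticalSizes L N p M) (hS : S.card ≤ M)
    (hN : N + 1 ≤ S.card) : p + 1 ≤ perimeter S := by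
  refine Nat.lt_of_le_of_ne (hc.le_perimeter hS (by omega)) fun hp => ?_
  have hiso := hc.six_mul_card_le hS (by omega)
  have hparity := perimeter_mod_two S
  have := hc.area_eq
  have := hc.odd_p
  have := hc.odd
  rw [← hp] at hiso hparity
  omega

lemma add_two_le_perimeter (hc : CriticalSizes L N p M) (hS : S.card = N + 2) :
    p + 2 ≤ perimeter S := by
  have := hc.le
  have := hc.add_one_le_perimeter (S := S) (by omega) (by omega)
  have := perimeter_mod_two S
  have := hc.odd_p
  have := hc.odd
  omega

lemma isCore_of_card (hc : CriticalSizes L N p M) (h : Admissible N p M S) (hS : S.card = N) :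
    IsCore N p S := by
  have := hc.le
  have hupper := h (by omega)
  have hlower := hc.le_perimeter (S := S) (by omega) (by omega)
  have := perimeter_mod_two S
  have := hc.odd_p
  have := hc.odd
  exact ⟨hS, by omega⟩

lemma exists_offCut_insert (hc : CriticalSizes L N p M) (hT : IsTarget p M T)
    (w : Site (ZMod L)) : ∃ a b, ∀ g ∈ insert w T, OffCut a b g := by
  have hwidth := hc.width
  have hstrips : ∀ k, ((insert w T).image (strip k)).card < L := fun k => by
    have hTstrip := two_mul_card_image_strip_le (hc.small hT.1.le (by rw [hT.2]; omega)) k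
    have hins := Finset.card_insert_le (strip k w) (T.image (strip k))
    rw [hT.2] at hTstrip
    rw [Finset.image_insert]
    omega
  obtain ⟨a, ha⟩ := exists_notMem_image_of_card_lt (hstrips 0)
  obtain ⟨b, hb⟩ := exists_notMem_image_of_card_lt (hstrips 1)
  exact ⟨a, b, fun g hg => ⟨ha g hg, hb g hg⟩⟩

lemma le_perimeter_add_one (hc : CriticalSizes L N p M) (hS : S.card + 1 = N) :
    p ≤ perimeter S + 1 := by
  have hle := hc.le
  by_contra! h
  nlinarith [hc.six_mul_card_le (S := S) (by omega) (by omega), hc.area_eq, hc.seven_le]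

lemma isCore_insert_erase (hc : CriticalSizes L N p M) (hQ : IsCore N p Q) {y u : Site (ZMod L)}
    (hy : y ∈ Q) (hQy : perimeter (Q.erase y) + 1 ≤ p) (hu : u ∉ Q.erase y)
    (hcu : 1 ≤ contacts (Q.erase y) u) : IsCore N p (insert u (Q.erase y)) := by
  have hle := hc.le
  have hcard : (insert u (Q.erase y)).card = N := by
    rw [Finset.card_insert_of_notMem hu, Finset.card_erase_add_one hy, hQ.1]
  have hlower := hc.le_perimeter (S := insert u (Q.erase y)) (by omega) (by omega)
  have hupper := perimeter_insert_le_of_one hu hcu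
  exact ⟨hcard, by omega⟩

/-- The critical hexagon changes by a sliding face: one of the two added faces replaces `y`. -/
lemma isCorePlus_of_slide (hc : CriticalSizes L N p M) (hQ : IsCore N p Q) {x g y : Site (ZMod L)}
    (hx : x ∉ Q) (hg : g ∉ insert x Q) (hy : y ∈ Q)
    (hadm : Admissible N p M ((insert g (insert x Q)).erase y)) :
    IsCorePlus N p ((insert g (insert x Q)).erase y) := by
  have hle := hc.le
  have hcard : (insert g (insert x Q)).card = N + 2 := by
    rw [Finset.card_insert_of_notMem hg, Finset.card_insert_of_notMem hx, hQ.1]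
  have hmem : y ∈ insert g (insert x Q) := by simp [hy]
  have hcard_erase : ((insert g (insert x Q)).erase y).card = N + 1 := by
    rw [Finset.card_erase_of_mem hmem, hcard]
    rfl
  have hxy : x ≠ y := fun e => hx (e ▸ hy)
  have hgxQ : g ≠ x ∧ g ∉ Q := by simpa [not_or] using hg
  have hgy : g ≠ y := fun e => hgxQ.2 (e ▸ hy)
  have hswap : (insert g (insert x Q)).erase y = insert g (insert x (Q.erase y)) := by
    rw [Finset.erase_insert_of_ne hgy, Finset.erase_insert_of_ne hxy]
  have hsub : Q.erase y ⊆ (insert g (insert x Q)).erase y := by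
    rw [hswap]
    exact (Finset.subset_insert _ _).trans (Finset.subset_insert _ _)
  have hupper := (hadm (by omega)).2 (by omega)
  have hQy : perimeter (Q.erase y) + 1 ≤ p := by
    have := hc.add_two_le_perimeter hcard
    have := perimeter_erase hmem
    have := perimeter_erase hy
    have := contacts_mono hsub y
    have := hQ.2
    omega
  have hxE : x ∉ Q.erase y := fun h => hx (Finset.mem_of_mem_erase h)
  have hgE : g ∉ Q.erase y := fun h => hgxQ.2 (Finset.mem_of_mem_erase h)
  have hgxE : g ∉ insert x (Q.erase y) := by simp [hgxQ]
  rw [hswap] at hupper ⊢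
  by_cases hcx : 1 ≤ contacts (Q.erase y) x
  · exact ⟨_, g, hc.isCore_insert_erase hQ hy hQy hxE hcx, hgxE, rfl⟩
  · have hcg : 2 ≤ contacts (insert x (Q.erase y)) g := by
      have := perimeter_insert hxE
      have := perimeter_insert hgxE
      have := hc.le_perimeter_add_one (S := Q.erase y)
        ((Finset.card_erase_add_one hy).trans hQ.1)
      omega
    exact ⟨_, x, hc.isCore_insert_erase hQ hy hQy hgE
      (one_le_contacts_of_two_le_insert hc.two_le hcg), by simp [hgxQ.1.symm, hxE],
      Finset.insert_comm _ _ _⟩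

lemma contacts_of_step (hc : CriticalSizes L N p M) (hQ : IsCore N p Q) {x g y : Site (ZMod L)}
    (hx : x ∉ Q) (hg : g ∉ insert x Q) (hy : y ∉ insert g (insert x Q))
    (hadm₁ : Admissible N p M (insert x Q)) (hadm₂ : Admissible N p M (insert g (insert x Q)))
    (hadm₃ : Admissible N p M (insert y (insert g (insert x Q)))) :
    1 ≤ contacts Q x ∧ 1 ≤ contacts (insert x Q) g ∧
      2 ≤ contacts (insert g (insert x Q)) y := by
  have hle := hc.le
  have hodd := hc.odd
  obtain ⟨hcard, hper⟩ := hQ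
  have hcard₁ := Finset.card_insert_of_notMem hx
  have hcard₂ := Finset.card_insert_of_notMem hg
  have hcard₃ := Finset.card_insert_of_notMem hy
  have hupper₁ := (hadm₁ (by omega)).2 (by omega)
  have hlower₁ := hc.add_one_le_perimeter (S := insert x Q) (by omega) (by omega)
  have hupper₂ := (hadm₂ (by omega)).1
  have hlower₂ := hc.add_two_le_perimeter (S := insert g (insert x Q)) (by omega)
  have hupper₃ := hc.perimeter_le_of_even hadm₃ (by omega) (by omega)
  have hper₁ := perimeter_insert hx
  have hper₂ := perimeter_insert hg
  have hper₃ := perimeter_insert hy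
  exact ⟨by omega, by omega, by omega⟩

lemma mem_gateConfigs_of_step (hc : CriticalSizes L N p M) (hQ : IsCore N p Q)
    {x g y : Site (ZMod L)} (hx : x ∉ Q) (hg : g ∉ insert x Q) (hy : y ∉ insert g (insert x Q))
    (hadm₁ : Admissible N p M (insert x Q)) (hadm₂ : Admissible N p M (insert g (insert x Q)))
    (hadm₃ : Admissible N p M (insert y (insert g (insert x Q)))) (hT : IsTarget p M T)
    (hsub : insert y (insert g (insert x Q)) ⊆ T) :
    configOf (insert g (insert x Q)) ∈ gateConfigs L (N + 2) := by
  obtain ⟨hcx, hcg, hcy⟩ := hc.contacts_of_step hQ hx hg hy hadm₁ hadm₂ hadm₃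
  obtain ⟨a, b, hoff⟩ := hc.exists_offCut_insert hT y
  replace hoff : ∀ f ∈ T, OffCut a b f := fun f hf => hoff f (Finset.mem_insert_of_mem hf)
  have hmem : y ∈ T ∧ g ∈ T ∧ x ∈ T ∧ Q ⊆ T := by simpa only [Finset.insert_subset_iff] using hsub
  obtain ⟨hyT, hgT, hxT, hQT⟩ := hmem
  have hxQT : insert x Q ⊆ T := Finset.insert_subset hxT hQT
  have hgxQT : insert g (insert x Q) ⊆ T := Finset.insert_subset hgT hxQT
  have hinj := lift_injective a b
  have hshape := hc.isCanonicalShape_or_isDefectiveShape (x := lift a b x) (g := lift a b g)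
    (y := lift a b y) (hQ.image_lift fun f hf => hoff f (hQT hf)) (hT.image_lift hoff)
    (by rwa [hinj.mem_finset_image])
    (by rwa [← Finset.image_insert, hinj.mem_finset_image])
    (by rwa [← Finset.image_insert, ← Finset.image_insert, hinj.mem_finset_image])
    (by simpa only [← Finset.image_insert] using Finset.image_subset_image hsub)
    (by rwa [contacts_image_lift (hoff x hxT) fun f hf => hoff f (hQT hf)])
    (by rwa [← Finset.image_insert,
      contacts_image_lift (hoff g hgT) fun f hf => hoff f (hxQT hf)])
    (by rwa [← Finset.image_insert, ← Finset.image_insert,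
      contacts_image_lift (hoff y hyT) fun f hf => hoff f (hgxQT hf)])
  simp only [← Finset.image_insert] at hshape
  have hcluster := hasCluster_lift a b (insert g (insert x Q))
  have hncard : ((((insert g (insert x Q)).image (lift a b) : Finset (Site ℤ)) :
      Set (Site ℤ))).ncard = N + 2 := by
    rw [Set.ncard_coe_finset, card_image_lift, Finset.card_insert_of_notMem hg,
      Finset.card_insert_of_notMem hx, hQ.1]
  exact hshape.imp (fun h => ⟨_, h, hncard, hcluster⟩) fun h => ⟨_, h, hncard, hcluster⟩

lemma subset_target_of_offCut (hc : CriticalSizes L N p M) (hT : IsTarget p M T) {a b : ZMod L}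
    (hoffT : ∀ f ∈ T, OffCut a b f) (hAT : A ⊆ T) (hA : N + 1 ≤ A.card) (hAB : A ⊆ B)
    (hoffB : ∀ f ∈ B, OffCut a b f) (hB : perimeter B ≤ p + 1) : B ⊆ T := by
  have hsub := hc.subset_target_of_perimeter_le (hT.image_lift hoffT)
    (Finset.image_subset_image hAT) (by rwa [card_image_lift]) (Finset.image_subset_image hAB)
    (by rwa [perimeter_image_lift hoffB])
  rwa [Finset.image_subset_image_iff (lift_injective a b)] at hsub

lemma insert_subset_target (hc : CriticalSizes L N p M) (hT : IsTarget p M T)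
    {w : Site (ZMod L)} (hAT : A ⊆ T) (hA : N + 1 ≤ A.card)
    (hp : perimeter (insert w A) ≤ p + 1) : insert w A ⊆ T := by
  obtain ⟨a, b, hoff⟩ := hc.exists_offCut_insert hT w
  exact hc.subset_target_of_offCut hT (fun f hf => hoff f (Finset.mem_insert_of_mem hf)) hAT hA
    (Finset.subset_insert w A) (fun f hf => hoff f (Finset.insert_subset_insert w hAT hf)) hp

lemma mem_target_of_insert_insert (hc : CriticalSizes L N p M) (hT : IsTarget p M T)
    {u w : Site (ZMod L)} (hAT : A ⊆ T) (hA : N + 1 ≤ A.card) (hw : w ∉ insert u A)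
    (hp : perimeter (insert w (insert u A)) ≤ p + 1) : u ∈ T := by
  by_contra hu
  obtain ⟨a, b, hoff⟩ := hc.exists_offCut_insert hT u
  have hoffu : ∀ f ∈ insert u A, OffCut a b f := fun f hf =>
    hoff f (Finset.insert_subset_insert u hAT hf)
  have hpu : p + 2 ≤ perimeter (insert u A) := by
    by_contra! hlt
    exact hu (hc.insert_subset_target hT hAT hA (by omega) (Finset.mem_insert_self u A))
  have hcw : 2 ≤ contacts (insert u A) w := by
    have := perimeter_insert hw
    omega
  have hoffw : ∀ f ∈ insert w (insert u A), OffCut a b f :=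
    Finset.forall_mem_insert _ _ _ |>.2 ⟨offCut_of_two_le_contacts hoffu hcw, hoffu⟩
  exact hu (hc.subset_target_of_offCut hT (fun f hf => hoff f (Finset.mem_insert_of_mem hf)) hAT
    hA ((Finset.subset_insert u A).trans (Finset.subset_insert w _)) hoffw hp (by simp))

lemma isCorePlus_of_exchange (hc : CriticalSizes L N p M) (hT : IsTarget p M T)
    {u w : Site (ZMod L)} (hAT : A ⊆ T) (hA : N + 1 ≤ A.card) (hw : w ∉ T) (hu : u ∈ A)
    (hp : perimeter (insert w (A.erase u)) ≤ p + 1) : IsCorePlus N p (insert w (A.erase u)) := by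
  obtain ⟨a, b, hoff⟩ := hc.exists_offCut_insert hT w
  have hoffT : ∀ f ∈ T, OffCut a b f := fun f hf => hoff f (Finset.mem_insert_of_mem hf)
  have hRT : A.erase u ⊆ T := (Finset.erase_subset _ _).trans hAT
  have hoffR : ∀ f ∈ A.erase u, OffCut a b f := fun f hf => hoffT f (hRT hf)
  have hwR : w ∉ A.erase u := fun h => hw (hRT h)
  have hinj := lift_injective a b
  have himage : (A.image (lift a b)).erase (lift a b u) = (A.erase u).image (lift a b) :=
    (Finset.image_erase hinj A u).symm
  have hRcard := Finset.card_erase_add_one hu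
  have hsum := hc.sum_hullBounds_erase_le (hT.image_lift hoffT) (u := lift a b u)
    (w := lift a b w) (Finset.image_subset_image hAT) (by rwa [card_image_lift])
    (by rwa [hinj.mem_finset_image]) (Finset.mem_image_of_mem _ hu)
    (by rwa [himage, ← Finset.image_insert,
      perimeter_image_lift fun f hf => hoff f (Finset.insert_subset_insert w hRT hf)])
  rw [himage] at hsum
  have hcw := hc.contacts_le_one_of_sum_le (by rw [card_image_lift]; omega) hsum
    (by rwa [hinj.mem_finset_image] : lift a b w ∉ _)
  rw [contacts_image_lift (hoff w (Finset.mem_insert_self w T)) hoffR] at hcw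
  have hRN : (A.erase u).card = N := by
    by_contra hne
    have := hc.lt_sum_hullBounds (P := (A.erase u).image (lift a b))
      (by rw [card_image_lift]; omega)
    omega
  have hins := perimeter_insert hwR
  have hlower := hc.le_perimeter (S := A.erase u) (by have := hc.le; omega) hRN.ge
  have hparity := perimeter_mod_two (A.erase u)
  have hodd := hc.odd
  have hodd_p := hc.odd_p
  exact ⟨_, w, ⟨hRN, by omega⟩, hwR, rfl⟩

end Torus

end CriticalSizes

section Crossing

/-- Two sets differ by one face. -/
def DifferByOne {L : ℕ} (A B : Finset (Site (ZMod L))) : Prop :=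
  (∃ x, x ∉ A ∧ B = insert x A) ∨ ∃ x, x ∉ B ∧ A = insert x B

lemma DifferByOne.card {L : ℕ} {A B : Finset (Site (ZMod L))} (h : DifferByOne A B) :
    B.card = A.card + 1 ∨ A.card = B.card + 1 := by
  rcases h with ⟨x, hx, rfl⟩ | ⟨x, hx, rfl⟩
  · exact Or.inl (Finset.card_insert_of_notMem hx)
  · exact Or.inr (Finset.card_insert_of_notMem hx)

lemma plusFinset_flip {L : ℕ} [NeZero L] {σ : Config L} {x : Site (ZMod L)}
    (hx : x ∉ plusFinset σ) : plusFinset (flip σ x) = insert x (plusFinset σ) := by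
  rw [mem_plusFinset] at hx
  ext y
  rw [Finset.mem_insert, mem_plusFinset, mem_plusFinset, flip]
  by_cases hyx : y = x
  · simp [hyx, Int.units_ne_iff_eq_neg.1 hx]
  · simp [hyx]

lemma differByOne_of_adj {L : ℕ} [NeZero L] {σ η : Config L} (h : (flipGraph L).Adj σ η) :
    DifferByOne (plusFinset σ) (plusFinset η) := by
  obtain ⟨x, rfl⟩ := h
  by_cases hx : x ∈ plusFinset σ
  · have hx' : x ∉ plusFinset (flip σ x) := by
      rw [mem_plusFinset] at hx ⊢
      rw [flip, Function.update_self, hx]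
      decide
    exact Or.inr ⟨x, hx', by rw [← plusFinset_flip hx', flip_flip]⟩
  · exact Or.inl ⟨x, hx, plusFinset_flip hx⟩

lemma IsCore.isCorePlus_of_differByOne {L N p : ℕ} {B C : Finset (Site (ZMod L))}
    (hB : IsCore N p B) (hC : C.card = N + 1) (hBC : DifferByOne B C) : IsCorePlus N p C := by
  rcases hBC with ⟨x, hx, rfl⟩ | ⟨x, hx, rfl⟩
  · exact ⟨B, x, hB, hx, rfl⟩
  · have := Finset.card_insert_of_notMem hx
    have := hB.1
    omega

end Crossing

namespace CriticalSizes

variable {L N p M : ℕ} [NeZero L] {A B C T : Finset (Site (ZMod L))}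

lemma exists_target_of_not_subcritical (hc : CriticalSizes L N p M) (hCM : C.card ≤ M)
    (hp : perimeter C ≤ p + 1) (hC : ¬ Subcritical N p M C) :
    N + 1 ≤ C.card ∧ (∃ T, IsTarget p M T ∧ C ⊆ T) ∧ (C.card < M → ¬ IsCorePlus N p C) := by
  have hle := hc.le
  rcases hCM.lt_or_eq with hlt | heq
  · simp only [Subcritical, hlt, true_and, not_or, not_forall, not_not] at hC
    obtain ⟨hN, hplus, T, hT, hCT⟩ := hC
    exact ⟨by omega, ⟨T, hT, hCT⟩, fun _ => hplus⟩
  · have hlower := hc.add_one_le_perimeter (S := C) hCM (by omega)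
    exact ⟨by omega, ⟨C, ⟨heq, by omega⟩, subset_rfl⟩, fun hlt => absurd heq hlt.ne⟩

lemma isCorePlus_erase (hc : CriticalSizes L N p M) {Q : Finset (Site (ZMod L))}
    (hQ : IsCore N p Q) {x g y : Site (ZMod L)} (hx : x ∉ Q) (hg : g ∉ insert x Q)
    (hy : y ∈ insert g (insert x Q)) (hadm : Admissible N p M ((insert g (insert x Q)).erase y)) :
    IsCorePlus N p ((insert g (insert x Q)).erase y) := by
  have hg' : g ≠ x ∧ g ∉ Q := by simpa [not_or] using hg
  rcases Finset.mem_insert.1 hy with rfl | hy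
  · rw [Finset.erase_insert hg]
    exact ⟨Q, x, hQ, hx, rfl⟩
  rcases Finset.mem_insert.1 hy with rfl | hy
  · rw [Finset.insert_comm, Finset.erase_insert (by simp [hg'.1.symm, hx])]
    exact ⟨Q, g, hQ, hg'.2, rfl⟩
  · exact hc.isCorePlus_of_slide hQ hx hg hy hadm

lemma subset_target_of_insert_eq_insert (hc : CriticalSizes L N p M) (hT : IsTarget p M T)
    (hCT : C ⊆ T) (hC : N + 1 ≤ C.card) {u w : Site (ZMod L)} (hu : u ∉ A) (hw : w ∉ C)
    (huw : insert u A = insert w C) (hp : perimeter A ≤ p + 1) (hA : ¬ IsCorePlus N p A) :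
    A ⊆ T := by
  by_cases hwT : w ∈ T
  · exact (Finset.subset_insert u A).trans (huw ▸ Finset.insert_subset hwT hCT)
  obtain rfl | hne := eq_or_ne u w
  · rwa [← Finset.erase_insert hu, huw, Finset.erase_insert hw]
  · have huC : u ∈ C :=
      (Finset.mem_insert.1 (huw ▸ Finset.mem_insert_self u A)).resolve_left hne
    have hAC : A = insert w (C.erase u) := by
      rw [← Finset.erase_insert_of_ne hne.symm, ← huw, Finset.erase_insert hu]
    rw [hAC] at hp hA
    exact absurd (hc.isCorePlus_of_exchange hT hCT hC hwT huC hp) hA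

lemma subset_target_of_differByOne (hc : CriticalSizes L N p M) (hT : IsTarget p M T)
    (hCT : C ⊆ T) (hC : N + 1 ≤ C.card) (hB : N + 1 ≤ B.card) (hAB : DifferByOne A B)
    (hBC : DifferByOne B C) (hp : perimeter A ≤ p + 1) (hA : ¬ IsCorePlus N p A) : A ⊆ T := by
  rcases hAB with ⟨u, hu, rfl⟩ | ⟨w, hw, rfl⟩
  · rcases hBC with ⟨y, -, rfl⟩ | ⟨w, hw, huw⟩
    · exact ((Finset.subset_insert _ _).trans (Finset.subset_insert _ _)).trans hCT
    · exact hc.subset_target_of_insert_eq_insert hT hCT hC hu hw huw hp hA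
  · rcases hBC with ⟨y, -, rfl⟩ | ⟨u, -, rfl⟩
    · exact hc.insert_subset_target hT ((Finset.subset_insert _ _).trans hCT) hB hp
    · have huT := hc.mem_target_of_insert_insert hT hCT hC hw hp
      exact hc.insert_subset_target hT (Finset.insert_subset huT hCT)
        (hC.trans (Finset.card_le_card (Finset.subset_insert u C))) hp

lemma mem_gateConfigs_of_differByOne (hc : CriticalSizes L N p M) (hA : Admissible N p M A)
    (hB : Admissible N p M B) (hC : Admissible N p M C) (hAB : DifferByOne A B)
    (hBC : DifferByOne B C) (hparity : A.card % 2 = 0) (hsub : Subcritical N p M A)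
    (hnot : ¬ Subcritical N p M C) : configOf B ∈ gateConfigs L (N + 2) := by
  have hle := hc.le
  have hodd := hc.odd
  have heven := hc.even
  have hAM := hsub.1
  have hcardAB := hAB.card
  have hcardBC := hBC.card
  have hpA := hc.perimeter_le_of_even hA hAM.le hparity
  have hpC := hc.perimeter_le_of_even hC (by omega) (by omega)
  obtain ⟨hCN, ⟨T, hT, hCT⟩, hCplus⟩ := hc.exists_target_of_not_subcritical (by omega) hpC hnot
  have hBN : N + 1 ≤ B.card := by
    by_contra! hlt
    exact hCplus (by omega)
      ((hc.isCore_of_card hB (by omega)).isCorePlus_of_differByOne (by omega) hBC)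
  by_cases hplus : IsCorePlus N p A
  · obtain ⟨Q, x, hQ, hx, rfl⟩ := hplus
    have hcardA : (insert x Q).card = N + 1 := by rw [Finset.card_insert_of_notMem hx, hQ.1]
    rcases hAB with ⟨g, hg, rfl⟩ | ⟨g, hg, hgB⟩
    · rcases hBC with ⟨y, hy, rfl⟩ | ⟨y, hy, hyC⟩
      · exact hc.mem_gateConfigs_of_step hQ hx hg hy hA hB hC hT hCT
      · have hCB : C = (insert g (insert x Q)).erase y := by rw [hyC, Finset.erase_insert hy]
        have hyB : y ∈ insert g (insert x Q) := hyC ▸ Finset.mem_insert_self y C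
        have hcardB := Finset.card_insert_of_notMem hg
        have hcardC : (insert g (insert x Q)).card = C.card + 1 := by
          rw [hyC, Finset.card_insert_of_notMem hy]
        have hcore : IsCorePlus N p C := hCB ▸ hc.isCorePlus_erase hQ hx hg hyB (hCB ▸ hC)
        exact absurd hcore (hCplus (by omega))
    · rw [hgB, Finset.card_insert_of_notMem hg] at hcardA
      omega
  · have hAT := hc.subset_target_of_differByOne hT hCT hCN hBN hAB hBC hpA hplus
    exact ((hsub.2.resolve_left (by omega)).resolve_left hplus T hT hAT).elim

/-- Only every other configuration of the path is examined: those of even area. -/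
lemma exists_mem_gateConfigs (hc : CriticalSizes L N p M) : ∀ (n : ℕ) {σ η : Config L}
    (ω : Path σ η), ω.length ≤ n →
    (∀ ζ ∈ ω.support, Admissible N p M (plusFinset ζ)) → (plusFinset σ).card % 2 = 0 →
    (plusFinset η).card % 2 = 0 → Subcritical N p M (plusFinset σ) →
    ¬ Subcritical N p M (plusFinset η) → ∃ ζ ∈ ω.support, ζ ∈ gateConfigs L (N + 2) := by
  intro n
  induction n with
  | zero =>
    intro σ η ω hn _ _ _ hσ hη
    obtain rfl := SimpleGraph.Walk.eq_of_length_eq_zero (Nat.le_zero.1 hn)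
    exact absurd hσ hη
  | succ n ih =>
    intro σ η ω hn hadm hparσ hparη hσ hη
    match ω, hn, hadm with
    | .nil, _, _ => exact absurd hσ hη
    | .cons hση .nil, _, _ =>
      have := (differByOne_of_adj hση).card
      omega
    | .cons (v := τ) hστ (.cons (v := υ) hτυ ω), hn, hadm =>
      by_cases hυ : Subcritical N p M (plusFinset υ)
      · have hcard₁ := (differByOne_of_adj hστ).card
        have hcard₂ := (differByOne_of_adj hτυ).card
        simp only [SimpleGraph.Walk.length_cons] at hn
        obtain ⟨ζ, hζ, hgate⟩ :=
          ih ω (by omega) (fun ζ hζ => hadm ζ (by simp [hζ])) (by omega) hparη hυ hη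
        exact ⟨ζ, by simp [hζ], hgate⟩
      · have hgate := hc.mem_gateConfigs_of_differByOne (hadm σ (by simp)) (hadm τ (by simp))
          (hadm υ (by simp)) (differByOne_of_adj hστ) (differByOne_of_adj hτυ) hparσ hσ hυ
        rw [configOf_plusFinset] at hgate
        exact ⟨τ, by simp, hgate⟩

end CriticalSizes

lemma admissible_of_energy_le {L N p M : ℕ} {J h : ℝ} (hh : 0 < h) (hJ : 0 < J)
    (hM : M * h < J + (N + 2) * h) {S : Finset (Site (ZMod L))}
    (hS : energy J h S ≤ J * (p + 2) - h * (N + 2)) : Admissible N p M S := by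
  intro hSM
  rw [energy] at hS
  constructor
  · have hcard : (S.card : ℝ) * h ≤ M * h := by gcongr
    have hper : J * perimeter S < J * (p + 3 : ℕ) := by
      push_cast
      nlinarith
    exact Nat.le_of_lt_succ (by exact_mod_cast lt_of_mul_lt_mul_left hper hJ.le)
  · intro hlt
    have hcard : (S.card : ℝ) * h < (N + 2 : ℕ) * h := by gcongr
    have hper : J * perimeter S < J * (p + 2 : ℕ) := by
      push_cast at hcard ⊢
      nlinarith
    exact Nat.le_of_lt_succ (by exact_mod_cast lt_of_mul_lt_mul_left hper hJ.le)

section Descent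

variable {L : ℕ} {J h Γ : ℝ} {A B C : Finset (Site (ZMod L))} {x : Site (ZMod L)}

lemma energy_le_of_perimeter_le (hh : 0 ≤ h) (hJ : 0 ≤ J) (hAB : A ⊆ B)
    (hp : perimeter B ≤ perimeter A) : energy J h B ≤ energy J h A := by
  have hcard : h * A.card ≤ h * B.card := by
    gcongr
  have hper : J * perimeter B ≤ J * perimeter A := by
    gcongr
  rw [energy, energy]
  linarith

lemma energy_insert_le (hJ : 0 ≤ J) (hx : x ∉ A) (hcontact : 1 ≤ contacts A x) :
    energy J h (insert x A) ≤ energy J h A + J - h := by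
  have hper : J * perimeter (insert x A) ≤ J * (perimeter A + 1) := by
    gcongr
    exact_mod_cast perimeter_insert_le_of_one hx hcontact
  rw [energy, energy, Finset.card_insert_of_notMem hx]
  push_cast
  linarith

lemma configOf_insert (hx : x ∉ A) : configOf (insert x A) = flip (configOf A) x := by
  funext y
  by_cases hyx : y = x
  · subst hyx
    simp [configOf, flip, hx]
  · simp [configOf, flip, hyx]

lemma adj_configOf_insert (hx : x ∉ A) :
    (flipGraph L).Adj (configOf A) (configOf (insert x A)) := ⟨x, configOf_insert hx⟩

variable [NeZero L]

/-- There is a path from `A` to `B` along which the energy is less than `Γ`. -/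
def JoinedBelow (J h Γ : ℝ) (A B : Finset (Site (ZMod L))) : Prop :=
  ∃ ω : Path (configOf A) (configOf B), ∀ ζ ∈ ω.support, energy J h (plusFinset ζ) < Γ

lemma JoinedBelow.refl (hA : energy J h A < Γ) : JoinedBelow J h Γ A A :=
  ⟨.nil, by simpa using hA⟩

lemma JoinedBelow.trans (hAB : JoinedBelow J h Γ A B) (hBC : JoinedBelow J h Γ B C) :
    JoinedBelow J h Γ A C := by
  obtain ⟨ω, hω⟩ := hAB
  obtain ⟨ω', hω'⟩ := hBC
  refine ⟨ω.append ω', fun ζ hζ => ?_⟩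
  exact ((SimpleGraph.Walk.mem_support_append_iff _ _).1 hζ).elim (hω ζ) (hω' ζ)

lemma JoinedBelow.insert (hA : energy J h A < Γ) (hx : energy J h (insert x A) < Γ) :
    JoinedBelow J h Γ A (insert x A) := by
  by_cases hxA : x ∈ A
  · rw [Finset.insert_eq_of_mem hxA]
    exact .refl hA
  · refine ⟨.cons (adj_configOf_insert hxA) .nil, fun ζ hζ => ?_⟩
    simp only [SimpleGraph.Walk.support_cons, SimpleGraph.Walk.support_nil, List.mem_cons,
      List.not_mem_nil, or_false] at hζ
    rcases hζ with rfl | rfl <;> rwa [plusFinset_configOf]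

/-- `A` can be enlarged to `B`, not increasing the perimeter, along a path on which the energy is
less than `Γ`. -/
structure FillsBelow (J h Γ : ℝ) (A B : Finset (Site (ZMod L))) : Prop where
  subset : A ⊆ B
  perimeter_le : perimeter B ≤ perimeter A
  joinedBelow : JoinedBelow J h Γ A B

namespace FillsBelow

lemma refl (hA : energy J h A < Γ) : FillsBelow J h Γ A A := ⟨subset_rfl, le_rfl, .refl hA⟩

lemma trans (hAB : FillsBelow J h Γ A B) (hBC : FillsBelow J h Γ B C) : FillsBelow J h Γ A C :=
  ⟨hAB.subset.trans hBC.subset, hBC.perimeter_le.trans hAB.perimeter_le,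
    hAB.joinedBelow.trans hBC.joinedBelow⟩

lemma energy_le (hAB : FillsBelow J h Γ A B) (hh : 0 ≤ h) (hJ : 0 ≤ J) :
    energy J h B ≤ energy J h A :=
  energy_le_of_perimeter_le hh hJ hAB.subset hAB.perimeter_le

lemma insert_of_two_le_contacts (hh : 0 ≤ h) (hJ : 0 ≤ J) (hx : 2 ≤ contacts A x)
    (hA : energy J h A < Γ) : FillsBelow J h Γ A (insert x A) := by
  by_cases hxA : x ∈ A
  · rw [Finset.insert_eq_of_mem hxA]
    exact .refl hA
  · have hsub := Finset.subset_insert x A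
    have hp : perimeter (insert x A) ≤ perimeter A := by
      have := perimeter_insert_le_of_two hxA hx
      omega
    exact ⟨hsub, hp, .insert hA ((energy_le_of_perimeter_le hh hJ hsub hp).trans_lt hA)⟩

lemma insert_insert (hh : 0 ≤ h) (hJ : h ≤ J) {m y : Site (ZMod L)} (hm : 1 ≤ contacts A m)
    (hy : 2 ≤ contacts (insert m A) y) (hym : y ≠ m) (hmy : y ∈ A → 2 ≤ contacts A m)
    (hA : energy J h A + J - h < Γ) : FillsBelow J h Γ A (insert y (insert m A)) := by
  have hJ₀ := hh.trans hJ
  have hA' : energy J h A < Γ := by linarith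
  by_cases hmA : m ∈ A
  · rw [Finset.insert_eq_of_mem hmA] at hy ⊢
    exact insert_of_two_le_contacts hh hJ₀ hy hA'
  by_cases hyA : y ∈ A
  · rw [Finset.insert_eq_of_mem (a := y) (Finset.mem_insert_of_mem hyA)]
    exact insert_of_two_le_contacts hh hJ₀ (hmy hyA) hA'
  · have hymA : y ∉ insert m A := by simp [hym, hyA]
    have henergy := energy_insert_le (h := h) hJ₀ hmA hm
    have hfill := insert_of_two_le_contacts (Γ := Γ) hh hJ₀ hy (by linarith)
    have hpm := perimeter_insert_le_of_one hmA hm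
    have hpy := perimeter_insert_le_of_two hymA hy
    exact ⟨(Finset.subset_insert m A).trans hfill.subset, by omega,
      (JoinedBelow.insert hA' (by linarith)).trans hfill.joinedBelow⟩

end FillsBelow

end Descent

section Rows

/-- A row of faces of the torus: consecutive faces are joined by the edges `i₀` and `i₁` in turn,
and the faces of even index have `i₂` as their remaining edge. -/
structure IsRow {L : ℕ} (f : ℤ → Site (ZMod L)) (i₀ i₁ i₂ : Fin 3) : Prop where
  ne₀₁ : i₀ ≠ i₁
  ne₀₂ : i₀ ≠ i₂
  ne₁₂ : i₁ ≠ i₂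
  odd : ∀ j, f (2 * j + 1) = neighbor (f (2 * j)) i₀
  even : ∀ j, f (2 * j + 2) = neighbor (f (2 * j + 1)) i₁

namespace IsRow

variable {L : ℕ} {f : ℤ → Site (ZMod L)} {i₀ i₁ i₂ : Fin 3}

lemma shift (hf : IsRow f i₀ i₁ i₂) (a : ℤ) : IsRow (fun j => f (2 * a + j)) i₀ i₁ i₂ where
  ne₀₁ := hf.ne₀₁
  ne₀₂ := hf.ne₀₂
  ne₁₂ := hf.ne₁₂
  odd j := by simpa only [mul_add, add_assoc] using hf.odd (a + j)
  even j := by simpa only [mul_add, add_assoc] using hf.even (a + j)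

lemma reverse (hf : IsRow f i₀ i₁ i₂) : IsRow (fun j => f (-j)) i₁ i₀ i₂ where
  ne₀₁ := hf.ne₀₁.symm
  ne₀₂ := hf.ne₁₂
  ne₁₂ := hf.ne₀₂
  odd j := by
    rw [show -(2 * j) = 2 * (-j - 1) + 2 by ring, hf.even, neighbor_neighbor]
    ring_nf
  even j := by
    rw [show -(2 * j + 1) = 2 * (-j - 1) + 1 by ring, hf.odd, neighbor_neighbor]
    ring_nf

variable [NeZero L] {J h Γ : ℝ} {A : Finset (Site (ZMod L))} {n : ℕ}

lemma fillsBelow_of_zero_mem (hf : IsRow f i₀ i₁ i₂) (hh : 0 ≤ h) (hJ : h ≤ J) (n : ℕ)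
    (hbelow : ∀ j : ℤ, 0 ≤ j → j ≤ n → neighbor (f (2 * j)) i₂ ∈ A) (hzero : f 0 ∈ A)
    (hA : energy J h A + J - h < Γ) :
    FillsBelow J h Γ A (A ∪ (Finset.Icc 0 (2 * n : ℤ)).image f) := by
  induction n with
  | zero =>
    have hset : A ∪ (Finset.Icc 0 (2 * (0 : ℕ) : ℤ)).image f = A := by simp [hzero]
    rw [hset]
    exact .refl (by linarith)
  | succ n ih =>
    have hfill := ih fun j h₀ hn => hbelow j h₀ (by omega)
    have henergy := hfill.energy_le hh (hh.trans hJ)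
    set B := A ∪ (Finset.Icc 0 (2 * n : ℤ)).image f
    have hIcc : Finset.Icc 0 (2 * (n + 1 : ℕ) : ℤ) =
        insert (2 * n + 2 : ℤ) (insert (2 * n + 1 : ℤ) (Finset.Icc 0 (2 * n : ℤ))) := by
      ext j
      simp only [Finset.mem_Icc, Finset.mem_insert]
      omega
    have hlast : f (2 * n) ∈ B :=
      Finset.mem_union_right _ (Finset.mem_image_of_mem _ (by simp))
    have hback : neighbor (f (2 * n + 1)) i₀ ∈ B := by rwa [hf.odd, neighbor_neighbor]
    have hback' : neighbor (f (2 * n + 2)) i₁ = f (2 * n + 1) := by rw [hf.even, neighbor_neighbor]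
    have hbase : neighbor (f (2 * n + 2)) i₂ ∈ B := by
      have := hfill.subset (hbelow (n + 1) (by omega) (by push_cast; rfl))
      rwa [mul_add, mul_one] at this
    rw [hIcc, Finset.image_insert, Finset.image_insert, Finset.union_insert, Finset.union_insert]
    refine hfill.trans (.insert_insert hh hJ (one_le_contacts i₀ hback)
      (two_le_contacts hf.ne₁₂ (by simp [hback']) (Finset.mem_insert_of_mem hbase)) ?_
      (fun hy => two_le_contacts hf.ne₀₁ hback (by rwa [← hf.even])) (by linarith))
    rw [hf.even]
    exact neighbor_ne _ _

lemma fillsBelow_of_even_mem (hf : IsRow f i₀ i₁ i₂) (hh : 0 ≤ h) (hJ : h ≤ J)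
    (hbelow : ∀ j : ℤ, 0 ≤ j → j ≤ n → neighbor (f (2 * j)) i₂ ∈ A) {a : ℕ} (han : a ≤ n)
    (ha : f (2 * a) ∈ A) (hA : energy J h A + J - h < Γ) :
    FillsBelow J h Γ A (A ∪ (Finset.Icc 0 (2 * n : ℤ)).image f) := by
  obtain ⟨c, rfl⟩ := Nat.exists_eq_add_of_le han
  have hright := (hf.shift a).fillsBelow_of_zero_mem hh hJ c
    (fun j h₀ hj => by simpa only [mul_add] using hbelow (a + j) (by omega) (by push_cast; omega))
    (by simpa using ha) hA
  have henergy := hright.energy_le hh (hh.trans hJ)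
  have hleft := (hf.shift a).reverse.fillsBelow_of_zero_mem (Γ := Γ) hh hJ a
    (fun j h₀ hj => hright.subset (by
      have := hbelow (a - j) (by omega) (by push_cast; omega)
      rwa [show (2 : ℤ) * (a - j) = 2 * a + -(2 * j) by ring] at this))
    (hright.subset (by simpa using ha)) (by linarith)
  convert hright.trans hleft using 1
  rw [Finset.union_assoc]
  congr 1
  ext u
  simp only [Finset.mem_union, Finset.mem_image, Finset.mem_Icc]
  constructor
  · rintro ⟨m, hm, rfl⟩
    rcases le_total (2 * a : ℤ) m with hle | hle
    · exact Or.inl ⟨m - 2 * a, by omega, by congr 1; omega⟩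
    · exact Or.inr ⟨2 * a - m, by omega, by congr 1; omega⟩
  · rintro (⟨j, hj, rfl⟩ | ⟨j, hj, rfl⟩)
    · exact ⟨_, by omega, rfl⟩
    · exact ⟨_, by omega, rfl⟩

lemma fillsBelow_of_mem (hf : IsRow f i₀ i₁ i₂) (hh : 0 ≤ h) (hJ : h ≤ J)
    (hbelow : ∀ j : ℤ, 0 ≤ j → j ≤ n → neighbor (f (2 * j)) i₂ ∈ A) {m : ℕ} (hmn : m ≤ 2 * n)
    (hm : f m ∈ A) (hA : energy J h A + J - h < Γ) :
    FillsBelow J h Γ A (A ∪ (Finset.Icc 0 (2 * n : ℤ)).image f) := by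
  rcases Nat.even_or_odd' m with ⟨a, rfl | rfl⟩
  · exact hf.fillsBelow_of_even_mem hh hJ hbelow (a := a) (by omega) (by simpa using hm) hA
  · have hcontacts : 2 ≤ contacts A (f (2 * a)) :=
      two_le_contacts hf.ne₀₂ (by simpa [← hf.odd] using hm) (hbelow a (by omega) (by omega))
    have hinsert : FillsBelow J h Γ A (insert (f (2 * a)) A) :=
      .insert_of_two_le_contacts hh (hh.trans hJ) hcontacts (by linarith)
    have henergy := hinsert.energy_le hh (hh.trans hJ)
    have hfill := hf.fillsBelow_of_even_mem (Γ := Γ) hh hJ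
      (fun j h₀ hj => hinsert.subset (hbelow j h₀ hj)) (a := a) (by omega)
      (Finset.mem_insert_self _ _) (by linarith)
    have hmem : f (2 * a) ∈ (Finset.Icc 0 (2 * n : ℤ)).image f :=
      Finset.mem_image_of_mem _ (Finset.mem_Icc.2 (by omega))
    rw [Finset.insert_union, Finset.insert_eq_of_mem (Finset.mem_union_right _ hmem)] at hfill
    exact hinsert.trans hfill

lemma joinedBelow_union (hf : IsRow f i₀ i₁ i₂) (hh : 0 ≤ h) (hJ : h ≤ J)
    (hbelow : ∀ j : ℤ, 0 ≤ j → j ≤ n → neighbor (f (2 * j)) i₂ ∈ A)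
    (hA : energy J h A + 2 * J - 2 * h < Γ) :
    JoinedBelow J h Γ A (A ∪ (Finset.Icc 0 (2 * n : ℤ)).image f) ∧
      perimeter (A ∪ (Finset.Icc 0 (2 * n : ℤ)).image f) ≤ perimeter A + 1 ∧
      (Disjoint A ((Finset.Icc 0 (2 * n : ℤ)).image f) ∨
        perimeter (A ∪ (Finset.Icc 0 (2 * n : ℤ)).image f) ≤ perimeter A) := by
  by_cases hd : Disjoint A ((Finset.Icc 0 (2 * n : ℤ)).image f)
  · have hmem : f 0 ∈ (Finset.Icc 0 (2 * n : ℤ)).image f :=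
      Finset.mem_image_of_mem _ (by simp)
    have hzero : f 0 ∉ A := Finset.disjoint_right.1 hd hmem
    have hcontact : 1 ≤ contacts A (f 0) :=
      one_le_contacts i₂ (by simpa using hbelow 0 le_rfl (by omega))
    have henergy := energy_insert_le (h := h) (hh.trans hJ) hzero hcontact
    have hp := perimeter_insert_le_of_one hzero hcontact
    have hfill := hf.fillsBelow_of_zero_mem (Γ := Γ) hh hJ n
      (fun j h₀ hj => Finset.mem_insert_of_mem (hbelow j h₀ hj)) (Finset.mem_insert_self _ A)
      (by linarith)
    rw [Finset.insert_union, Finset.insert_eq_of_mem (Finset.mem_union_right _ hmem)] at hfill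
    exact ⟨(JoinedBelow.insert (by linarith) (by linarith)).trans hfill.joinedBelow,
      hfill.perimeter_le.trans hp, Or.inl hd⟩
  · obtain ⟨u, huA, hu⟩ := Finset.not_disjoint_iff.1 hd
    obtain ⟨m, hm, rfl⟩ := Finset.mem_image.1 hu
    rw [Finset.mem_Icc] at hm
    lift m to ℕ using hm.1
    have hfill := hf.fillsBelow_of_mem (Γ := Γ) hh hJ hbelow (by omega) huA (by linarith)
    exact ⟨hfill.joinedBelow, hfill.perimeter_le.trans (Nat.le_succ _), Or.inr hfill.perimeter_le⟩

end IsRow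

end Rows

section TorusHexagons

/-- The image of a planar hexagon on the torus. -/
noncomputable def torusHexagon (L : ℕ) (b : Fin 6 → ℤ) : Finset (Site (ZMod L)) :=
  (hexagonFinset b).image (toTorus L)

variable {L : ℕ}

lemma torusHexagon_mono {b b' : Fin 6 → ℤ} (hb : ∀ k, b k ≤ b' k) :
    torusHexagon L b ⊆ torusHexagon L b' :=
  Finset.image_subset_image (hexagonFinset_mono hb)

lemma intCast_inj_of_lt {x y : ℤ} (h : (x : ZMod L) = y) (hxy : x - y < L) (hyx : y - x < L) :
    x = y := by
  rw [ZMod.intCast_eq_intCast_iff_dvd_sub] at h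
  have := Int.eq_zero_of_abs_lt_dvd h (abs_lt.2 ⟨by omega, by omega⟩)
  omega

lemma injOn_toTorus {b : Fin 6 → ℤ} (h₀ : b 0 + b 3 ≤ L) (h₂ : b 2 + b 5 ≤ L) :
    Set.InjOn (toTorus L) (hexagonFinset b : Set (Site ℤ)) := by
  rintro ⟨⟨x, y⟩, t⟩ hf ⟨⟨x', y'⟩, t'⟩ hg hfg
  rw [Finset.mem_coe, mem_hexagonFinset] at hf hg
  simp only [toTorus, Prod.mk.injEq] at hfg
  obtain ⟨⟨hx, hy⟩, rfl⟩ := hfg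
  have hf₀ := hf 0
  have hf₂ := hf 2
  have hf₃ := hf 3
  have hf₅ := hf 5
  have hg₀ := hg 0
  have hg₂ := hg 2
  have hg₃ := hg 3
  have hg₅ := hg 5
  simp [faceForm, strip] at hf₀ hf₂ hf₃ hf₅ hg₀ hg₂ hg₃ hg₅
  rw [intCast_inj_of_lt hx (by omega) (by omega), intCast_inj_of_lt hy (by omega) (by omega)]

namespace IsBar

variable {b : Fin 6 → ℤ} {k : Fin 6} {f : ℤ → Site ℤ} {i₀ i₁ i₂ : Fin 3} {n : ℕ}

lemma isRow (hf : IsBar b k f i₀ i₁ i₂) : IsRow (fun n => toTorus L (f n)) i₀ i₁ i₂ where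
  ne₀₁ := hf.ne₀₁
  ne₀₂ := hf.ne₀₂
  ne₁₂ := hf.ne₁₂
  odd j := by rw [hf.odd, toTorus_neighbor]
  even j := by rw [hf.even, toTorus_neighbor]

lemma hexagonFinset_pushSide (hf : IsBar b k f i₀ i₁ i₂) (hn : sideLength b k = n + 1) :
    hexagonFinset (pushSide b k) = hexagonFinset b ∪ (Finset.Icc 0 (2 * n : ℤ)).image f := by
  ext g
  rw [Finset.mem_union, Finset.mem_image]
  constructor
  · intro hg
    by_cases hgb : g ∈ hexagonFinset b
    · exact Or.inl hgb
    · obtain ⟨m, h₀, hm, rfl⟩ := (hf.mem g).1 ⟨hg, hgb⟩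
      exact Or.inr ⟨m, Finset.mem_Icc.2 ⟨h₀, by omega⟩, rfl⟩
  · rintro (hg | ⟨m, hm, rfl⟩)
    · exact hexagonFinset_mono (le_pushSide b k) hg
    · rw [Finset.mem_Icc] at hm
      exact ((hf.mem _).2 ⟨m, hm.1, by omega, rfl⟩).1

lemma torusHexagon_pushSide (hf : IsBar b k f i₀ i₁ i₂) (hn : sideLength b k = n + 1) :
    torusHexagon L (pushSide b k) =
      torusHexagon L b ∪ (Finset.Icc 0 (2 * n : ℤ)).image fun m => toTorus L (f m) := by
  rw [torusHexagon, hf.hexagonFinset_pushSide hn, Finset.image_union, Finset.image_image]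
  rfl

lemma neighbor_mem (hf : IsBar b k f i₀ i₁ i₂) (hn : sideLength b k = n + 1)
    {A : Finset (Site (ZMod L))} (hA : torusHexagon L b ⊆ A) (j : ℤ) (h₀ : 0 ≤ j) (hj : j ≤ n) :
    neighbor (toTorus L (f (2 * j))) i₂ ∈ A := by
  rw [← toTorus_neighbor]
  exact hA (Finset.mem_image_of_mem _ (hf.below j h₀ (by omega)))

end IsBar

lemma joinedBelow_union_torusHexagon_pushSide [NeZero L] {J h Γ : ℝ} {A : Finset (Site (ZMod L))}
    {b : Fin 6 → ℤ} {k : Fin 6} (hb : ∀ k, 0 ≤ sideLength b k) (hne : (hexagonFinset b).Nonempty)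
    (hk : 1 ≤ sideLength b k) (hh : 0 ≤ h) (hJ : h ≤ J) (hbA : torusHexagon L b ⊆ A)
    (hA : energy J h A + 2 * J - 2 * h < Γ) :
    JoinedBelow J h Γ A (A ∪ torusHexagon L (pushSide b k)) ∧
      perimeter (A ∪ torusHexagon L (pushSide b k)) ≤ perimeter A + 1 ∧
      (perimeter (A ∪ torusHexagon L (pushSide b k)) ≤ perimeter A ∨
        (Set.InjOn (toTorus L) (hexagonFinset (pushSide b k) : Set (Site ℤ)) →
          ((A ∪ torusHexagon L (pushSide b k)).card : ℤ) = A.card + 2 * sideLength b k - 1)) := by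
  obtain ⟨f, i₀, i₁, i₂, hf⟩ := exists_isBar k b hb hne
  obtain ⟨n, hn⟩ := Int.eq_ofNat_of_zero_le (sub_nonneg.2 hk)
  replace hn : sideLength b k = n + 1 := by omega
  have hset : A ∪ torusHexagon L (pushSide b k) =
      A ∪ (Finset.Icc 0 (2 * n : ℤ)).image fun m => toTorus L (f m) := by
    rw [hf.torusHexagon_pushSide hn, ← Finset.union_assoc, Finset.union_eq_left.2 hbA]
  obtain ⟨hjoin, hper, hdisj⟩ := hf.isRow.joinedBelow_union hh hJ (hf.neighbor_mem hn hbA) hA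
  rw [hset]
  refine ⟨hjoin, hper, hdisj.symm.imp_right fun hd hinj => ?_⟩
  rw [hf.hexagonFinset_pushSide hn] at hinj
  rw [Finset.card_union_of_disjoint hd, Finset.card_image_of_injOn, Int.card_Icc, hn]
  · push_cast
    omega
  · intro m hm m' hm' hmm'
    exact hf.inj (hinj (Finset.mem_union_right _ (Finset.mem_image_of_mem f hm))
      (Finset.mem_union_right _ (Finset.mem_image_of_mem f hm')) hmm')

end TorusHexagons

section HexChain

lemma sideForm_sub_add (k : Fin 6) (c : ℤ × ℤ) :
    sideForm (k - 1) c + sideForm (k + 1) c = sideForm k c := by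
  have hneg : (-1 : Fin 6) = 5 := rfl
  fin_cases k <;> (simp [sideForm, hneg]; try ring)

/-- The bounds of the quasi-regular hexagon of perimeter `s` around `c`, whose bars start at the
side `d`. -/
def hexChain (c : ℤ × ℤ) (d : Fin 6) (s : ℕ) : Fin 6 → ℤ := quasiHexBounds c (s / 6) (s % 6) d

lemma hexChain_eq (c : ℤ × ℤ) (d : Fin 6) (r : ℕ) (i : Fin 6) :
    hexChain c d (6 * r + i) = quasiHexBounds c r i d := by
  have := i.isLt
  rw [hexChain, show (6 * r + (i : ℕ)) / 6 = r by omega, show (6 * r + (i : ℕ)) % 6 = i by omega]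

lemma exists_eq_six_mul_add (s : ℕ) : ∃ (r : ℕ) (i : Fin 6), s = 6 * r + i :=
  ⟨s / 6, ⟨s % 6, Nat.mod_lt _ (by norm_num)⟩, (Nat.div_add_mod s 6).symm⟩

lemma ofNat_six_mul_add (r : ℕ) (i : Fin 6) : Fin.ofNat 6 (6 * r + i) = i :=
  Fin.ext (by simp [Fin.ofNat])

lemma sideLength_quasiHexBounds (c : ℤ × ℤ) (r : ℕ) (i d k : Fin 6) :
    sideLength (quasiHexBounds c r i d) k = r + ((if (k - 1 - d).val < i.val then 1 else 0) +
      (if (k + 1 - d).val < i.val then 1 else 0) - if (k - d).val < i.val then 1 else 0) := by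
  have := sideForm_sub_add k c
  simp only [sideLength, quasiHexBounds]
  linarith

lemma sideLength_hexChain_nonneg (c : ℤ × ℤ) (d : Fin 6) {s : ℕ} (hs : 6 ≤ s) (k : Fin 6) :
    0 ≤ sideLength (hexChain c d s) k := by
  obtain ⟨r, i, rfl⟩ := exists_eq_six_mul_add s
  have := i.isLt
  rw [hexChain_eq, sideLength_quasiHexBounds]
  split_ifs <;> omega

lemma le_sideLength_hexChain (c : ℤ × ℤ) (d : Fin 6) (s : ℕ) :
    (s / 6 : ℕ) ≤ sideLength (hexChain c d s) (d + Fin.ofNat 6 s) := by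
  obtain ⟨r, i, rfl⟩ := exists_eq_six_mul_add s
  have := i.isLt
  have hbar : ¬ ((d + i - d).val < i.val) := by simp
  rw [ofNat_six_mul_add, hexChain_eq, sideLength_quasiHexBounds,
    show (6 * r + (i : ℕ)) / 6 = r by omega, if_neg hbar]
  split_ifs <;> omega

lemma hexChain_six_mul_add_one (c : ℤ × ℤ) (d : Fin 6) (r : ℕ) (i : Fin 6) :
    hexChain c d (6 * r + i + 1) = quasiHexBounds c r (i + 1) d := by
  have hi := i.isLt
  by_cases hlast : i.val = 5
  · rw [hexChain, show (6 * r + (i : ℕ) + 1) / 6 = r + 1 by omega,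
      show (6 * r + (i : ℕ) + 1) % 6 = 0 by omega, hlast]
    funext k
    have := (k - d).isLt
    simp [quasiHexBounds]
    omega
  · rw [hexChain, show (6 * r + (i : ℕ) + 1) / 6 = r by omega,
      show (6 * r + (i : ℕ) + 1) % 6 = i + 1 by omega]

lemma hexChain_succ (c : ℤ × ℤ) (d : Fin 6) (s : ℕ) :
    hexChain c d (s + 1) = pushSide (hexChain c d s) (d + Fin.ofNat 6 s) := by
  have hindicator : ∀ d i k : Fin 6, (if (k - d).val < i.val + 1 then (1 : ℤ) else 0) =
      (if (k - d).val < i.val then 1 else 0) + if k = d + i then 1 else 0 := by decide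
  obtain ⟨r, i, rfl⟩ := exists_eq_six_mul_add s
  rw [ofNat_six_mul_add, hexChain_eq, hexChain_six_mul_add_one]
  funext k
  rw [quasiHexBounds, hindicator]
  by_cases hk : k = d + i
  · rw [hk, pushSide, Function.update_self, quasiHexBounds, if_pos rfl]
    ring
  · rw [pushSide, Function.update_of_ne hk, quasiHexBounds, if_neg hk]
    ring

lemma hexChain_le_succ (c : ℤ × ℤ) (d : Fin 6) (s : ℕ) (k : Fin 6) :
    hexChain c d s k ≤ hexChain c d (s + 1) k := by
  rw [hexChain_succ]
  exact le_pushSide _ _ k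

lemma hexChain_mul_six (c : ℤ × ℤ) (d : Fin 6) (r : ℕ) (k : Fin 6) :
    hexChain c d (6 * r) k = sideForm k c + r := by
  rw [hexChain, show 6 * r / 6 = r by omega, show 6 * r % 6 = 0 by omega]
  simp [quasiHexBounds]

lemma hexChain_mul_six_eq (c : ℤ × ℤ) (d d' : Fin 6) (r : ℕ) :
    hexChain c d (6 * r) = hexChain c d' (6 * r) := by
  funext k
  rw [hexChain_mul_six, hexChain_mul_six]

lemma sum_quasiHexBounds (c : ℤ × ℤ) (r : ℕ) (i d : Fin 6) :
    ∑ k, quasiHexBounds c r i d k = 6 * r + i := by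
  have hbars : ∀ d i : Fin 6,
      ∑ k : Fin 6, (if (k - d).val < i.val then (1 : ℤ) else 0) = i.val := by decide
  have hcenter : ∑ k, sideForm k c = 0 := by
    simp [Fin.sum_univ_succ, sideForm]
    ring
  simp only [quasiHexBounds, Finset.sum_add_distrib, hcenter, hbars]
  simp

/-- Six times the area of a quasi-regular hexagon of perimeter `s` falls short of `s ^ 2` by this
number, where `i` is the residue of `s`. -/
def areaDefect (i : Fin 6) : ℤ := ![0, 7, 4, 3, 4, 7] i

lemma six_mul_card_quasiHexBounds (c : ℤ × ℤ) {r : ℕ} (hr : 1 ≤ r) (i d : Fin 6) :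
    6 * ((hexagonFinset (quasiHexBounds c r i d)).card : ℤ) =
      (6 * r + i : ℤ) ^ 2 - areaDefect i := by
  have hdefect : ∀ d i : Fin 6, ∀ χ : Fin 6 → ℤ,
      χ = (fun k => if (k - d).val < i.val then 1 else 0) →
      2 * ((χ 0 + χ 3 - (χ 1 + χ 4)) ^ 2 + (χ 1 + χ 4 - (χ 2 + χ 5)) ^ 2 +
        (χ 0 + χ 3 - (χ 2 + χ 5)) ^ 2) + 3 * (χ 0 + χ 2 + χ 4 - (χ 1 + χ 3 + χ 5)) ^ 2 =
        areaDefect i := by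
    rintro d i _ rfl
    revert d i
    decide
  have hside : ∀ k, 0 ≤ sideLength (quasiHexBounds c r i d) k := by
    intro k
    rw [← hexChain_eq]
    exact sideLength_hexChain_nonneg c d (by omega) k
  rw [six_mul_card_hexagonFinset hside, sum_quasiHexBounds, ← hdefect d i _ rfl]
  simp only [quasiHexBounds, sideForm]
  simp
  ring

lemma card_hexChain (c : ℤ × ℤ) (d : Fin 6) {s : ℕ} (hs : 6 ≤ s) :
    6 * ((hexagonFinset (hexChain c d s)).card : ℤ) =
      (s : ℤ) ^ 2 - areaDefect (Fin.ofNat 6 s) := by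
  obtain ⟨r, i, rfl⟩ := exists_eq_six_mul_add s
  rw [hexChain_eq, six_mul_card_quasiHexBounds c (by omega), ofNat_six_mul_add]
  push_cast
  rfl

lemma nonempty_hexChain (c : ℤ × ℤ) (d : Fin 6) {s : ℕ} (hs : 6 ≤ s) :
    (hexagonFinset (hexChain c d s)).Nonempty := by
  have hcard := card_hexChain c d hs
  have hdefect : ∀ i, areaDefect i ≤ 7 := by decide
  have := hdefect (Fin.ofNat 6 s)
  rw [← Finset.card_pos]
  zify at hs ⊢
  nlinarith

lemma width_hexChain (c : ℤ × ℤ) (d : Fin 6) (s : ℕ) :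
    hexChain c d s 0 + hexChain c d s 3 ≤ 2 * (((s + 5) / 6 : ℕ) : ℤ) ∧
      hexChain c d s 2 + hexChain c d s 5 ≤ 2 * (((s + 5) / 6 : ℕ) : ℤ) := by
  obtain ⟨r, i, rfl⟩ := exists_eq_six_mul_add s
  have := i.isLt
  rw [hexChain_eq]
  simp only [quasiHexBounds, sideForm]
  constructor <;> simp <;> split_ifs <;> omega

/-- The energy of a quasi-regular hexagon of perimeter `s`. -/
noncomputable def chainEnergy (J h : ℝ) (s : ℕ) : ℝ :=
  J * s - h * (((s : ℝ) ^ 2 - areaDefect (Fin.ofNat 6 s)) / 6)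

variable {L : ℕ}

lemma injOn_hexChain (c : ℤ × ℤ) (d : Fin 6) {s : ℕ} (hL : 2 * ((s + 5) / 6) ≤ L) :
    Set.InjOn (toTorus L) (hexagonFinset (hexChain c d s) : Set (Site ℤ)) := by
  obtain ⟨h₀, h₂⟩ := width_hexChain c d s
  exact injOn_toTorus (h₀.trans (by exact_mod_cast hL)) (h₂.trans (by exact_mod_cast hL))

lemma card_torusHexagon_hexChain (c : ℤ × ℤ) (d : Fin 6) {s : ℕ} (hL : 2 * ((s + 5) / 6) ≤ L) :
    (torusHexagon L (hexChain c d s)).card = (hexagonFinset (hexChain c d s)).card :=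
  Finset.card_image_of_injOn (injOn_hexChain c d hL)

lemma energy_hexChain_le {J h : ℝ} (hJ : 0 ≤ J) {c : ℤ × ℤ} {d : Fin 6} {s : ℕ} (hs : 6 ≤ s)
    (hL : 2 * ((s + 5) / 6) ≤ L) (hp : perimeter (torusHexagon L (hexChain c d s)) ≤ s) :
    energy J h (torusHexagon L (hexChain c d s)) ≤ chainEnergy J h s := by
  have hcard : (6 : ℝ) * (hexagonFinset (hexChain c d s)).card =
      (s : ℝ) ^ 2 - areaDefect (Fin.ofNat 6 s) := by
    exact_mod_cast card_hexChain c d hs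
  have hper : J * perimeter (torusHexagon L (hexChain c d s)) ≤ J * s := by gcongr
  rw [energy, chainEnergy, card_torusHexagon_hexChain c d hL, ← hcard]
  linarith

end HexChain

section FirstHexagon

/-- The faces around the vertex `c`, in cyclic order. -/
def faceAround (c : ℤ × ℤ) : ℕ → Site ℤ
  | 0 => (c, true)
  | n + 1 => neighbor (faceAround c n) (![1, 0, 2] (Fin.ofNat 3 n))

lemma faceAround_six (c : ℤ × ℤ) : faceAround c 6 = faceAround c 0 := by
  simp [faceAround, neighbor, Fin.ofNat]

lemma hexagonFinset_hexChain_six (c : ℤ × ℤ) (d : Fin 6) :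
    hexagonFinset (hexChain c d 6) = (Finset.range 6).image (faceAround c) := by
  have hbounds : ∀ k, hexChain c d 6 k = sideForm k c + 1 := fun k => by
    simpa using hexChain_mul_six c d 1 k
  obtain ⟨c₁, c₂⟩ := c
  ext ⟨⟨u, v⟩, t⟩
  rw [mem_hexagonFinset]
  simp only [hbounds]
  cases t <;>
    simp [Fin.forall_fin_succ, faceForm, strip, sideForm, Finset.range_add_one, faceAround,
      neighbor, Fin.ofNat] <;>
    omega

variable {L : ℕ} [NeZero L] {J h Γ : ℝ}

lemma joinedBelow_empty_image_range (hh : 0 ≤ h) (hJ : h ≤ J) {x : ℕ → Site (ZMod L)}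
    (hx : ∀ j, ∃ i, x (j + 1) = neighbor (x j) i) (n : ℕ) (hΓ : (n + 3) * J - (n + 1) * h < Γ) :
    JoinedBelow J h Γ ∅ ((Finset.range (n + 1)).image x) ∧
      energy J h ((Finset.range (n + 1)).image x) ≤ (n + 3) * J - (n + 1) * h ∧
      perimeter ((Finset.range (n + 1)).image x) ≤ n + 3 := by
  induction n with
  | zero =>
    have hper : perimeter ({x 0} : Finset (Site (ZMod L))) = 3 := by
      have hinsert := perimeter_insert (Finset.notMem_empty (x 0))
      zify
      simpa [perimeter_empty, contacts] using hinsert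
    have hempty : energy J h (∅ : Finset (Site (ZMod L))) = 0 := by
      simp [energy, perimeter_empty]
    have hsingle : energy J h {x 0} = 3 * J - h := by
      rw [energy, hper, Finset.card_singleton]
      push_cast
      ring
    have hjoin : JoinedBelow J h Γ ∅ (insert (x 0) ∅) := by
      refine .insert ?_ ?_
      · push_cast at hΓ
        linarith
      · rw [insert_empty_eq, hsingle]
        push_cast at hΓ
        linarith
    simpa [hsingle, hper] using hjoin
  | succ n ih =>
    push_cast at hΓ ⊢
    obtain ⟨hjoin, henergy, hper⟩ := ih (by linarith)
    rw [Finset.range_add_one, Finset.image_insert]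
    obtain ⟨i, hi⟩ := hx n
    have hcontact : 1 ≤ contacts ((Finset.range (n + 1)).image x) (x (n + 1)) := by
      refine one_le_contacts i ?_
      rw [hi, neighbor_neighbor]
      exact Finset.mem_image_of_mem _ (by simp)
    by_cases hmem : x (n + 1) ∈ (Finset.range (n + 1)).image x
    · rw [Finset.insert_eq_of_mem hmem]
      exact ⟨hjoin, by linarith, by omega⟩
    · have hstep := energy_insert_le (h := h) (hh.trans hJ) hmem hcontact
      have := perimeter_insert_le_of_one hmem hcontact
      exact ⟨hjoin.trans (.insert (by linarith) (by linarith)), by linarith, by omega⟩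

/-- Going around a vertex, only the first five faces can increase the perimeter. -/
lemma joinedBelow_hexChain_six (hh : 0 ≤ h) (hJ : h ≤ J) (hL : 2 ≤ L) (hΓ : 7 * J - 5 * h < Γ)
    (c : ℤ × ℤ) (d : Fin 6) :
    JoinedBelow J h Γ ∅ (torusHexagon L (hexChain c d 6)) ∧
      perimeter (torusHexagon L (hexChain c d 6)) ≤ 6 := by
  have hstep : ∀ j, ∃ i, toTorus L (faceAround c (j + 1)) =
      neighbor (toTorus L (faceAround c j)) i := fun j => ⟨_, by rw [faceAround, toTorus_neighbor]⟩
  obtain ⟨hjoin, henergy, hper⟩ := joinedBelow_empty_image_range hh hJ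
    (x := fun j => toTorus L (faceAround c j)) hstep 4 (by push_cast; linarith)
  set A := (Finset.range (4 + 1)).image fun j => toTorus L (faceAround c j)
  have hset : torusHexagon L (hexChain c d 6) = insert (toTorus L (faceAround c 5)) A := by
    rw [torusHexagon, hexagonFinset_hexChain_six, Finset.image_image, Finset.range_add_one,
      Finset.image_insert]
    rfl
  have hcontacts : 2 ≤ contacts A (toTorus L (faceAround c 5)) := by
    refine two_le_contacts (i := 0) (j := 2) (by decide) ?_ ?_ <;> rw [← toTorus_neighbor]
    · rw [faceAround, show (![1, 0, 2] (Fin.ofNat 3 4) : Fin 3) = 0 from rfl, neighbor_neighbor]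
      exact Finset.mem_image_of_mem (fun j => toTorus L (faceAround c j)) (by simp)
    · rw [show neighbor (faceAround c 5) 2 = faceAround c 6 from rfl, faceAround_six]
      exact Finset.mem_image_of_mem (fun j => toTorus L (faceAround c j)) (by simp)
  have hfill := FillsBelow.insert_of_two_le_contacts (Γ := Γ) hh (hh.trans hJ) hcontacts
    (by push_cast at henergy; linarith)
  rw [← hset] at hfill
  refine ⟨hjoin.trans hfill.joinedBelow, ?_⟩
  have hcard := card_hexChain c d (s := 6) le_rfl
  have hcard' := card_torusHexagon_hexChain (L := L) c d (s := 6) (by omega)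
  have hparity := perimeter_mod_two (torusHexagon L (hexChain c d 6))
  have := hfill.perimeter_le
  have hdefect : areaDefect (Fin.ofNat 6 6) = 0 := rfl
  omega

end FirstHexagon

section Growth

variable {L : ℕ} [NeZero L] {J h Γ : ℝ} {A : Finset (Site (ZMod L))}

lemma joinedBelow_union_hexChain_succ (hh : 0 ≤ h) (hJ : h ≤ J) {c : ℤ × ℤ} {d : Fin 6} {s : ℕ}
    (hs : 6 ≤ s) (hcA : torusHexagon L (hexChain c d s) ⊆ A)
    (hA : energy J h A + 2 * J - 2 * h < Γ) :
    JoinedBelow J h Γ A (A ∪ torusHexagon L (hexChain c d (s + 1))) ∧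
      perimeter (A ∪ torusHexagon L (hexChain c d (s + 1))) ≤ perimeter A + 1 ∧
      (perimeter (A ∪ torusHexagon L (hexChain c d (s + 1))) ≤ perimeter A ∨
        (2 * ((s + 1 + 5) / 6) ≤ L →
          A.card + 2 * (s / 6) ≤ (A ∪ torusHexagon L (hexChain c d (s + 1))).card + 1)) := by
  have hside := le_sideLength_hexChain c d s
  rw [hexChain_succ]
  obtain ⟨hjoin, hper, hcard⟩ := joinedBelow_union_torusHexagon_pushSide
    (sideLength_hexChain_nonneg c d hs) (nonempty_hexChain c d hs) (k := d + Fin.ofNat 6 s)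
    (by omega) hh hJ hcA hA
  refine ⟨hjoin, hper, hcard.imp_right fun hcard hL => ?_⟩
  have := hcard (hexChain_succ c d s ▸ injOn_hexChain c d hL)
  omega

lemma joinedBelow_hexChain (hh : 0 ≤ h) (hJ : h ≤ J) {c : ℤ × ℤ} {d : Fin 6} {s t : ℕ}
    (hs : 6 ≤ s) (hst : s ≤ t) (hL : 2 * ((t + 5) / 6) ≤ L)
    (hp : perimeter (torusHexagon L (hexChain c d s)) ≤ s) (hfirst : chainEnergy J h s < Γ)
    (hΓ : ∀ u, s ≤ u → u < t → chainEnergy J h u + 2 * J - 2 * h < Γ) :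
    JoinedBelow J h Γ (torusHexagon L (hexChain c d s)) (torusHexagon L (hexChain c d t)) ∧
      perimeter (torusHexagon L (hexChain c d t)) ≤ t := by
  induction t, hst using Nat.le_induction with
  | base => exact ⟨.refl ((energy_hexChain_le (hh.trans hJ) hs hL hp).trans_lt hfirst), hp⟩
  | succ t hst ih =>
    obtain ⟨hjoin, hper⟩ := ih (by omega) fun u hsu hut => hΓ u hsu (by omega)
    have henergy := energy_hexChain_le (h := h) (hh.trans hJ) (hs.trans hst) (by omega) hper
    obtain ⟨hjoin', hper', -⟩ := joinedBelow_union_hexChain_succ (Γ := Γ) (c := c) (d := d) hh hJ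
      (hs.trans hst) Finset.Subset.rfl (by linarith [hΓ t hst (by omega)])
    rw [Finset.union_eq_right.2 (torusHexagon_mono (hexChain_le_succ c d t))] at hjoin' hper'
    exact ⟨hjoin.trans hjoin', hper'.trans (by omega)⟩

/-- Beyond the critical radius a bar pays for itself: it costs at most `J` and gains
`(2 * R - 1) * h`. -/
lemma joinedBelow_union_hexChain_of_large (hh : 0 ≤ h) (hJ : h ≤ J) {R : ℕ} (hR : 1 ≤ R)
    (hJR : J ≤ (2 * R - 1) * h) {E : ℝ} (hE : E + 2 * J - 2 * h < Γ) {c : ℤ × ℤ} {d : Fin 6}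
    {s : ℕ} (hs : 6 * R ≤ s) (hL : 2 * ((s + 1 + 5) / 6) ≤ L)
    (hcA : torusHexagon L (hexChain c d s) ⊆ A) (hA : energy J h A ≤ E) :
    JoinedBelow J h Γ A (A ∪ torusHexagon L (hexChain c d (s + 1))) ∧
      energy J h (A ∪ torusHexagon L (hexChain c d (s + 1))) ≤ E := by
  obtain ⟨hjoin, hper, hgain⟩ :=
    joinedBelow_union_hexChain_succ (Γ := Γ) hh hJ (by omega) hcA (by linarith)
  refine ⟨hjoin, ?_⟩
  set B := A ∪ torusHexagon L (hexChain c d (s + 1))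
  rcases hgain with hper' | hcard
  · exact (energy_le_of_perimeter_le hh (hh.trans hJ) Finset.subset_union_left hper').trans hA
  · have hcard' : A.card + 2 * R ≤ B.card + 1 := by
      have := hcard hL
      omega
    have harea : h * (A.card + 2 * R) ≤ h * (B.card + 1) :=
      mul_le_mul_of_nonneg_left (by exact_mod_cast hcard') hh
    have hcost : J * perimeter B ≤ J * (perimeter A + 1) :=
      mul_le_mul_of_nonneg_left (by exact_mod_cast hper) (hh.trans hJ)
    rw [energy] at hA ⊢
    linarith

end Growth

section Covering

variable {L : ℕ} {R : ℕ}

lemma torusHexagon_translate_subset (c : ℤ × ℤ) (d : Fin 6) {v : ℤ × ℤ}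
    (hv : v = (1, 0) ∨ v = (0, 1)) :
    ∃ d', torusHexagon L (hexChain (c + v) d (6 * R)) ⊆
      torusHexagon L (hexChain c d' (6 * R + 2)) := by
  have htwo : ∀ d', hexChain c d' (6 * R + 2) = quasiHexBounds c R 2 d' := fun d' =>
    hexChain_eq c d' R 2
  rcases hv with rfl | rfl
  · refine ⟨0, torusHexagon_mono fun k => ?_⟩
    rw [hexChain_mul_six, htwo]
    fin_cases k <;> simp [quasiHexBounds, sideForm] <;> omega
  · refine ⟨1, torusHexagon_mono fun k => ?_⟩
    rw [hexChain_mul_six, htwo]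
    fin_cases k <;> simp [quasiHexBounds, sideForm] <;> omega

lemma mem_torusHexagon_hexChain (hR : 1 ≤ R) (c : ℤ × ℤ) (d : Fin 6) :
    toTorus L (c, true) ∈ torusHexagon L (hexChain c d (6 * R)) ∧
      toTorus L ((c.1 - 1, c.2), false) ∈ torusHexagon L (hexChain c d (6 * R)) := by
  constructor <;> refine Finset.mem_image_of_mem _ (mem_hexagonFinset.2 fun k => ?_) <;>
    rw [hexChain_mul_six] <;> fin_cases k <;> simp [faceForm, strip, sideForm] <;> omega

variable [NeZero L] {J h Γ : ℝ} {A : Finset (Site (ZMod L))}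

lemma eq_univ_of_translates (hR : 1 ≤ R) {c : ℤ × ℤ} {d : Fin 6}
    (hc : torusHexagon L (hexChain c d (6 * R)) ⊆ A)
    (htranslate : ∀ c v, v = (1, 0) ∨ v = (0, 1) → torusHexagon L (hexChain c d (6 * R)) ⊆ A →
      torusHexagon L (hexChain (c + v) d (6 * R)) ⊆ A) : A = Finset.univ := by
  have hfst : ∀ m : ℕ, torusHexagon L (hexChain (c + m • (1, 0)) d (6 * R)) ⊆ A := by
    intro m
    induction m with
    | zero => simpa using hc
    | succ m ih => simpa only [succ_nsmul, add_assoc] using htranslate _ _ (Or.inl rfl) ih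
  have hall : ∀ m n : ℕ, torusHexagon L (hexChain (c + m • (1, 0) + n • (0, 1)) d (6 * R)) ⊆ A := by
    intro m n
    induction n with
    | zero => simpa using hfst m
    | succ n ih => simpa only [succ_nsmul, add_assoc] using htranslate _ _ (Or.inr rfl) ih
  have hcenter : ∀ x y : ZMod L, ∃ e : ℤ × ℤ, (e.1 : ZMod L) = x ∧ (e.2 : ZMod L) = y ∧
      torusHexagon L (hexChain e d (6 * R)) ⊆ A := fun x y =>
    ⟨_, by simp, by simp, hall (x - c.1).val (y - c.2).val⟩
  ext ⟨⟨x, y⟩, t⟩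
  simp only [Finset.mem_univ, iff_true]
  cases t
  · obtain ⟨e, hx, hy, he⟩ := hcenter (x + 1) y
    have := he (mem_torusHexagon_hexChain hR e d).2
    rwa [toTorus, Int.cast_sub, hx, hy, Int.cast_one, add_sub_cancel_right] at this
  · obtain ⟨e, hx, hy, he⟩ := hcenter x y
    have := he (mem_torusHexagon_hexChain hR e d).1
    rwa [toTorus, hx, hy] at this

lemma exists_joinedBelow_translate (hh : 0 ≤ h) (hJ : h ≤ J) (hR : 1 ≤ R) (hL : 2 * R + 2 ≤ L)
    (hJR : J ≤ (2 * R - 1) * h) {E : ℝ} (hE : E + 2 * J - 2 * h < Γ) {c v : ℤ × ℤ} {d : Fin 6}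
    (hv : v = (1, 0) ∨ v = (0, 1)) (hc : torusHexagon L (hexChain c d (6 * R)) ⊆ A)
    (hA : energy J h A ≤ E) :
    ∃ B, A ⊆ B ∧ torusHexagon L (hexChain (c + v) d (6 * R)) ⊆ B ∧ JoinedBelow J h Γ A B ∧
      energy J h B ≤ E := by
  obtain ⟨d', hd'⟩ := torusHexagon_translate_subset (L := L) (R := R) c d hv
  rw [hexChain_mul_six_eq c d d'] at hc
  obtain ⟨hjoin, henergy⟩ := joinedBelow_union_hexChain_of_large (Γ := Γ) hh hJ hR hJR hE
    (s := 6 * R) le_rfl (by omega) hc hA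
  obtain ⟨hjoin', henergy'⟩ := joinedBelow_union_hexChain_of_large (Γ := Γ) hh hJ hR hJR hE
    (s := 6 * R + 1) (by omega) (by omega) (c := c) (d := d') Finset.subset_union_right henergy
  exact ⟨_, Finset.subset_union_left.trans Finset.subset_union_left,
    hd'.trans Finset.subset_union_right, hjoin.trans hjoin', henergy'⟩

lemma joinedBelow_univ (hh : 0 ≤ h) (hJ : h ≤ J) (hR : 1 ≤ R) (hL : 2 * R + 2 ≤ L)
    (hJR : J ≤ (2 * R - 1) * h) {E : ℝ} (hE : E + 2 * J - 2 * h < Γ) {c : ℤ × ℤ} {d : Fin 6}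
    (hc : torusHexagon L (hexChain c d (6 * R)) ⊆ A) (hA : energy J h A ≤ E) :
    JoinedBelow J h Γ A Finset.univ := by
  induction hn : Aᶜ.card using Nat.strong_induction_on generalizing A c with
  | h n ih =>
    subst hn
    by_cases htranslate : ∀ c v, v = (1, 0) ∨ v = (0, 1) →
        torusHexagon L (hexChain c d (6 * R)) ⊆ A →
        torusHexagon L (hexChain (c + v) d (6 * R)) ⊆ A
    · rw [← eq_univ_of_translates hR hc htranslate]
      exact .refl (by linarith)
    · push Not at htranslate
      obtain ⟨c', v, hv, hc', hnot⟩ := htranslate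
      obtain ⟨B, hAB, hB, hjoin, henergy⟩ :=
        exists_joinedBelow_translate (Γ := Γ) hh hJ hR hL hJR hE hv hc' hA
      have hcard : Bᶜ.card < Aᶜ.card := Finset.card_lt_card
        (Finset.compl_ssubset_compl.2 ⟨hAB, fun hBA => hnot (hB.trans hBA)⟩)
      exact hjoin.trans (ih _ hcard hB henergy rfl)

end Covering

section HexChainSides

lemma areaDefect_mem_Icc (i : Fin 6) : areaDefect i ∈ Set.Icc (0 : ℤ) 7 := by
  revert i
  decide

lemma eq_hexChain_of_card {b : Fin 6 → ℤ} (hb : IsQuasiRegular b) {N p : ℕ}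
    (hN : (hexagonFinset b).card = N) (hNp : 6 * N + 7 = p ^ 2) (hp : 7 ≤ p) :
    ∃ c d, b = hexChain c d p := by
  obtain ⟨c, r, i, d, hr, hi, rfl⟩ := hb
  have hchain : quasiHexBounds c r i d = hexChain c d (6 * r + i) :=
    (hexChain_eq c d r ⟨i, by omega⟩).symm
  rw [hchain] at hN ⊢
  have hcard := card_hexChain c d (s := 6 * r + i) (by omega)
  obtain ⟨hdef₀, hdef₇⟩ := areaDefect_mem_Icc (Fin.ofNat 6 (6 * r + i))
  generalize 6 * r + i = s at hN hcard hdef₀ hdef₇ ⊢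
  rw [hN] at hcard
  zify at hNp hp
  have hps : p = s := by
    zify
    apply le_antisymm
    · by_contra! hlt
      nlinarith
    · by_contra! hlt
      nlinarith
  exact ⟨c, d, by rw [hps]⟩

lemma areaDefect_eq_seven {N p : ℕ} (hNp : 6 * N + 7 = p ^ 2) :
    areaDefect (Fin.ofNat 6 p) = 7 := by
  obtain ⟨r, i, rfl⟩ := exists_eq_six_mul_add p
  rw [ofNat_six_mul_add]
  have hsq : (6 * r + (i : ℕ)) ^ 2 = 6 * (6 * r ^ 2 + 2 * r * i) + (i : ℕ) ^ 2 := by ring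
  rw [hsq] at hNp
  generalize 6 * r ^ 2 + 2 * r * i = m at hNp
  -- Only the residues `1` and `5` have a square congruent to `1` modulo `6`.
  fin_cases i <;> first | rfl | (exfalso; revert hNp; norm_num; omega)

lemma pushSide_quasiHexBounds (c : ℤ × ℤ) (r : ℕ) (i d k j : Fin 6) :
    pushSide (quasiHexBounds c r i d) k j =
      sideForm j c + r + ((if (j - d).val < i.val then 1 else 0) + if j = k then 1 else 0) := by
  by_cases hjk : j = k
  · rw [hjk, pushSide, Function.update_self, quasiHexBounds, if_pos rfl]
    ring
  · rw [pushSide, Function.update_of_ne hjk, quasiHexBounds, if_neg hjk]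
    ring

lemma exists_pushSide_hexChain {c : ℤ × ℤ} {d k : Fin 6} {s : ℕ}
    (hs : areaDefect (Fin.ofNat 6 s) = 7) (hk : IsLongestSide (hexChain c d s) k) :
    ∃ d', pushSide (hexChain c d s) k = hexChain c d' (s + 1) := by
  obtain ⟨r, i, rfl⟩ := exists_eq_six_mul_add s
  rw [ofNat_six_mul_add] at hs
  have hindicator : ∀ i : Fin 6, areaDefect i = 7 → ∀ d k : Fin 6,
      (∀ k' : Fin 6, ((if (k' - 1 - d).val < i.val then (1 : ℤ) else 0) +
        (if (k' + 1 - d).val < i.val then 1 else 0) - if (k' - d).val < i.val then 1 else 0) ≤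
        (if (k - 1 - d).val < i.val then 1 else 0) +
        (if (k + 1 - d).val < i.val then 1 else 0) - if (k - d).val < i.val then 1 else 0) →
      ∃ d' : Fin 6, ∀ j : Fin 6, (if (j - d).val < i.val then (1 : ℤ) else 0) +
        (if j = k then 1 else 0) = (if (j - d').val < i.val then (1 : ℤ) else 0) +
        if j = d' + i then 1 else 0 := by decide
  rw [hexChain_eq] at hk ⊢
  obtain ⟨d', hd'⟩ := hindicator i hs d k fun k' => by
    have := hk k'
    rw [sideLength_quasiHexBounds, sideLength_quasiHexBounds] at this
    linarith
  refine ⟨d', funext fun j => ?_⟩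
  rw [hexChain_succ, hexChain_eq, ofNat_six_mul_add, pushSide_quasiHexBounds,
    pushSide_quasiHexBounds, hd']

end HexChainSides

section GrowsInto

/-- The faces `x`, `y`, `z` can be attached to `A` one after the other inside `B`, so that the
third one shares two edges with the cluster and makes its perimeter shrink again. -/
structure GrowsInto {R : Type} [CommRing R] [DecidableEq R] (A B : Finset (Site R))
    (x y z : Site R) : Prop where
  fst_notMem : x ∉ A
  snd_notMem : y ∉ insert x A
  trd_notMem : z ∉ insert y (insert x A)
  fst_contacts : 1 ≤ contacts A x
  snd_contacts : 1 ≤ contacts (insert x A) y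
  trd_contacts : 2 ≤ contacts (insert y (insert x A)) z
  subset : insert z (insert y (insert x A)) ⊆ B

lemma contacts_le_contacts_image {L : ℕ} (P : Finset (Site ℤ)) (x : Site ℤ) :
    contacts P x ≤ contacts (P.image (toTorus L)) (toTorus L x) :=
  Finset.card_le_card fun i hi => by
    simp only [Finset.mem_filter, Finset.mem_univ, true_and] at hi ⊢
    rw [← toTorus_neighbor]
    exact Finset.mem_image_of_mem _ hi

lemma GrowsInto.image {L : ℕ} {A B : Finset (Site ℤ)} {x y z : Site ℤ}
    (hgrow : GrowsInto A B x y z) (hinj : Set.InjOn (toTorus L) (B : Set (Site ℤ))) :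
    GrowsInto (A.image (toTorus L)) (B.image (toTorus L)) (toTorus L x) (toTorus L y)
      (toTorus L z) := by
  have hzB := (Finset.insert_subset_iff.1 hgrow.subset).1
  have hyxA := (Finset.insert_subset_iff.1 hgrow.subset).2
  have hyB := (Finset.insert_subset_iff.1 hyxA).1
  have hxA := (Finset.insert_subset_iff.1 hyxA).2
  have hxB := (Finset.insert_subset_iff.1 hxA).1
  have hA := (Finset.insert_subset_iff.1 hxA).2
  have hnotMem : ∀ {S : Finset (Site ℤ)} {w : Site ℤ}, S ⊆ B → w ∈ B → w ∉ S →
      toTorus L w ∉ S.image (toTorus L) := fun hS hw hwS hmem => by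
    obtain ⟨v, hv, hvw⟩ := Finset.mem_image.1 hmem
    exact hwS (hinj (hS hv) hw hvw ▸ hv)
  constructor
  · exact hnotMem hA hxB hgrow.fst_notMem
  · rw [← Finset.image_insert]
    exact hnotMem hxA hyB hgrow.snd_notMem
  · rw [← Finset.image_insert, ← Finset.image_insert]
    exact hnotMem hyxA hzB hgrow.trd_notMem
  · exact hgrow.fst_contacts.trans (contacts_le_contacts_image _ _)
  · rw [← Finset.image_insert]
    exact hgrow.snd_contacts.trans (contacts_le_contacts_image _ _)
  · rw [← Finset.image_insert, ← Finset.image_insert]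
    exact hgrow.trd_contacts.trans (contacts_le_contacts_image _ _)
  · rw [← Finset.image_insert, ← Finset.image_insert, ← Finset.image_insert]
    exact Finset.image_subset_image hgrow.subset

end GrowsInto

section BarPairs

variable {b : Fin 6 → ℤ} {k : Fin 6} {f : ℤ → Site ℤ} {i₀ i₁ i₂ : Fin 3}

namespace IsBar

lemma growsInto (hf : IsBar b k f i₀ i₁ i₂) {a n q : ℤ}
    (ha : 0 ≤ 2 * a ∧ 2 * a < 2 * sideLength b k - 1)
    (hn : 0 ≤ n ∧ n < 2 * sideLength b k - 1) (hq : 0 ≤ q ∧ q < 2 * sideLength b k - 1)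
    (hna : n ≠ 2 * a) (hqa : q ≠ 2 * a) (hqn : q ≠ n)
    (hsnd : 1 ≤ contacts (insert (f (2 * a)) (hexagonFinset b)) (f n))
    (htrd : 2 ≤ contacts (insert (f n) (insert (f (2 * a)) (hexagonFinset b))) (f q)) :
    GrowsInto (hexagonFinset b) (hexagonFinset (pushSide b k)) (f (2 * a)) (f n) (f q) := by
  have hmem : ∀ m, 0 ≤ m ∧ m < 2 * sideLength b k - 1 → f m ∈ hexagonFinset (pushSide b k) :=
    fun m hm => ((hf.mem _).2 ⟨m, hm.1, hm.2, rfl⟩).1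
  refine ⟨hf.notMem _, ?_, ?_, one_le_contacts i₂ (hf.below a (by omega) (by omega)), hsnd, htrd,
    Finset.insert_subset (hmem q hq) (Finset.insert_subset (hmem n hn)
      (Finset.insert_subset (hmem _ ha) (hexagonFinset_mono (le_pushSide b k))))⟩
  · simp [hf.inj.eq_iff, hna, hf.notMem]
  · simp [hf.inj.eq_iff, hqa, hqn, hf.notMem]

lemma exists_growsInto_of_succ (hf : IsBar b k f i₀ i₁ i₂) {m : ℤ}
    (hm : 0 ≤ m ∧ m + 1 < 2 * sideLength b k - 1) :
    ∃ a y z, (0 ≤ a ∧ a < sideLength b k) ∧ ({f m, f (m + 1)} : Set (Site ℤ)) = {f (2 * a), y} ∧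
      GrowsInto (hexagonFinset b) (hexagonFinset (pushSide b k)) (f (2 * a)) y z := by
  rcases Int.even_or_odd' m with ⟨a, rfl | rfl⟩
  · refine ⟨a, f (2 * a + 1), f (2 * a + 2), by omega, rfl, hf.growsInto (by omega) (by omega)
      (by omega) (by omega) (by omega) (by omega) ?_ ?_⟩
    · exact one_le_contacts i₀ (by rw [hf.neighbor_odd_zero]; simp)
    · have hprev := hf.neighbor_even_one (a + 1)
      have hbelow := hf.below (a + 1) (by omega) (by omega)
      rw [show 2 * (a + 1) - 1 = 2 * a + 1 by ring, show 2 * (a + 1) = 2 * a + 2 by ring] at hprev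
      rw [show 2 * (a + 1) = 2 * a + 2 by ring] at hbelow
      exact two_le_contacts hf.ne₁₂ (by rw [hprev]; simp) (by simp [hbelow])
  · refine ⟨a + 1, f (2 * a + 1), f (2 * a), by omega, ?_, hf.growsInto (by omega) (by omega)
      (by omega) (by omega) (by omega) (by omega) ?_ ?_⟩
    · rw [Set.pair_comm, show 2 * a + 1 + 1 = 2 * (a + 1) by ring]
    · refine one_le_contacts i₁ ?_
      rw [hf.neighbor_odd_one, show 2 * (a + 1) = 2 * a + 2 by ring]
      simp
    · have hbelow := hf.below a (by omega) (by omega)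
      exact two_le_contacts hf.ne₀₂ (by rw [hf.neighbor_even_zero]; simp) (by simp [hbelow])

lemma exists_growsInto_of_even (hf : IsBar b k f i₀ i₁ i₂) {a : ℤ}
    (ha : 0 ≤ a ∧ a + 1 < sideLength b k) :
    ∃ z, GrowsInto (hexagonFinset b) (hexagonFinset (pushSide b k)) (f (2 * a))
      (f (2 * (a + 1))) z := by
  refine ⟨f (2 * a + 1), hf.growsInto (by omega) (by omega) (by omega) (by omega) (by omega)
    (by omega) ?_ ?_⟩
  · exact one_le_contacts i₂ (by simp [hf.below (a + 1) (by omega) (by omega)])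
  · refine two_le_contacts hf.ne₀₁ (by rw [hf.neighbor_odd_zero]; simp) ?_
    rw [hf.neighbor_odd_one, show 2 * (a + 1) = 2 * a + 2 by ring]
    simp

lemma eq_add_one_of_adj (hf : IsBar b k f i₀ i₁ i₂) {m m' : ℤ}
    (hm : 0 ≤ m ∧ m < 2 * sideLength b k - 1) (hm' : 0 ≤ m' ∧ m' < 2 * sideLength b k - 1)
    (hadj : (hexLattice ℤ).Adj (f m) (f m')) : m' = m + 1 ∨ m = m' + 1 := by
  obtain ⟨i, hi⟩ := (hexLattice_adj_iff _ _).1 hadj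
  rcases Int.even_or_odd' m with ⟨a, rfl | rfl⟩
  · rcases hf.index_cases i with rfl | rfl | rfl
    · rw [hf.neighbor_even_zero, hf.inj.eq_iff] at hi
      omega
    · rw [hf.neighbor_even_one, hf.inj.eq_iff] at hi
      omega
    · exact absurd (hi ▸ hf.below a (by omega) (by omega)) (hf.notMem m')
  · rcases hf.index_cases i with rfl | rfl | rfl
    · rw [hf.neighbor_odd_zero, hf.inj.eq_iff] at hi
      omega
    · rw [hf.neighbor_odd_one, hf.inj.eq_iff] at hi
      omega
    · exact absurd (hi ▸ ((hf.mem (f m')).2 ⟨m', hm'.1, hm'.2, rfl⟩).1) (hf.above a)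

lemma neighbor_even_cases (hf : IsBar b k f i₀ i₁ i₂) {a : ℤ} (ha : 0 ≤ a ∧ a < sideLength b k)
    (i : Fin 3) : neighbor (f (2 * a)) i = f (2 * a + 1) ∨
      neighbor (f (2 * a)) i = f (2 * a - 1) ∨
      i = i₂ ∧ neighbor (f (2 * a)) i ∈ hexagonFinset b := by
  rcases hf.index_cases i with rfl | rfl | rfl
  · exact .inl (hf.neighbor_even_zero a)
  · exact .inr (.inl (hf.neighbor_even_one a))
  · exact .inr (.inr ⟨rfl, hf.below a ha.1 ha.2⟩)

end IsBar

lemma exists_neighbor_eq_neighbor_of_dist_eq_two {x y : Site ℤ}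
    (hdist : (hexLattice ℤ).dist x y = 2) : ∃ i j, neighbor x i = neighbor y j := by
  have hreach : (hexLattice ℤ).Reachable x y := by
    by_contra hnot
    rw [SimpleGraph.dist_eq_zero_of_not_reachable hnot] at hdist
    omega
  obtain ⟨ω, hω⟩ := hreach.exists_walk_length_eq_dist
  rw [hdist] at hω
  rcases ω with _ | ⟨hxu, _ | ⟨huy, _ | ⟨_, _⟩⟩⟩
  · simp at hω
  · simp at hω
  · obtain ⟨i, rfl⟩ := (hexLattice_adj_iff _ _).1 hxu
    obtain ⟨j, hj⟩ := (hexLattice_adj_iff _ _).1 huy.symm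
    exact ⟨i, j, hj⟩
  · simp at hω

lemma IsBar.eq_add_one_of_dist (hf : IsBar b k f i₀ i₁ i₂) {a a' : ℤ}
    (ha : 0 ≤ a ∧ a < sideLength b k) (ha' : 0 ≤ a' ∧ a' < sideLength b k)
    (hdist : (hexLattice ℤ).dist (f (2 * a)) (f (2 * a')) = 2) : a' = a + 1 ∨ a = a' + 1 := by
  have hne : a ≠ a' := by
    rintro rfl
    simp at hdist
  obtain ⟨i, j, hij⟩ := exists_neighbor_eq_neighbor_of_dist_eq_two hdist
  rcases hf.neighbor_even_cases ha i with hi | hi | ⟨rfl, hi⟩ <;>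
    rcases hf.neighbor_even_cases ha' j with hj | hj | ⟨rfl, hj⟩
  any_goals rw [hi, hj, hf.inj.eq_iff] at hij; omega
  any_goals rw [← hij, hi] at hj; exact absurd hj (hf.notMem _)
  any_goals rw [hij, hj] at hi; exact absurd hi (hf.notMem _)
  rw [neighbor_eq_iff, neighbor_neighbor, hf.inj.eq_iff] at hij
  omega

/-- A pair of faces as in the two kinds of configurations of the gate: they form an elementary
rhombus, or they are attached to the hexagon at distance two. -/
def IsGatePair (b : Fin 6 → ℤ) (f g : Site ℤ) : Prop :=
  (hexLattice ℤ).Adj f g ∨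
    IsAttachedTo f (hexagon b) ∧ IsAttachedTo g (hexagon b) ∧ (hexLattice ℤ).dist f g = 2

lemma IsBar.exists_growsInto (hf : IsBar b k f i₀ i₁ i₂) {x y : Site ℤ} (hx : x ∈ sideBar b k)
    (hy : y ∈ sideBar b k) (hxy : IsGatePair b x y) :
    ∃ a v w, (0 ≤ a ∧ a < sideLength b k) ∧ ({x, y} : Set (Site ℤ)) = {f (2 * a), v} ∧
      GrowsInto (hexagonFinset b) (hexagonFinset (pushSide b k)) (f (2 * a)) v w := by
  rw [sideBar_eq] at hx hy
  obtain ⟨m, hm₀, hm, rfl⟩ := (hf.mem x).1 hx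
  obtain ⟨m', hm₀', hm', rfl⟩ := (hf.mem y).1 hy
  rcases hxy with hadj | ⟨hattx, hatty, hdist⟩
  · rcases hf.eq_add_one_of_adj ⟨hm₀, hm⟩ ⟨hm₀', hm'⟩ hadj with rfl | rfl
    · exact hf.exists_growsInto_of_succ ⟨hm₀, hm'⟩
    · rw [Set.pair_comm]
      exact hf.exists_growsInto_of_succ ⟨hm₀', hm⟩
  · have heven : ∀ m, IsAttachedTo (f m) (hexagon b) → ∃ a, m = 2 * a := by
      rintro m ⟨e, he, hadj⟩
      obtain ⟨i, rfl⟩ := (hexLattice_adj_iff _ _).1 hadj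
      rw [← coe_hexagonFinset, Finset.mem_coe] at he
      exact hf.even_of_contacts (one_le_contacts i he)
    obtain ⟨a, rfl⟩ := heven m hattx
    obtain ⟨a', rfl⟩ := heven m' hatty
    rcases hf.eq_add_one_of_dist (by omega) (by omega) hdist with rfl | rfl
    · obtain ⟨w, hgrow⟩ := hf.exists_growsInto_of_even (a := a) (by omega)
      exact ⟨a, _, w, by omega, rfl, hgrow⟩
    · obtain ⟨w, hgrow⟩ := hf.exists_growsInto_of_even (a := a') (by omega)
      exact ⟨a', _, w, by omega, Set.pair_comm _ _, hgrow⟩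

lemma card_hexagonFinset_of_ncard {A : ℕ} {x y : Site ℤ} (hx : x ∈ sideBar b k)
    (hy : y ∈ sideBar b k) (hxy : x ≠ y) (hcard : (hexagon b ∪ {x, y}).ncard = A + 2) :
    (hexagonFinset b).card = A := by
  rw [sideBar_eq] at hx hy
  have hcoe : hexagon b ∪ {x, y} =
      ((insert x (insert y (hexagonFinset b)) : Finset (Site ℤ)) : Set (Site ℤ)) := by
    rw [← coe_hexagonFinset]
    push_cast
    rw [Set.union_comm, Set.insert_union, Set.singleton_union]
  rw [hcoe, Set.ncard_coe_finset, Finset.card_insert_of_notMem, Finset.card_insert_of_notMem hy.2]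
    at hcard
  · omega
  · simp [hxy, hx.2]

lemma exists_isGatePair_of_mem_gateConfigs {L A : ℕ} [NeZero L] {η : Config L}
    (hη : η ∈ gateConfigs L (A + 2)) :
    ∃ b k x y, IsQuasiRegular b ∧ IsLongestSide b k ∧ x ∈ sideBar b k ∧ y ∈ sideBar b k ∧
      IsGatePair b x y ∧ (hexagonFinset b).card = A ∧
      (plusFinset η : Set (Site (ZMod L))) = toTorus L '' (hexagonFinset b ∪ {x, y}) := by
  rcases hη with ⟨P, ⟨b, k, x, y, hb, hk, hx, hy, hxy, rfl⟩, hcard, -, hP⟩ |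
    ⟨P, ⟨b, k, x, y, hb, hk, hx, hy, hattx, hatty, hdist, rfl⟩, hcard, -, hP⟩
  · exact ⟨b, k, x, y, hb, hk, hx, hy, .inl hxy,
      card_hexagonFinset_of_ncard hx hy hxy.ne hcard, by rw [coe_plusFinset, hP, coe_hexagonFinset]⟩
  · refine ⟨b, k, x, y, hb, hk, hx, hy, .inr ⟨hattx, hatty, hdist⟩,
      card_hexagonFinset_of_ncard hx hy ?_ hcard, by rw [coe_plusFinset, hP, coe_hexagonFinset]⟩
    rintro rfl
    simp at hdist

end BarPairs

section GrowthEnergy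

variable {L N p : ℕ} {J h Γ : ℝ}

lemma energy_le_of_bounds (hJ : 0 ≤ J) {A : Finset (Site (ZMod L))} {q n : ℕ}
    (hp : perimeter A ≤ q) (hn : A.card = n) : energy J h A ≤ J * q - h * n := by
  rw [energy, hn]
  gcongr

lemma JoinedBelow.energy_right_lt [NeZero L] {A B : Finset (Site (ZMod L))}
    (hAB : JoinedBelow J h Γ A B) : energy J h B < Γ := by
  obtain ⟨ω, hω⟩ := hAB
  simpa only [plusFinset_configOf] using hω _ ω.end_mem_support

lemma GrowsInto.energy_le {A B : Finset (Site (ZMod L))} {x y z : Site (ZMod L)}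
    (hgrow : GrowsInto A B x y z) (hJ : 0 ≤ J) (hp : perimeter A ≤ p) (hN : A.card = N) :
    energy J h (insert x A) ≤ J * (p + 1) - h * (N + 1) ∧
      energy J h (insert y (insert x A)) ≤ J * (p + 2) - h * (N + 2) ∧
      energy J h (insert z (insert y (insert x A))) ≤ J * (p + 1) - h * (N + 3) ∧
      perimeter (insert z (insert y (insert x A))) ≤ p + 1 := by
  have hpx := perimeter_insert_le_of_one hgrow.fst_notMem hgrow.fst_contacts
  have hpy := perimeter_insert_le_of_one hgrow.snd_notMem hgrow.snd_contacts
  have hpz := perimeter_insert_le_of_two hgrow.trd_notMem hgrow.trd_contacts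
  have hcx := Finset.card_insert_of_notMem hgrow.fst_notMem
  have hcy := Finset.card_insert_of_notMem hgrow.snd_notMem
  have hcz := Finset.card_insert_of_notMem hgrow.trd_notMem
  refine ⟨?_, ?_, ?_, by omega⟩
  · exact_mod_cast energy_le_of_bounds (q := p + 1) (n := N + 1) hJ (by omega) (by omega)
  · exact_mod_cast energy_le_of_bounds (q := p + 2) (n := N + 2) hJ (by omega) (by omega)
  · exact_mod_cast energy_le_of_bounds (q := p + 1) (n := N + 3) hJ (by omega) (by omega)

variable [NeZero L]

lemma IsBar.fillsBelow_pushSide {b : Fin 6 → ℤ} {k : Fin 6} {f : ℤ → Site ℤ} {i₀ i₁ i₂ : Fin 3}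
    (hf : IsBar b k f i₀ i₁ i₂) (hh : 0 ≤ h) (hJ : h ≤ J) {a : ℤ}
    (ha : 0 ≤ a ∧ a < sideLength b k) {A : Finset (Site (ZMod L))} (hbA : torusHexagon L b ⊆ A)
    (hAb : A ⊆ torusHexagon L (pushSide b k)) (haA : toTorus L (f (2 * a)) ∈ A)
    (hA : energy J h A + J - h < Γ) : FillsBelow J h Γ A (torusHexagon L (pushSide b k)) := by
  obtain ⟨l, hl⟩ := Int.eq_ofNat_of_zero_le (by omega : 0 ≤ sideLength b k - 1)
  lift a to ℕ using ha.1
  have hfill := hf.isRow.fillsBelow_of_even_mem hh hJ (n := l) (a := a)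
    (hf.neighbor_mem (by omega) hbA) (by omega) haA hA
  rwa [show A ∪ (Finset.Icc 0 (2 * l : ℤ)).image (fun m => toTorus L (f m)) =
    torusHexagon L (pushSide b k) from ?_] at hfill
  rw [hf.torusHexagon_pushSide (n := l) (by omega)] at hAb ⊢
  exact Finset.Subset.antisymm (Finset.union_subset hAb Finset.subset_union_right)
    (Finset.union_subset_union_left hbA)

lemma exists_path_through {A B C : Finset (Site (ZMod L))} {y z : Site (ZMod L)} (hy : y ∉ A)
    (hz : z ∉ insert y A) (hBA : JoinedBelow J h Γ B A)
    (hAC : JoinedBelow J h Γ (insert z (insert y A)) C) :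
    ∃ ω : Path (configOf B) (configOf C), configOf (insert y A) ∈ ω.support ∧
      ∀ ζ ∈ ω.support, ζ = configOf (insert y A) ∨ energy J h (plusFinset ζ) < Γ := by
  obtain ⟨ω, hω⟩ := hBA
  obtain ⟨ω', hω'⟩ := hAC
  refine ⟨ω.append (.cons (adj_configOf_insert hy) (.cons (adj_configOf_insert hz) ω')), ?_,
    fun ζ hζ => ?_⟩
  · rw [SimpleGraph.Walk.mem_support_append_iff]
    simp
  · rw [SimpleGraph.Walk.mem_support_append_iff] at hζ
    simp only [SimpleGraph.Walk.support_cons, List.mem_cons] at hζ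
    rcases hζ with hζ | rfl | rfl | hζ
    · exact .inr (hω _ hζ)
    · exact .inr (hω _ (SimpleGraph.Walk.end_mem_support _))
    · exact .inl rfl
    · exact .inr (hω' _ hζ)

end GrowthEnergy

section Barrier

/-- Among the quasi-regular hexagons of perimeter at most `6 R`, those of perimeter `p`, whose area
is `N`, have the highest energy, and further growth beyond perimeter `6 R` is favorable. -/
structure EnergyBarrier (L : ℕ) (J h : ℝ) (N p R : ℕ) : Prop where
  pos : 0 < h
  lt : h < J
  width : 2 * R + 2 ≤ L
  area_eq : 6 * N + 7 = p ^ 2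
  seven_le : 7 ≤ p
  lt_mul : p + 1 ≤ 6 * R
  le_mul : J ≤ (2 * R - 1) * h
  start : 7 * J - 5 * h < J * (p + 2) - h * (N + 2)
  peak : ∀ s, 6 ≤ s → s ≤ 6 * R → s ≠ p →
    chainEnergy J h s + 2 * J - 2 * h < J * (p + 2) - h * (N + 2)

@[simp] lemma configOf_empty (L : ℕ) : configOf (∅ : Finset (Site (ZMod L))) = allMinus L := by
  funext s
  simp [configOf, allMinus]

@[simp] lemma configOf_univ (L : ℕ) [NeZero L] :
    configOf (Finset.univ : Finset (Site (ZMod L))) = allPlus L := by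
  funext s
  simp [configOf, allPlus]

namespace EnergyBarrier

variable {L N p R : ℕ} {J h : ℝ}

lemma chainEnergy_le (hB : EnergyBarrier L J h N p R) :
    chainEnergy J h p + 2 * J - 2 * h ≤ J * (p + 2) - h * (N + 2) := by
  have harea : (6 : ℝ) * N + 7 = (p : ℝ) ^ 2 := by exact_mod_cast hB.area_eq
  rw [chainEnergy, areaDefect_eq_seven hB.area_eq, ← harea]
  push_cast
  linarith

variable [NeZero L]

lemma joinedBelow_empty_hexChain (hB : EnergyBarrier L J h N p R) (c : ℤ × ℤ) (d : Fin 6) :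
    JoinedBelow J h (J * (p + 2) - h * (N + 2)) ∅ (torusHexagon L (hexChain c d p)) ∧
      perimeter (torusHexagon L (hexChain c d p)) ≤ p := by
  have hp := hB.seven_le
  have hpR := hB.lt_mul
  have hRL := hB.width
  have hpeak := hB.peak 6 le_rfl (by omega) (by omega)
  have hlt := hB.lt
  obtain ⟨hjoin, hper⟩ :=
    joinedBelow_hexChain_six (L := L) hB.pos.le hlt.le (by omega) hB.start c d
  obtain ⟨hjoin', hper'⟩ := joinedBelow_hexChain (L := L) hB.pos.le hlt.le (s := 6) (t := p)
    le_rfl (by omega) (by omega) hper (by linarith)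
    (fun u hu hup => hB.peak u hu (by omega) (by omega))
  exact ⟨hjoin.trans hjoin', hper'⟩

lemma joinedBelow_hexChain_univ (hB : EnergyBarrier L J h N p R) (c : ℤ × ℤ) (d : Fin 6)
    (hper : perimeter (torusHexagon L (hexChain c d (p + 1))) ≤ p + 1) :
    JoinedBelow J h (J * (p + 2) - h * (N + 2)) (torusHexagon L (hexChain c d (p + 1)))
      Finset.univ := by
  have hp := hB.seven_le
  have hpR := hB.lt_mul
  have hRL := hB.width
  have hpeak := hB.peak (p + 1) (by omega) (by omega) (by omega)
  have hlt := hB.lt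
  obtain ⟨hjoin, hper'⟩ := joinedBelow_hexChain (L := L) hB.pos.le hlt.le (s := p + 1)
    (t := 6 * R) (by omega) hpR (by omega) hper (by linarith)
    (fun u hu hup => hB.peak u (by omega) (by omega) (by omega))
  exact hjoin.trans (joinedBelow_univ hB.pos.le hlt.le (by omega) hRL hB.le_mul
    (hB.peak (6 * R) (by omega) le_rfl (by omega)) Finset.Subset.rfl
    (energy_hexChain_le (hB.pos.trans hlt).le (by omega) (by omega) hper'))

lemma exists_path (hB : EnergyBarrier L J h N p R) {η : Config L}
    (hη : η ∈ gateConfigs L (N + 2)) :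
    ∃ ω : Path (allMinus L) (allPlus L), η ∈ ω.support ∧
      (∀ ζ ∈ ω.support, ζ = η ∨ energy J h (plusFinset ζ) < J * (p + 2) - h * (N + 2)) ∧
      energy J h (plusFinset η) ≤ J * (p + 2) - h * (N + 2) := by
  have hh := hB.pos
  have hlt := hB.lt
  have hJ₀ := (hh.trans hlt).le
  have hRL := hB.width
  have hpR := hB.lt_mul
  have hp₇ := hB.seven_le
  obtain ⟨b, k, v, w, hb, hk, hv, hw, hvw, hcard, hplus⟩ := exists_isGatePair_of_mem_gateConfigs hη
  obtain ⟨c, d, rfl⟩ := eq_hexChain_of_card hb hcard hB.area_eq hp₇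
  obtain ⟨d', hd'⟩ := exists_pushSide_hexChain (areaDefect_eq_seven hB.area_eq) hk
  obtain ⟨f, i₀, i₁, i₂, hf⟩ := exists_isBar k _ (sideLength_hexChain_nonneg c d (by omega))
    (nonempty_hexChain c d (s := p) (by omega))
  obtain ⟨a, y, z, ha, hpair, hplanar⟩ := hf.exists_growsInto hv hw hvw
  have hgrow := hplanar.image (L := L) (by rw [hd']; exact injOn_hexChain c d' (by omega))
  change GrowsInto (torusHexagon L _) (torusHexagon L _) _ _ _ at hgrow
  obtain ⟨hjoin, hper⟩ := hB.joinedBelow_empty_hexChain c d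
  obtain ⟨hfst, hsnd, htrd, hper₃⟩ := hgrow.energy_le (h := h) hJ₀ hper
    ((card_torusHexagon_hexChain c d (by omega)).trans hcard)
  have hη' : η = configOf (insert (toTorus L y) (insert (toTorus L (f (2 * a)))
      (torusHexagon L (hexChain c d p)))) := by
    rw [← configOf_plusFinset η]
    congr 1
    rw [← Finset.coe_inj, hplus, hpair]
    push_cast [torusHexagon]
    rw [Set.image_union, Set.image_pair, Set.union_comm, Set.insert_union, Set.singleton_union,
      Set.insert_comm]
  have hfill := hf.fillsBelow_pushSide (Γ := J * (p + 2) - h * (N + 2)) hh.le hlt.le ha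
    (((Finset.subset_insert _ _).trans (Finset.subset_insert _ _)).trans
      (Finset.subset_insert _ _)) hgrow.subset (by simp) (by linarith)
  rw [hd'] at hfill
  obtain ⟨ω, hηω, hω⟩ := exists_path_through hgrow.snd_notMem hgrow.trd_notMem
    (hjoin.trans (.insert hjoin.energy_right_lt (by linarith)))
    (hfill.joinedBelow.trans (hB.joinedBelow_hexChain_univ c d' (hfill.perimeter_le.trans hper₃)))
  rw [← configOf_empty, ← configOf_univ, hη', plusFinset_configOf]
  exact ⟨ω, hηω, hω, hsnd⟩

lemma joinedBelow_of_lt (hB : EnergyBarrier L J h N p R) {Γ : ℝ}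
    (hΓ : J * (p + 2) - h * (N + 2) < Γ) :
    JoinedBelow J h Γ ∅ (Finset.univ : Finset (Site (ZMod L))) := by
  have hh := hB.pos
  have hlt := hB.lt
  have hp := hB.seven_le
  have hpR := hB.lt_mul
  have hRL := hB.width
  have hpeak : ∀ s, 6 ≤ s → s ≤ 6 * R → chainEnergy J h s + 2 * J - 2 * h < Γ := by
    intro s hs hsR
    rcases eq_or_ne s p with rfl | hsp
    · exact hB.chainEnergy_le.trans_lt hΓ
    · exact (hB.peak s hs hsR hsp).trans hΓ
  have hpeak₆ := hpeak 6 le_rfl (by omega)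
  obtain ⟨hjoin, hper⟩ :=
    joinedBelow_hexChain_six (L := L) hh.le hlt.le (by omega) (hB.start.trans hΓ) 0 0
  obtain ⟨hjoin', hper'⟩ := joinedBelow_hexChain (L := L) hh.le hlt.le (s := 6) (t := 6 * R)
    le_rfl (by omega) (by omega) hper (by linarith) (fun u hu hup => hpeak u hu hup.le)
  exact (hjoin.trans hjoin').trans (joinedBelow_univ hh.le hlt.le (by omega) hRL hB.le_mul
    (hpeak (6 * R) (by omega) le_rfl) Finset.Subset.rfl
    (energy_hexChain_le (hh.trans hlt).le (by omega) (by omega) hper'))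

end EnergyBarrier

end Barrier

section Gates

variable {L : ℕ} [NeZero L] {J h : ℝ} {σ η ζ : Config L} {V W : Set (Config L)}

lemma height_le_iff {σ η : Config L} {ω : Path σ η} {c : ℝ} :
    height J h ω ≤ c ↔ ∀ ζ ∈ ω.support, hamiltonian J h ζ ≤ c :=
  (Finset.sup'_le_iff _ _).trans (by simp)

lemma height_lt_iff {σ η : Config L} {ω : Path σ η} {c : ℝ} :
    height J h ω < c ↔ ∀ ζ ∈ ω.support, hamiltonian J h ζ < c :=
  (Finset.sup'_lt_iff _).trans (by simp)

/-- An essential saddle: a minimal saddle at which some optimal path attains its maximal energy,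
and this path does so nowhere else. -/
def IsEssentialSaddle (J h : ℝ) (σ η ζ : Config L) : Prop :=
  hamiltonian J h ζ = commHeight J h σ η ∧ ∃ ω : Path σ η, ζ ∈ ω.support ∧
    ∀ ξ ∈ ω.support, ξ = ζ ∨ hamiltonian J h ξ < commHeight J h σ η

lemma IsEssentialSaddle.exists_isOptimal (hζ : IsEssentialSaddle J h σ η ζ) :
    ∃ ω : Path σ η, IsOptimal J h ω ∧ ζ ∈ ω.support ∧
      ∀ ξ ∈ ω.support, ξ = ζ ∨ hamiltonian J h ξ < commHeight J h σ η := by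
  obtain ⟨heq, ω, hζω, hω⟩ := hζ
  refine ⟨ω, le_antisymm (height_le_iff.2 fun ξ hξ => ?_)
    ((commHeight_isLeast J h σ η).2 ⟨ω, rfl⟩), hζω, hω⟩
  rcases hω ξ hξ with rfl | hlt
  · exact heq.le
  · exact hlt.le

lemma IsEssentialSaddle.mem_saddles (hζ : IsEssentialSaddle J h σ η ζ) : ζ ∈ saddles J h σ η := by
  obtain ⟨ω, hopt, hζω, -⟩ := hζ.exists_isOptimal
  exact ⟨ω, hζω, hopt.trans hζ.1.symm, hζ.1⟩

lemma IsEssentialSaddle.mem_of_isGate (hζ : IsEssentialSaddle J h σ η ζ)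
    (hV : IsGate J h σ η V) : ζ ∈ V := by
  obtain ⟨ω, hopt, -, hω⟩ := hζ.exists_isOptimal
  obtain ⟨ξ, hξω, hξV⟩ := hV.2 ω hopt
  rcases hω ξ hξω with rfl | hlt
  · exact hξV
  · obtain ⟨-, -, -, heq⟩ := hV.1 hξV
    exact absurd heq hlt.ne

lemma minimalGatesUnion_eq_of_isEssentialSaddle
    (hmeet : ∀ ω : Path σ η, IsOptimal J h ω → ∃ ζ ∈ ω.support, ζ ∈ W)
    (hW : ∀ ζ ∈ W, IsEssentialSaddle J h σ η ζ) : minimalGatesUnion J h σ η = W := by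
  have hgate : IsGate J h σ η W := ⟨fun ζ hζ => (hW ζ hζ).mem_saddles, hmeet⟩
  have hsub : ∀ V, IsGate J h σ η V → W ⊆ V := fun V hV ζ hζ => (hW ζ hζ).mem_of_isGate hV
  have hmin : IsMinimalGate J h σ η W := by
    refine ⟨hgate, fun V hV => ?_⟩
    by_contra! hcon
    exact hV.2 (hsub V ⟨hV.1.trans hgate.1, hcon⟩)
  refine Set.Subset.antisymm (Set.sUnion_subset fun V hV => ?_) (Set.subset_sUnion_of_mem hmin)
  by_contra hne
  obtain ⟨ω, hopt, hω⟩ := hV.2 W ⟨hsub V hV.1, hne⟩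
  obtain ⟨ζ, hζω, hζ⟩ := hmeet ω hopt
  exact hω ζ hζω hζ

end Gates

section CriticalGate

variable {L N p M R : ℕ} {J h : ℝ}

lemma HasCluster.card_plusFinset [NeZero L] {σ : Config L} {P : Set (Site ℤ)}
    (hσ : HasCluster σ P) : (plusFinset σ).card = P.ncard := by
  rw [← Set.ncard_coe_finset, coe_plusFinset, hσ.2, hσ.1.ncard_image]

lemma card_plusFinset_of_mem_gateConfigs [NeZero L] {A : ℕ} {η : Config L}
    (hη : η ∈ gateConfigs L A) : (plusFinset η).card = A := by
  rcases hη with ⟨P, -, rfl, hη⟩ | ⟨P, -, rfl, hη⟩ <;> exact hη.card_plusFinset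

lemma card_site (L : ℕ) [NeZero L] : Fintype.card (Site (ZMod L)) = 2 * L ^ 2 := by
  rw [Fintype.card_prod, Fintype.card_prod, ZMod.card, Fintype.card_bool]
  ring

namespace CriticalSizes

variable [NeZero L]

lemma le_energy (hc : CriticalSizes L N p M) (hJ : 0 ≤ J) {η : Config L}
    (hη : η ∈ gateConfigs L (N + 2)) :
    J * (p + 2) - h * (N + 2) ≤ energy J h (plusFinset η) := by
  have hcard := card_plusFinset_of_mem_gateConfigs hη
  have hper : (p : ℝ) + 2 ≤ perimeter (plusFinset η) := by
    exact_mod_cast hc.add_two_le_perimeter hcard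
  rw [energy, hcard]
  push_cast
  gcongr

lemma exists_mem_gateConfigs_of_energy_le (hc : CriticalSizes L N p M) (hh : 0 < h) (hJ : 0 < J)
    (hM : M * h < J + (N + 2) * h) (ω : Path (allMinus L) (allPlus L))
    (hω : ∀ ζ ∈ ω.support, energy J h (plusFinset ζ) ≤ J * (p + 2) - h * (N + 2)) :
    ∃ ζ ∈ ω.support, ζ ∈ gateConfigs L (N + 2) := by
  have hcard : (Finset.univ : Finset (Site (ZMod L))).card = 2 * L ^ 2 := by
    rw [Finset.card_univ, card_site]
  have hcut := hc.cut
  have hle := hc.le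
  refine hc.exists_mem_gateConfigs _ ω le_rfl
    (fun ζ hζ => admissible_of_energy_le hh hJ hM (hω ζ hζ)) (by simp) ?_ ?_ ?_
  · rw [plusFinset_allPlus, hcard]
    omega
  · rw [plusFinset_allMinus]
    exact ⟨by simp; omega, .inl (by simp)⟩
  · rw [plusFinset_allPlus]
    rintro ⟨hsub, -⟩
    rw [hcard] at hsub
    have := Nat.zero_le (L * (p + 2))
    omega

lemma commHeight_eq (hc : CriticalSizes L N p M) (hB : EnergyBarrier L J h N p R)
    (hM : M * h < J + (N + 2) * h) :
    commHeight J h (allMinus L) (allPlus L) =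
      hamiltonian J h (allMinus L) + (J * (p + 2) - h * (N + 2)) := by
  have hJ := hB.pos.trans hB.lt
  have hleast := commHeight_isLeast J h (allMinus L) (allPlus L)
  apply le_antisymm
  · refine le_of_forall_gt_imp_ge_of_dense fun c hc' => ?_
    have hjoin := hB.joinedBelow_of_lt (Γ := c - hamiltonian J h (allMinus L)) (by linarith)
    rw [JoinedBelow, configOf_empty, configOf_univ] at hjoin
    obtain ⟨ω, hω⟩ := hjoin
    refine (hleast.2 ⟨ω, rfl⟩).trans (height_le_iff.2 fun ζ hζ => ?_)
    rw [hamiltonian_eq hc.two_le]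
    linarith [hω ζ hζ]
  · obtain ⟨ω, hω⟩ := hleast.1
    by_contra! hlt
    have henergy : ∀ ζ ∈ ω.support, energy J h (plusFinset ζ) < J * (p + 2) - h * (N + 2) := by
      intro ζ hζ
      have := height_lt_iff.1 (hω.trans_lt hlt) ζ hζ
      rw [hamiltonian_eq hc.two_le] at this
      linarith
    obtain ⟨ζ, hζω, hζ⟩ := hc.exists_mem_gateConfigs_of_energy_le hB.pos hJ hM ω
      fun ζ hζ => (henergy ζ hζ).le
    exact (henergy ζ hζω).not_ge (hc.le_energy hJ.le hζ)

lemma exists_mem_gateConfigs_of_isOptimal (hc : CriticalSizes L N p M)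
    (hB : EnergyBarrier L J h N p R) (hM : M * h < J + (N + 2) * h)
    {ω : Path (allMinus L) (allPlus L)} (hω : IsOptimal J h ω) :
    ∃ ζ ∈ ω.support, ζ ∈ gateConfigs L (N + 2) := by
  refine hc.exists_mem_gateConfigs_of_energy_le hB.pos (hB.pos.trans hB.lt) hM ω fun ζ hζ => ?_
  have hle := height_le_iff.1 (hω.trans (hc.commHeight_eq hB hM)).le ζ hζ
  rw [hamiltonian_eq hc.two_le] at hle
  linarith

lemma isEssentialSaddle_of_mem_gateConfigs (hc : CriticalSizes L N p M)
    (hB : EnergyBarrier L J h N p R) (hM : M * h < J + (N + 2) * h) {η : Config L}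
    (hη : η ∈ gateConfigs L (N + 2)) :
    IsEssentialSaddle J h (allMinus L) (allPlus L) η := by
  obtain ⟨ω, hηω, hω, hle⟩ := hB.exists_path hη
  have heq := hle.antisymm (hc.le_energy (hB.pos.trans hB.lt).le hη)
  rw [IsEssentialSaddle, hc.commHeight_eq hB hM]
  refine ⟨by rw [hamiltonian_eq hc.two_le, heq], ω, hηω, fun ξ hξ => (hω ξ hξ).imp_right ?_⟩
  intro hlt
  rw [hamiltonian_eq hc.two_le]
  linarith

lemma minimalGatesUnion_eq (hc : CriticalSizes L N p M) (hB : EnergyBarrier L J h N p R)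
    (hM : M * h < J + (N + 2) * h) :
    minimalGatesUnion J h (allMinus L) (allPlus L) = gateConfigs L (N + 2) :=
  minimalGatesUnion_eq_of_isEssentialSaddle
    (fun _ => hc.exists_mem_gateConfigs_of_isOptimal hB hM)
    (fun _ => hc.isEssentialSaddle_of_mem_gateConfigs hB hM)

end CriticalSizes

end CriticalGate

section Constants

variable {L N p : ℕ} {J h : ℝ}

lemma chainEnergy_lt_of_pos {s : ℕ} (hNp : 6 * N + 7 = p ^ 2)
    (hpos : 0 < ((p : ℝ) - s) * (6 * J - h * (p + s)) + h * (7 - areaDefect (Fin.ofNat 6 s))) :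
    chainEnergy J h s + 2 * J - 2 * h < J * (p + 2) - h * (N + 2) := by
  have hsq : h * (p : ℝ) ^ 2 = h * (6 * N + 7) := by
    congr 1
    exact_mod_cast hNp.symm
  rw [chainEnergy]
  linarith

lemma chainEnergy_lt_of_mul_pos {s : ℕ} (hh : 0 ≤ h) (hNp : 6 * N + 7 = p ^ 2)
    (hpos : 0 < ((p : ℝ) - s) * (6 * J - h * (p + s))) :
    chainEnergy J h s + 2 * J - 2 * h < J * (p + 2) - h * (N + 2) := by
  have hdefect : (areaDefect (Fin.ofNat 6 s) : ℝ) ≤ 7 := by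
    exact_mod_cast (areaDefect_mem_Icc _).2
  exact chainEnergy_lt_of_pos hNp
    (add_pos_of_pos_of_nonneg hpos (mul_nonneg hh (sub_nonneg.2 hdefect)))

lemma criticalSizes_six_mul_add_five {r : ℕ} (hr : 1 ≤ r) (hL : 8 * (2 * r + 1) ^ 2 < L ^ 2) :
    CriticalSizes L (6 * r ^ 2 + 10 * r + 3) (6 * r + 5) (6 * r ^ 2 + 12 * r + 6) := by
  have hrL : 11 * r + 6 ≤ 2 * L := by
    by_contra! h
    nlinarith
  refine ⟨by ring, by omega, by nlinarith, by omega, by omega, by omega, ?_, by omega⟩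
  zify at *
  nlinarith

lemma criticalSizes_six_mul_add_seven {r : ℕ} (hL : 8 * (2 * r + 2) ^ 2 < L ^ 2) :
    CriticalSizes L (6 * r ^ 2 + 14 * r + 7) (6 * r + 7) (6 * r ^ 2 + 16 * r + 10) := by
  have hrL : 11 * r + 12 ≤ 2 * L := by
    by_contra! h
    nlinarith
  refine ⟨by ring, by omega, by nlinarith, by omega, by omega, by omega, ?_, by omega⟩
  zify at *
  nlinarith

lemma chainEnergy_lt_six_mul_add_five {r s : ℕ} (hNp : 6 * N + 7 = (6 * r + 5) ^ 2) (hh : 0 < h)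
    (hJ : (2 * r + 1) * h < J) (hJ' : J < (2 * r + 2) * h) (hs : s ≠ 6 * r + 5) :
    chainEnergy J h s + 2 * J - 2 * h < J * ((6 * r + 5 : ℕ) + 2) - h * (N + 2) := by
  rcases (by omega : s ≤ 6 * r + 1 ∨ s = 6 * r + 2 ∨ s = 6 * r + 3 ∨ s = 6 * r + 4 ∨
    s = 6 * r + 6 ∨ 6 * r + 7 ≤ s) with hs | rfl | rfl | rfl | rfl | hs
  · have hs' : (s : ℝ) ≤ 6 * r + 1 := by exact_mod_cast hs
    refine chainEnergy_lt_of_mul_pos hh.le hNp (mul_pos (by push_cast; linarith) ?_)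
    push_cast
    nlinarith
  · refine chainEnergy_lt_of_pos hNp ?_
    rw [show Fin.ofNat 6 (6 * r + 2) = 2 from ofNat_six_mul_add r 2,
      show areaDefect 2 = 4 from rfl]
    push_cast
    linarith
  · refine chainEnergy_lt_of_pos hNp ?_
    rw [show Fin.ofNat 6 (6 * r + 3) = 3 from ofNat_six_mul_add r 3,
      show areaDefect 3 = 3 from rfl]
    push_cast
    linarith
  · refine chainEnergy_lt_of_pos hNp ?_
    rw [show Fin.ofNat 6 (6 * r + 4) = 4 from ofNat_six_mul_add r 4,
      show areaDefect 4 = 4 from rfl]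
    push_cast
    linarith
  · refine chainEnergy_lt_of_pos hNp ?_
    rw [show Fin.ofNat 6 (6 * r + 6) = 0 from ofNat_six_mul_add (r + 1) 0,
      show areaDefect 0 = 0 from rfl]
    push_cast
    linarith
  · have hs' : (6 : ℝ) * r + 7 ≤ s := by exact_mod_cast hs
    refine chainEnergy_lt_of_mul_pos hh.le hNp (mul_pos_of_neg_of_neg (by push_cast; linarith) ?_)
    push_cast
    nlinarith

lemma chainEnergy_lt_six_mul_add_seven {r s : ℕ} (hNp : 6 * N + 7 = (6 * r + 7) ^ 2) (hh : 0 < h)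
    (hJ : (2 * r + 2) * h < J) (hJ' : J < (2 * r + 3) * h) (hs : s ≠ 6 * r + 7) :
    chainEnergy J h s + 2 * J - 2 * h < J * ((6 * r + 7 : ℕ) + 2) - h * (N + 2) := by
  rcases (by omega : s ≤ 6 * r + 5 ∨ s = 6 * r + 6 ∨ s = 6 * r + 8 ∨ s = 6 * r + 9 ∨
    s = 6 * r + 10 ∨ 6 * r + 11 ≤ s) with hs | rfl | rfl | rfl | rfl | hs
  · have hs' : (s : ℝ) ≤ 6 * r + 5 := by exact_mod_cast hs
    refine chainEnergy_lt_of_mul_pos hh.le hNp (mul_pos (by push_cast; linarith) ?_)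
    push_cast
    nlinarith
  · refine chainEnergy_lt_of_pos hNp ?_
    rw [show Fin.ofNat 6 (6 * r + 6) = 0 from ofNat_six_mul_add (r + 1) 0,
      show areaDefect 0 = 0 from rfl]
    push_cast
    linarith
  · refine chainEnergy_lt_of_pos hNp ?_
    rw [show Fin.ofNat 6 (6 * r + 8) = 2 from ofNat_six_mul_add (r + 1) 2,
      show areaDefect 2 = 4 from rfl]
    push_cast
    linarith
  · refine chainEnergy_lt_of_pos hNp ?_
    rw [show Fin.ofNat 6 (6 * r + 9) = 3 from ofNat_six_mul_add (r + 1) 3,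
      show areaDefect 3 = 3 from rfl]
    push_cast
    linarith
  · refine chainEnergy_lt_of_pos hNp ?_
    rw [show Fin.ofNat 6 (6 * r + 10) = 4 from ofNat_six_mul_add (r + 1) 4,
      show areaDefect 4 = 4 from rfl]
    push_cast
    linarith
  · have hs' : (6 : ℝ) * r + 11 ≤ s := by exact_mod_cast hs
    refine chainEnergy_lt_of_mul_pos hh.le hNp (mul_pos_of_neg_of_neg (by push_cast; linarith) ?_)
    push_cast
    nlinarith

lemma energyBarrier_six_mul_add_five {r : ℕ} (hr : 1 ≤ r) (hL : 8 * (2 * r + 1) ^ 2 < L ^ 2)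
    (hh : 0 < h) (hJ : (2 * r + 1) * h < J) (hJ' : J < (2 * r + 2) * h) :
    EnergyBarrier L J h (6 * r ^ 2 + 10 * r + 3) (6 * r + 5) (r + 2) := by
  have hrL : 11 * r + 6 ≤ 2 * L := by
    by_contra! h
    nlinarith
  have hrh : h ≤ r * h := le_mul_of_one_le_left hh.le (by exact_mod_cast hr)
  have hNp : 6 * (6 * r ^ 2 + 10 * r + 3) + 7 = (6 * r + 5) ^ 2 := by ring
  refine ⟨hh, by linarith, by omega, hNp, by omega, by omega, by push_cast; linarith, ?_,
    fun s _ _ hs => chainEnergy_lt_six_mul_add_five hNp hh hJ hJ' hs⟩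
  push_cast
  nlinarith

lemma energyBarrier_six_mul_add_seven {r : ℕ} (hL : 8 * (2 * r + 2) ^ 2 < L ^ 2) (hh : 0 < h)
    (hJ : (2 * r + 2) * h < J) (hJ' : J < (2 * r + 3) * h) :
    EnergyBarrier L J h (6 * r ^ 2 + 14 * r + 7) (6 * r + 7) (r + 2) := by
  have hrL : 11 * r + 12 ≤ 2 * L := by
    by_contra! h
    nlinarith
  have hrh : 0 ≤ r * h := by positivity
  have hNp : 6 * (6 * r ^ 2 + 14 * r + 7) + 7 = (6 * r + 7) ^ 2 := by ring
  refine ⟨hh, by linarith, by omega, hNp, by omega, by omega, by push_cast; linarith, ?_,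
    fun s _ _ hs => chainEnergy_lt_six_mul_add_seven hNp hh hJ hJ' hs⟩
  push_cast
  nlinarith

lemma eq_criticalRadius_add_delta (hh : 0 < h) (hJ : h ≤ J) :
    J = (2 * criticalRadius J h + 1 + 2 * delta J h) * h := by
  have hnonneg : 0 ≤ J / (2 * h) - 1 / 2 := by
    rw [sub_nonneg, div_le_div_iff₀ (by norm_num) (by positivity)]
    linarith
  have hsum : (criticalRadius J h : ℝ) + delta J h = J / (2 * h) - 1 / 2 := by
    rw [criticalRadius, delta, natCast_floor_eq_intCast_floor hnonneg]
    exact Int.floor_add_fract _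
  have hcancel : J / (2 * h) * (2 * h) = J := div_mul_cancel₀ _ (by positivity)
  linear_combination (-2 * h) * hsum - hcancel

lemma lt_sq_of_le_card [NeZero L] (hh : 0 < h) {m : ℕ} (hm : m * h < J)
    (hL : (4 * J / h) ^ 2 ≤ (Fintype.card (Site (ZMod L)) : ℝ)) : 8 * m ^ 2 < L ^ 2 := by
  have hlt : (m : ℝ) < J / h := by rwa [lt_div_iff₀ hh]
  have hsq : (m : ℝ) ^ 2 < (J / h) ^ 2 := by gcongr
  rw [card_site, mul_div_assoc, mul_pow] at hL
  push_cast at hL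
  have : 8 * (m : ℝ) ^ 2 < (L : ℝ) ^ 2 := by linarith
  exact_mod_cast this

lemma exists_criticalSizes_of_delta_lt [NeZero L] (hh : 0 < h) (hJ : 2 * h ≤ J)
    (hδ : delta J h ≠ 0) (hδ' : delta J h < 1 / 2)
    (hL : (4 * J / h) ^ 2 ≤ (Fintype.card (Site (ZMod L)) : ℝ)) :
    ∃ N p M R, criticalArea J h = N + 2 ∧ CriticalSizes L N p M ∧ EnergyBarrier L J h N p R ∧
      M * h < J + (N + 2) * h := by
  have hJδ := eq_criticalRadius_add_delta hh (by linarith : h ≤ J)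
  have hδh : 0 < delta J h * h := mul_pos ((Int.fract_nonneg _).lt_of_ne' hδ) hh
  have hδh' : delta J h * h < 1 / 2 * h := by gcongr
  have hA : criticalArea J h = 6 * criticalRadius J h ^ 2 + 10 * criticalRadius J h + 3 + 2 := by
    rw [criticalArea, if_pos hδ']
  generalize criticalRadius J h = r at *
  have hr : 1 ≤ r := by
    by_contra! hr
    obtain rfl := Nat.lt_one_iff.1 hr
    push_cast at hJδ
    linarith
  have hlt : (2 * r + 1) * h < J := by linarith
  have hrL := lt_sq_of_le_card hh (m := 2 * r + 1) (by exact_mod_cast hlt) hL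
  exact ⟨_, _, _, _, hA, criticalSizes_six_mul_add_five hr hrL,
    energyBarrier_six_mul_add_five hr hrL hh hlt (by linarith), by push_cast; linarith⟩

lemma exists_criticalSizes_of_lt_delta [NeZero L] (hh : 0 < h) (hJ : h ≤ J)
    (hδ : 1 / 2 < delta J h) (hL : (4 * J / h) ^ 2 ≤ (Fintype.card (Site (ZMod L)) : ℝ)) :
    ∃ N p M R, criticalArea J h = N + 2 ∧ CriticalSizes L N p M ∧ EnergyBarrier L J h N p R ∧
      M * h < J + (N + 2) * h := by
  have hJδ := eq_criticalRadius_add_delta hh hJ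
  have hδh : 1 / 2 * h < delta J h * h := by gcongr
  have hδh' : delta J h * h < 1 * h := by
    gcongr
    exact Int.fract_lt_one _
  have hA : criticalArea J h = 6 * criticalRadius J h ^ 2 + 14 * criticalRadius J h + 7 + 2 := by
    rw [criticalArea, if_neg hδ.not_gt]
    ring
  generalize criticalRadius J h = r at *
  have hlt : (2 * r + 2) * h < J := by linarith
  have hrL := lt_sq_of_le_card hh (m := 2 * r + 2) (by exact_mod_cast hlt) hL
  exact ⟨_, _, _, _, hA, criticalSizes_six_mul_add_seven hrL,
    energyBarrier_six_mul_add_seven hrL hh hlt (by linarith), by push_cast; linarith⟩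

end Constants

end HexIsing

theorem theorem6_general (L : ℕ) [NeZero L] (J h : ℝ) (hh_pos : 0 < h) (hJ : 2 * h ≤ J)
    (hδ_zero : HexIsing.delta J h ≠ 0) (hδ_half : HexIsing.delta J h ≠ 1 / 2)
    (hL : (4 * J / h) ^ 2 ≤ (Fintype.card (HexIsing.Site (ZMod L)) : ℝ)) :
    (∀ ω : HexIsing.Path (HexIsing.allMinus L) (HexIsing.allPlus L), HexIsing.IsOptimal J h ω →
      ∃ ζ ∈ ω.support,
        ζ ∈ HexIsing.canonicalConfigs L (HexIsing.criticalArea J h) ∪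
          HexIsing.defectiveConfigs L (HexIsing.criticalArea J h)) ∧
    HexIsing.minimalGatesUnion J h (HexIsing.allMinus L) (HexIsing.allPlus L) =
      HexIsing.canonicalConfigs L (HexIsing.criticalArea J h) ∪
        HexIsing.defectiveConfigs L (HexIsing.criticalArea J h) := by
  obtain ⟨N, p, M, R, hA, hc, hB, hM⟩ : ∃ N p M R, HexIsing.criticalArea J h = N + 2 ∧
      HexIsing.CriticalSizes L N p M ∧ HexIsing.EnergyBarrier L J h N p R ∧
      M * h < J + (N + 2) * h := by
    rcases hδ_half.lt_or_gt with hδ | hδ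
    · exact HexIsing.exists_criticalSizes_of_delta_lt hh_pos hJ hδ_zero hδ hL
    · exact HexIsing.exists_criticalSizes_of_lt_delta hh_pos (by linarith) hδ hL
  rw [hA]
  exact ⟨fun _ => hc.exists_mem_gateConfigs_of_isOptimal hB hM, hc.minimalGatesUnion_eq hB hM⟩

theorem theorem6 (L : ℕ) [NeZero L] (J h : ℝ) (hh_pos : 0 < h) (hh_lt : h < 1) (hJ : 2 * h ≤ J)
    (hδ_zero : HexIsing.delta J h ≠ 0) (hδ_half : HexIsing.delta J h ≠ 1 / 2)
    (hL : (4 * J / h) ^ 2 ≤ (Fintype.card (HexIsing.Site (ZMod L)) : ℝ)) :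
    (∀ ω : HexIsing.Path (HexIsing.allMinus L) (HexIsing.allPlus L), HexIsing.IsOptimal J h ω →
      ∃ ζ ∈ ω.support,
        ζ ∈ HexIsing.canonicalConfigs L (HexIsing.criticalArea J h) ∪
          HexIsing.defectiveConfigs L (HexIsing.criticalArea J h)) ∧
    HexIsing.minimalGatesUnion J h (HexIsing.allMinus L) (HexIsing.allPlus L) =
      HexIsing.canonicalConfigs L (HexIsing.criticalArea J h) ∪
        HexIsing.defectiveConfigs L (HexIsing.criticalArea J h) :=
  theorem6_general L J h hh_pos hJ hδ_zero hδ_half hL
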